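/- Let $\Gamma$ be a finitely generated, virtually nilpotent discrete group with word length $\|\cdot\|$ with respect to a finite generating set, and let $T$ be a smooth closed (compact, without boundary) connected manifold on which $\Gamma$ acts on the right by diffeomorphisms. Let $C^0(T)\rtimes_r\Gamma$ be the reduced crossed product $C^*$-algebra, i.e. the norm completion, in the regular representation on $\ell^2(T\times\Gamma)$, of the algebra of finite sums $\sum_\gamma f_\gamma\gamma$ with $f_\gamma\in C^0(T)$ and $(f\gamma)(f'\gamma')=f\cdot f'(\,\cdot\,\gamma)\,\gamma\gamma'$. Let $$\mathcal B^\infty_\Gamma=\Bigl\{f:\Gamma\to\mathbb C \;:\; \sup_{\gamma\in\Gamma}(1+\|\gamma\|)^L|f(\gamma)|<\infty\ \ \forall L\in\mathbb N\Bigr\},$$ and let $\mathcal T^\infty=C^\infty(T,\mathcal B^\infty_\Gamma)$ be the set of all sums $\sum_{\gamma\in\Gamma}t_\gamma\gamma$ with $t_\gamma\in C^\infty(T)$ such that, for every $N\in\mathbb N$, $\sup_{\theta\in T,\,\gamma\in\Gamma}(1+\|\gamma\|)^N|t_\gamma(\theta)|<\infty$, and likewise for all (covariant) derivatives of the $t_\gamma$.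 Assume that $T$ admits a Riemannian metric for which $\Gamma$ acts by isometries. Then the sums $\sum_\gamma t_\gamma\gamma$ converge in $C^0(T)\rtimes_r\Gamma$ and determine their coefficients, so that $\mathcal T^\infty\subset C^0(T)\rtimes_r\Gamma$; $\mathcal T^\infty$ is a unital subalgebra of $C^0(T)\rtimes_r\Gamma$; and it is closed under the holomorphic functional calculus of $C^0(T)\rtimes_r\Gamma$: if $a\in\mathcal T^\infty$ and $f$ is holomorphic on an open neighbourhood of the spectrum of $a$ in $C^0(T)\rtimes_r\Gamma$, then $f(a)\in\mathcal T^\infty$. Moreover, the inclusion induces an isomorphism $$K_0(\mathcal T^\infty)\;\cong\;K_0\bigl(C^0(T)\rtimes_r\Gamma\bigr).$$ -/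

import Mathlib

open scoped Manifold ContDiff ENNReal

noncomputable section

/-! ## The group `K₀` of a ring -/

/-- Algebraic (Murray-von Neumann) equivalence of square matrices of possibly different sizes:
`p = x y` and `q = y x` for rectangular matrices `x`, `y`. -/
def MatrixEquiv {R m n : Type*} [Ring R] [Fintype m] [Fintype n]
    (p : Matrix m m R) (q : Matrix n n R) : Prop :=
  ∃ (x : Matrix m n R) (y : Matrix n m R), x * y = p ∧ y * x = q

theorem MatrixEquiv.symm {R m n : Type*} [Ring R] [Fintype m] [Fintype n]
    {p : Matrix m m R} {q : Matrix n n R} (h : MatrixEquiv p q) : MatrixEquiv q p := by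
  obtain ⟨x, y, h1, h2⟩ := h
  exact ⟨y, x, h2, h1⟩

theorem MatrixEquiv.trans {R m n k : Type*} [Ring R] [Fintype m] [Fintype n] [Fintype k]
    {p : Matrix m m R} {q : Matrix n n R} {r : Matrix k k R} (hp : p * p = p) (hr : r * r = r)
    (h : MatrixEquiv p q) (h' : MatrixEquiv q r) : MatrixEquiv p r := by
  obtain ⟨x, y, h1, h2⟩ := h
  obtain ⟨z, w, h3, h4⟩ := h'
  refine ⟨x * z, w * y, ?_, ?_⟩
  · calc x * z * (w * y) = x * (z * w) * y := by simp only [Matrix.mul_assoc]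
      _ = (x * y) * (x * y) := by rw [h3, ← h2]; simp only [Matrix.mul_assoc]
      _ = p := by rw [h1, hp]
  · calc w * y * (x * z) = w * (y * x) * z := by simp only [Matrix.mul_assoc]
      _ = (w * z) * (w * z) := by rw [h2, ← h3]; simp only [Matrix.mul_assoc]
      _ = r := by rw [h4, hr]

theorem matrixEquiv_submatrix {R m n : Type*} [Ring R] [Fintype m] [Fintype n]
    {p : Matrix m m R} (hp : p * p = p) (e : n ≃ m) : MatrixEquiv p (p.submatrix e e) := by
  refine ⟨p.submatrix id e, p.submatrix e id, ?_, ?_⟩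
  · rw [Matrix.submatrix_mul_equiv, hp, Matrix.submatrix_id_id]
  · rw [← Matrix.submatrix_mul p p e id e Function.bijective_id, hp]

theorem fromBlocks_idem {R m n : Type*} [Ring R] [Fintype m] [Fintype n]
    {p : Matrix m m R} {q : Matrix n n R} (hp : p * p = p) (hq : q * q = q) :
    Matrix.fromBlocks p 0 0 q * Matrix.fromBlocks p 0 0 q = Matrix.fromBlocks p 0 0 q := by
  simp [Matrix.fromBlocks_multiply, hp, hq]

theorem MatrixEquiv.fromBlocks {R m n m' n' : Type*} [Ring R] [Fintype m] [Fintype n]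
    [Fintype m'] [Fintype n'] {p : Matrix m m R} {q : Matrix n n R} {p' : Matrix m' m' R}
    {q' : Matrix n' n' R} (h : MatrixEquiv p p') (h' : MatrixEquiv q q') :
    MatrixEquiv (Matrix.fromBlocks p 0 0 q) (Matrix.fromBlocks p' 0 0 q') := by
  obtain ⟨x, y, h1, h2⟩ := h
  obtain ⟨z, w, h3, h4⟩ := h'
  exact ⟨Matrix.fromBlocks x 0 0 z, Matrix.fromBlocks y 0 0 w,
    by simp [Matrix.fromBlocks_multiply, h1, h3], by simp [Matrix.fromBlocks_multiply, h2, h4]⟩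

/-- An idempotent square matrix (of any size) over `R`. -/
structure IdempotentMatrix (R : Type*) [Ring R] where
  size : ℕ
  mat : Matrix (Fin size) (Fin size) R
  idem : mat * mat = mat

namespace IdempotentMatrix

/-- Idempotent matrices up to equivalence, i.e. up to isomorphism of the finitely generated
projective modules which they define. -/
instance setoid (R : Type*) [Ring R] : Setoid (IdempotentMatrix R) where
  r p q := MatrixEquiv p.mat q.mat
  iseqv :=
    { refl := fun p => ⟨p.mat, p.mat, p.idem, p.idem⟩
      symm := fun h => h.symm
      trans := fun {p _ r} h h' => h.trans p.idem r.idem h' }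

/-- The direct sum, i.e. the block diagonal matrix with blocks `p` and `q`. -/
def sum {R : Type*} [Ring R] (p q : IdempotentMatrix R) : IdempotentMatrix R where
  size := p.size + q.size
  mat := (Matrix.fromBlocks p.mat 0 0 q.mat).submatrix finSumFinEquiv.symm finSumFinEquiv.symm
  idem := by rw [Matrix.submatrix_mul_equiv, fromBlocks_idem p.idem q.idem]

theorem sum_equiv {R : Type*} [Ring R] (p q : IdempotentMatrix R) :
    MatrixEquiv (Matrix.fromBlocks p.mat 0 0 q.mat) (p.sum q).mat :=
  matrixEquiv_submatrix (fromBlocks_idem p.idem q.idem) _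

/-- The empty matrix, corresponding to the zero module. -/
def empty (R : Type*) [Ring R] : IdempotentMatrix R where
  size := 0
  mat := 0
  idem := by simp

instance isEmpty_empty (R : Type*) [Ring R] : IsEmpty (Fin (empty R).size) :=
  inferInstanceAs (IsEmpty (Fin 0))

/-- Entrywise image under a ring homomorphism. -/
def map {R R' : Type*} [Ring R] [Ring R'] (f : R →+* R') (p : IdempotentMatrix R) :
    IdempotentMatrix R' where
  size := p.size
  mat := p.mat.map f
  idem := by rw [← Matrix.map_mul, p.idem]

end IdempotentMatrix

/-- The commutative monoid `V(R)` of equivalence classes of idempotent matrices. -/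
def VMonoid (R : Type*) [Ring R] : Type _ := Quotient (IdempotentMatrix.setoid R)

namespace VMonoid

/-- The class of an idempotent matrix. -/
def mk {R : Type*} [Ring R] (p : IdempotentMatrix R) : VMonoid R := Quotient.mk _ p

theorem mk_eq {R : Type*} [Ring R] {p q : IdempotentMatrix R} (h : MatrixEquiv p.mat q.mat) :
    mk p = mk q := Quotient.sound h

/-- Addition of classes, induced by the direct sum. -/
def add {R : Type*} [Ring R] : VMonoid R → VMonoid R → VMonoid R :=
  Quotient.lift₂ (fun p q => mk (p.sum q)) fun p q p' q' h h' =>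
    mk_eq (((p.sum_equiv q).symm.trans (p.sum q).idem (fromBlocks_idem p'.idem q'.idem)
      (MatrixEquiv.fromBlocks h h')).trans (p.sum q).idem (p'.sum q').idem (p'.sum_equiv q'))

instance instAdd (R : Type*) [Ring R] : Add (VMonoid R) := ⟨add⟩

instance instZero (R : Type*) [Ring R] : Zero (VMonoid R) := ⟨mk (IdempotentMatrix.empty R)⟩

instance instAddCommMonoid (R : Type*) [Ring R] : AddCommMonoid (VMonoid R) where
  nsmul := nsmulRec
  add_assoc := by
    rintro ⟨p⟩ ⟨q⟩ ⟨r⟩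
    have hA : MatrixEquiv
        (Matrix.fromBlocks (Matrix.fromBlocks p.mat 0 0 q.mat) 0 0 r.mat)
        ((p.sum q).sum r).mat :=
      (MatrixEquiv.fromBlocks (p.sum_equiv q) ⟨r.mat, r.mat, r.idem, r.idem⟩).trans
        (fromBlocks_idem (fromBlocks_idem p.idem q.idem) r.idem) ((p.sum q).sum r).idem
        ((p.sum q).sum_equiv r)
    have hB : MatrixEquiv
        (Matrix.fromBlocks p.mat 0 0 (Matrix.fromBlocks q.mat 0 0 r.mat))
        (p.sum (q.sum r)).mat :=
      (MatrixEquiv.fromBlocks ⟨p.mat, p.mat, p.idem, p.idem⟩ (q.sum_equiv r)).trans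
        (fromBlocks_idem p.idem (fromBlocks_idem q.idem r.idem)) (p.sum (q.sum r)).idem
        (p.sum_equiv (q.sum r))
    have hC : (Matrix.fromBlocks (Matrix.fromBlocks p.mat 0 0 q.mat) 0 0 r.mat).submatrix
        (Equiv.sumAssoc _ _ _).symm (Equiv.sumAssoc _ _ _).symm =
        Matrix.fromBlocks p.mat 0 0 (Matrix.fromBlocks q.mat 0 0 r.mat) := by
      ext (i | i | i) (j | j | j) <;> rfl
    have hD := matrixEquiv_submatrix
      (fromBlocks_idem (fromBlocks_idem p.idem q.idem) r.idem) (Equiv.sumAssoc _ _ _).symm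
    rw [hC] at hD
    exact mk_eq ((hA.symm.trans ((p.sum q).sum r).idem
      (fromBlocks_idem p.idem (fromBlocks_idem q.idem r.idem)) hD).trans
      ((p.sum q).sum r).idem (p.sum (q.sum r)).idem hB)
  zero_add := by
    rintro ⟨p⟩
    have h := matrixEquiv_submatrix (fromBlocks_idem (IdempotentMatrix.empty R).idem p.idem)
      (Equiv.emptySum (Fin (IdempotentMatrix.empty R).size) (Fin p.size)).symm
    have hC : (Matrix.fromBlocks (IdempotentMatrix.empty R).mat 0 0 p.mat).submatrix
        (Equiv.emptySum _ _).symm (Equiv.emptySum _ _).symm = p.mat := by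
      ext i j; rfl
    rw [hC] at h
    exact mk_eq (((IdempotentMatrix.empty R).sum_equiv p).symm.trans
      ((IdempotentMatrix.empty R).sum p).idem p.idem h)
  add_zero := by
    rintro ⟨p⟩
    have h := matrixEquiv_submatrix (fromBlocks_idem p.idem (IdempotentMatrix.empty R).idem)
      (Equiv.sumEmpty (Fin p.size) (Fin (IdempotentMatrix.empty R).size)).symm
    have hC : (Matrix.fromBlocks p.mat 0 0 (IdempotentMatrix.empty R).mat).submatrix
        (Equiv.sumEmpty _ _).symm (Equiv.sumEmpty _ _).symm = p.mat := by
      ext i j; rfl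
    rw [hC] at h
    exact mk_eq ((p.sum_equiv (IdempotentMatrix.empty R)).symm.trans
      (p.sum (IdempotentMatrix.empty R)).idem p.idem h)
  add_comm := by
    rintro ⟨p⟩ ⟨q⟩
    have hC : (Matrix.fromBlocks p.mat 0 0 q.mat).submatrix
        (Equiv.sumComm _ _) (Equiv.sumComm _ _) = Matrix.fromBlocks q.mat 0 0 p.mat := by
      ext (i | i) (j | j) <;> rfl
    have hD := matrixEquiv_submatrix (fromBlocks_idem p.idem q.idem) (Equiv.sumComm _ _)
    rw [hC] at hD
    exact mk_eq (((p.sum_equiv q).symm.trans (p.sum q).idem (fromBlocks_idem q.idem p.idem)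
      hD).trans (p.sum q).idem (q.sum p).idem (q.sum_equiv p))

/-- Functoriality of `V`. -/
def map {R R' : Type*} [Ring R] [Ring R'] (f : R →+* R') : VMonoid R →+ VMonoid R' where
  toFun := Quotient.lift (fun p => mk (p.map f)) fun p q h => by
    obtain ⟨x, y, h1, h2⟩ := h
    have h3 : x.map f * y.map f = p.mat.map f := by rw [← Matrix.map_mul, h1]
    have h4 : y.map f * x.map f = q.mat.map f := by rw [← Matrix.map_mul, h2]
    exact mk_eq ⟨x.map f, y.map f, h3, h4⟩
  map_zero' := mk_eq ⟨0, 0, by ext i; exact i.elim0, by ext i; exact i.elim0⟩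
  map_add' := by
    rintro ⟨p⟩ ⟨q⟩
    have h : ((p.sum q).map f).mat = ((p.map f).sum (q.map f)).mat := by
      simp only [IdempotentMatrix.map, IdempotentMatrix.sum, ← Matrix.submatrix_map,
        Matrix.fromBlocks_map]
      congr 2 <;> ext <;> simp
    have h2 : MatrixEquiv ((p.sum q).map f).mat ((p.map f).sum (q.map f)).mat := by
      rw [h]
      exact ⟨_, _, ((p.map f).sum (q.map f)).idem, ((p.map f).sum (q.map f)).idem⟩
    exact mk_eq h2

end VMonoid

/-- `K₀(R)`: the Grothendieck group of `V(R)`. -/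
abbrev KZero (R : Type*) [Ring R] : Type _ := Algebra.GrothendieckAddGroup (VMonoid R)

/-- The homomorphism `K₀(R) → K₀(R')` induced by a unital ring homomorphism. -/
def KZero.map {R R' : Type*} [Ring R] [Ring R'] (f : R →+* R') : KZero R →+ KZero R' :=
  Algebra.GrothendieckAddGroup.lift (Algebra.GrothendieckAddGroup.of.comp (VMonoid.map f))

/-! ## Holomorphic functional calculus -/

/-- A cycle in `U \ K` (a finite family of closed `C¹` curves, parametrized by `[0, 1]`) which has
winding number `1` about each point of `K` and `0` about each point outside `U`. -/
structure CauchyCycle (K U : Set ℂ) where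
  n : ℕ
  loop : Fin n → ℝ → ℂ
  contDiffOn : ∀ i, ContDiffOn ℝ 1 (loop i) (Set.Icc 0 1)
  closed : ∀ i, loop i 0 = loop i 1
  mem : ∀ i, ∀ s ∈ Set.Icc (0 : ℝ) 1, loop i s ∈ U \ K
  winding_one : ∀ z ∈ K, ∑ i, ∫ s in (0 : ℝ)..1,
    (loop i s - z)⁻¹ * derivWithin (loop i) (Set.Icc 0 1) s = 2 * Real.pi * Complex.I
  winding_zero : ∀ z ∉ U, ∑ i, ∫ s in (0 : ℝ)..1,
    (loop i s - z)⁻¹ * derivWithin (loop i) (Set.Icc 0 1) s = 0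

/-- The Cauchy integral `(2πi)⁻¹ ∮ f(z) (z - a)⁻¹ dz` over the cycle `c`. -/
def CauchyCycle.integral {B : Type*} [NormedRing B] [NormedAlgebra ℂ B] {K U : Set ℂ}
    (c : CauchyCycle K U) (f : ℂ → ℂ) (a : B) : B :=
  (2 * Real.pi * Complex.I : ℂ)⁻¹ • ∑ i, ∫ s in (0 : ℝ)..1,
    (f (c.loop i s) * derivWithin (c.loop i) (Set.Icc 0 1) s) • resolvent a (c.loop i s)

/-- `b = f(a)` in the sense of the holomorphic functional calculus of the Banach algebra `B`, for
`f` holomorphic on the open neighbourhood `U` of the spectrum of `a` in `B`. -/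
def IsHolomorphicValue {B : Type*} [NormedRing B] [NormedAlgebra ℂ B] [CompleteSpace B]
    (U : Set ℂ) (f : ℂ → ℂ) (a b : B) : Prop :=
  IsOpen U ∧ spectrum ℂ a ⊆ U ∧ DifferentiableOn ℂ f U ∧
    ∃ c : CauchyCycle (spectrum ℂ a) U, c.integral f a = b

/-- The subalgebra `A` of the Banach algebra `B` is closed under the holomorphic functional
calculus of `B`. -/
def IsClosedUnderHolomorphicCalculus {B : Type*} [NormedRing B] [NormedAlgebra ℂ B]
    [CompleteSpace B] (A : Subalgebra ℂ B) : Prop :=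
  ∀ a ∈ A, ∀ (U : Set ℂ) (f : ℂ → ℂ) (b : B), IsHolomorphicValue U f a b → b ∈ A

/-! ## The reduced crossed product -/

/-- The Hilbert space `ℓ²(T × Γ)`, on which `C⁰(T) ⋊ Γ` acts by its regular representation. -/
abbrev EllTwo (T Γ : Type*) : Type _ := lp (fun _ : T × Γ => ℂ) 2

/-- The bijection `(θ, h) ↦ (θ · g, g⁻¹ h)` of `T × Γ`, for a right action of `Γ` on `T`. -/
def groupoidShift {Γ T : Type*} [Group Γ] [MulAction Γᵐᵒᵖ T] (g : Γ) : T × Γ ≃ T × Γ :=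
  (MulAction.toPerm (MulOpposite.op g)).prodCongr (Equiv.mulLeft g⁻¹)

theorem memlp_weighted {X : Type*} (c : X → ℂ) {C : ℝ} (hc : ∀ x, ‖c x‖ ≤ C) (σ : X ≃ X)
    (ξ : lp (fun _ : X => ℂ) 2) : Memℓp (E := fun _ : X => ℂ) (fun x => c x * ξ (σ x)) 2 := by
  apply memℓp_gen
  have h : Summable fun x => ‖ξ x‖ ^ (2 : ℝ≥0∞).toReal := (lp.memℓp ξ).summable (by norm_num)
  refine Summable.of_nonneg_of_le (fun x => by positivity) (fun x => ?_)
    ((h.comp_injective σ.injective).mul_left (C ^ (2 : ℝ≥0∞).toReal))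
  rw [norm_mul, Real.mul_rpow (norm_nonneg _) (norm_nonneg _)]
  exact mul_le_mul_of_nonneg_right
    (Real.rpow_le_rpow (norm_nonneg _) (hc x) (by norm_num)) (by positivity)

theorem norm_weighted_le {X : Type*} (c : X → ℂ) {C : ℝ} (hC : 0 ≤ C) (hc : ∀ x, ‖c x‖ ≤ C)
    (σ : X ≃ X) (ξ : lp (fun _ : X => ℂ) 2) :
    ‖(⟨_, memlp_weighted c hc σ ξ⟩ : lp (fun _ : X => ℂ) 2)‖ ≤ C * ‖ξ‖ := by
  refine lp.norm_le_of_forall_sum_le (by norm_num) (by positivity) fun s => ?_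
  rw [Real.mul_rpow hC (norm_nonneg _)]
  refine le_trans ?_ (mul_le_mul_of_nonneg_left
    (lp.sum_rpow_le_norm_rpow (by norm_num) ξ (s.map σ.toEmbedding)) (by positivity))
  rw [Finset.sum_map, Finset.mul_sum]
  refine Finset.sum_le_sum fun x _ => ?_
  change ‖c x * ξ (σ x)‖ ^ _ ≤ _ * ‖ξ (σ x)‖ ^ _
  rw [norm_mul, Real.mul_rpow (norm_nonneg _) (norm_nonneg _)]
  exact mul_le_mul_of_nonneg_right
    (Real.rpow_le_rpow (norm_nonneg _) (hc x) (by norm_num)) (by positivity)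

/-- The operator of the regular representation given by the monomial `f g`, `f ∈ C⁰(T)`, `g ∈ Γ`:
`(f g · ξ)(θ, h) = f(θ) ξ(θ · g, g⁻¹ h)`, i.e. left convolution by `f g` in the groupoid `T ⋊ Γ`. -/
def regularOp {Γ T : Type*} [Group Γ] [TopologicalSpace T] [CompactSpace T] [MulAction Γᵐᵒᵖ T]
    (f : C(T, ℂ)) (g : Γ) : EllTwo T Γ →L[ℂ] EllTwo T Γ :=
  LinearMap.mkContinuous
    { toFun := fun ξ => ⟨fun x => f x.1 * ξ (groupoidShift g x),
        memlp_weighted (fun x : T × Γ => f x.1) (fun x => f.norm_coe_le_norm x.1) (groupoidShift g) ξ⟩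
      map_add' := fun ξ η => by
        ext x
        exact mul_add (f x.1) (ξ (groupoidShift g x)) (η (groupoidShift g x))
      map_smul' := fun r ξ => by
        ext x
        exact mul_left_comm (f x.1) r (ξ (groupoidShift g x)) }
    ‖f‖ fun ξ => norm_weighted_le (fun x : T × Γ => f x.1) (norm_nonneg f)
      (fun x => f.norm_coe_le_norm x.1) (groupoidShift g) ξ

/-- The reduced crossed product C*-algebra `C⁰(T) ⋊_r Γ`: the norm closure of the *-algebra
generated by the operators `f g` in the regular representation. -/
abbrev ReducedCrossedProduct (Γ T : Type*) [Group Γ] [TopologicalSpace T] [CompactSpace T]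
    [MulAction Γᵐᵒᵖ T] : StarSubalgebra ℂ (EllTwo T Γ →L[ℂ] EllTwo T Γ) :=
  (StarAlgebra.adjoin ℂ {A | ∃ (f : C(T, ℂ)) (g : Γ), A = regularOp f g}).topologicalClosure

/-- The monomial `f g` as an element of `C⁰(T) ⋊_r Γ`. -/
def monomial {Γ T : Type*} [Group Γ] [TopologicalSpace T] [CompactSpace T] [MulAction Γᵐᵒᵖ T]
    (f : C(T, ℂ)) (g : Γ) : ReducedCrossedProduct Γ T :=
  ⟨regularOp f g, StarSubalgebra.le_topologicalClosure _
    (StarAlgebra.subset_adjoin ℂ _ ⟨f, g, rfl⟩)⟩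

/-! ## The rapidly decreasing algebra -/

/-- The word length of `γ` with respect to the generating set `S`. -/
def wordLength {Γ : Type*} [Group Γ] (S : Set Γ) (γ : Γ) : ℕ :=
  sInf {n | ∃ l : List Γ, l.length = n ∧ (∀ s ∈ l, s ∈ S ∨ s⁻¹ ∈ S) ∧ l.prod = γ}

/-- The families `(t_γ)` of smooth functions on the compact manifold `T` which constitute
`C^∞(T, B^∞_Γ)`: for all `N`, `(1 + ‖γ‖)^N |t_γ(θ)|` is bounded uniformly in `γ` and `θ`, together
with all derivatives of `t_γ`. The derivatives are taken in charts, over compact subsets of chart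
domains; as `T` is compact this amounts to covariant derivatives over all of `T`. -/
def IsRapidlyDecreasing {Γ E T : Type*} [Group Γ] [NormedAddCommGroup E] [NormedSpace ℝ E]
    [TopologicalSpace T] [ChartedSpace E T] (S : Set Γ)
    (t : Γ → C^∞⟮𝓘(ℝ, E), T; 𝓘(ℝ, ℂ), ℂ⟯) : Prop :=
  ∀ (θ₀ : T) (K : Set E), IsCompact K → K ⊆ (extChartAt 𝓘(ℝ, E) θ₀).target → ∀ k N : ℕ,
    ∃ C : ℝ, ∀ (γ : Γ), ∀ y ∈ K, (1 + (wordLength S γ : ℝ)) ^ N *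
      ‖iteratedFDeriv ℝ k (fun z => t γ ((extChartAt 𝓘(ℝ, E) θ₀).symm z)) y‖ ≤ C

/-- The term `t_γ γ` for a smooth function `t_γ`, as an element of `C⁰(T) ⋊_r Γ`. -/
def smoothMonomial {Γ E T : Type*} [Group Γ] [NormedAddCommGroup E] [NormedSpace ℝ E]
    [TopologicalSpace T] [ChartedSpace E T] [CompactSpace T] [MulAction Γᵐᵒᵖ T]
    (f : C^∞⟮𝓘(ℝ, E), T; 𝓘(ℝ, ℂ), ℂ⟯) (g : Γ) : ReducedCrossedProduct Γ T :=
  monomial ⟨f, f.contMDiff.continuous⟩ g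

/-- `T^∞ = C^∞(T, B^∞_Γ)` as a subset of `C⁰(T) ⋊_r Γ`: the sums `∑ t_γ γ` of rapidly decreasing
families of smooth functions. -/
def rapidlyDecreasingSet {Γ : Type*} (E T : Type*) [Group Γ] [NormedAddCommGroup E]
    [NormedSpace ℝ E] [TopologicalSpace T] [ChartedSpace E T] [CompactSpace T]
    [MulAction Γᵐᵒᵖ T] (S : Set Γ) : Set (ReducedCrossedProduct Γ T) :=
  {a | ∃ t : Γ → C^∞⟮𝓘(ℝ, E), T; 𝓘(ℝ, ℂ), ℂ⟯,
    IsRapidlyDecreasing S t ∧ HasSum (fun γ => smoothMonomial (t γ) γ) a}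

end

/-!
For `s ∈ ℝ` and `x ∈ T`, restriction of functions on `T × Γ` to the orbit of `x` gives a
representation of the crossed product `B = C⁰(T) ⋊ Γ` on `ℓ²(Γ)`; conjugate it by multiplication
with `e^{i s ‖h‖}`, where `‖·‖` is the word length. This is a family `ρ_{s,x}` of contractive unital
representations in the Banach algebra of operators on `ℓ²(Γ)` (`orbitRep`), whose matrix entries are
`e^{i s (‖h‖ - ‖k‖)} t_{h k⁻¹}(x · h⁻¹)`, where the `t_γ` are the coefficients of the element of `B`
(`matrixEntry_orbitRep`).

The proof identifies `C^∞(T, B^∞_Γ)` with the set of those `a ∈ B` for which `(s, x) ↦ ρ_{s,x}(a)`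
is smooth in the operator norm.

* Such a set is a subalgebra closed under the holomorphic functional calculus, and its matrix
  algebras are closed under inversion and under the correction of almost idempotent matrices to
  idempotent ones, since inversion and convergent power series are smooth operations in a Banach
  algebra (`isClosedUnderHolomorphicCalculus_smoothSubalgebra`,
  `isStableOnMatrices_smoothSubalgebra`). As the set is dense, idempotent matrices over `B` can be
  approximated, up to similarity, by those over the subalgebra, and similarities as well; hence the
  isomorphism in `K₀` (`bijective_vMonoidMap`, `bijective_kZeroMap`).
* If `ρ_{s,x}(a)` is smooth, the entry at `(1, γ⁻¹)` is `e^{-i s ‖γ‖} t_γ(x)`, and `N` derivatives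
  in `s` produce the factor `‖γ‖^N`: the coefficients decrease rapidly with all their derivatives
  (`exists_rapid_decay`).
* Conversely, for a rapidly decreasing family the functions `e^{i s (‖h‖ - ‖γ⁻¹ h‖)} t_γ(x · h⁻¹)`
  are smooth with derivatives bounded uniformly in `h` and rapidly decreasing in `γ`. The phase
  causes no loss, as `|‖h‖ - ‖γ⁻¹ h‖| ≤ ‖γ‖`; the translations `x ↦ x · h⁻¹` are isometries, and an
  isometry `ψ` satisfies, in charts, an equation `D²ψ = F(y, ψ, Dψ)` given by the Christoffel
  symbols, which bounds all its derivatives independently of `h`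
  (`exists_norm_iteratedFDeriv_isometry_le`). So the coefficients form a smooth map to
  `ℓ^∞(Γ × Γ)` (`IsUniformlySmooth.contDiffOn_toLinfty`). It is composed with a continuous linear
  map to the operators, which exists as `∑ (1 + ‖γ‖)^{-d} < ∞` for large `d`
  (`exists_summable_wordLength`): a finitely generated virtually nilpotent group has polynomial
  growth, by induction along the lower central series.
-/

/-! ### Growth of virtually nilpotent groups -/

/-- The elements of `G` which are products of at most `n` factors from `S ∪ S⁻¹`. -/
def wordBall {G : Type*} [Group G] (S : Set G) (n : ℕ) : Set G :=
  {g | ∃ l : List G, l.length ≤ n ∧ (∀ s ∈ l, s ∈ S ∨ s⁻¹ ∈ S) ∧ l.prod = g}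

/-- The number of products of at most `n` factors from `S ∪ S⁻¹` is bounded by a polynomial
in `n`. The set `S` need not generate `G`. -/
def HasPolynomialGrowth {G : Type*} [Group G] (S : Set G) : Prop :=
  ∃ C d : ℕ, ∀ n : ℕ, ∃ F : Finset G, wordBall S n ⊆ F ∧ F.card ≤ C * (n + 1) ^ d

section WordBall

variable {G : Type*} [Group G] {S : Set G}

theorem one_mem_wordBall (S : Set G) (n : ℕ) : (1 : G) ∈ wordBall S n :=
  ⟨[], by simp, by simp, by simp⟩

theorem wordBall_mono {m n : ℕ} (h : m ≤ n) : wordBall S m ⊆ wordBall S n := by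
  rintro g ⟨l, h1, h2, h3⟩
  exact ⟨l, h1.trans h, h2, h3⟩

theorem mul_mem_wordBall {m n : ℕ} {g h : G} (hg : g ∈ wordBall S m) (hh : h ∈ wordBall S n) :
    g * h ∈ wordBall S (m + n) := by
  obtain ⟨l, h1, h2, rfl⟩ := hg
  obtain ⟨l', h1', h2', rfl⟩ := hh
  refine ⟨l ++ l', by simp; omega, fun s hs => ?_, by simp⟩
  rcases List.mem_append.1 hs with hs | hs
  exacts [h2 s hs, h2' s hs]

theorem inv_mem_wordBall {n : ℕ} {g : G} (hg : g ∈ wordBall S n) : g⁻¹ ∈ wordBall S n := by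
  obtain ⟨l, h1, h2, rfl⟩ := hg
  refine ⟨(l.map (·⁻¹)).reverse, by simpa using h1, fun s hs => ?_, ?_⟩
  · simp only [List.mem_reverse, List.mem_map] at hs
    obtain ⟨t, ht, rfl⟩ := hs
    simpa using (h2 t ht).symm
  · rw [List.prod_inv_reverse]

theorem mem_wordBall_one {s : G} (hs : s ∈ S) : s ∈ wordBall S 1 :=
  ⟨[s], by simp, by simpa using Or.inl hs, by simp⟩

/-- The iterated commutators `[s, a, …, a]`, with `i` entries `a`. -/
def iterComm (a s : G) : ℕ → G
  | 0 => s
  | i + 1 => (iterComm a s i)⁻¹ * (a⁻¹ * iterComm a s i * a)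

theorem conj_iterComm (a s : G) (i : ℕ) :
    a⁻¹ * iterComm a s i * a = iterComm a s i * iterComm a s (i + 1) := by
  simp [iterComm]

/-- Conjugating an iterated commutator by `a ^ k` multiplies its word length at most by a
polynomial in `k`, since `a⁻¹ xᵢ a = xᵢ xᵢ₊₁`. -/
theorem conj_pow_mem_wordBall {a s : G} {c : ℕ} (hc : iterComm a s c = 1)
    (hS : ∀ i < c, iterComm a s i ∈ S) (m i k : ℕ) (hm : i + m = c) :
    (a ^ k)⁻¹ * iterComm a s i * a ^ k ∈ wordBall S ((k + 1) ^ m) ∧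
      a ^ k * iterComm a s i * (a ^ k)⁻¹ ∈ wordBall S ((k + 1) ^ m) := by
  induction m generalizing i k with
  | zero =>
    rw [show i = c by omega, hc]
    simp [one_mem_wordBall]
  | succ m ihm =>
    induction k with
    | zero => simpa using mem_wordBall_one (hS i (by omega))
    | succ k ihk =>
      constructor
      · have h := mul_mem_wordBall ihk.1 (ihm (i + 1) k (by omega)).1
        refine wordBall_mono ?_ (?_ : _ ∈ wordBall S ((k + 1) ^ (m + 1) + (k + 1) ^ m))
        · calc (k + 1) ^ (m + 1) + (k + 1) ^ m = (k + 1) ^ m * (k + 1 + 1) := by ring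
            _ ≤ (k + 1 + 1) ^ m * (k + 1 + 1) := by gcongr; omega
            _ = _ := by ring
        · convert h using 1
          calc (a ^ (k + 1))⁻¹ * iterComm a s i * a ^ (k + 1)
              = (a ^ k)⁻¹ * (a⁻¹ * iterComm a s i * a) * a ^ k := by
                rw [pow_succ']; group
            _ = _ := by rw [conj_iterComm]; group
      · have h := mul_mem_wordBall ihk.2 (inv_mem_wordBall (ihm (i + 1) (k + 1) (by omega)).2)
        refine wordBall_mono ?_ (?_ : _ ∈ wordBall S ((k + 1) ^ (m + 1) + (k + 1 + 1) ^ m))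
        · calc (k + 1) ^ (m + 1) + (k + 1 + 1) ^ m = (k + 1) ^ m * (k + 1) + (k + 1 + 1) ^ m := by
                ring
            _ ≤ (k + 1 + 1) ^ m * (k + 1) + (k + 1 + 1) ^ m := by gcongr; omega
            _ = _ := by ring
        · convert h using 1
          have h1 : a ^ k * iterComm a s i * (a ^ k)⁻¹ =
              a ^ (k + 1) * (iterComm a s i * iterComm a s (i + 1)) * (a ^ (k + 1))⁻¹ := by
            rw [← conj_iterComm, pow_succ]; group
          rw [h1]; group

theorem conj_zpow_mem_wordBall {a s : G} {c : ℕ} (hc : iterComm a s c = 1)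
    (hS : ∀ i < c, iterComm a s i ∈ S) (k : ℤ) :
    (a ^ k)⁻¹ * s * a ^ k ∈ wordBall S ((k.natAbs + 1) ^ c) := by
  have h := conj_pow_mem_wordBall hc hS c 0 k.natAbs (by omega)
  rcases Int.natAbs_eq k with hk | hk
  · rw [show a ^ k = a ^ k.natAbs by rw [← zpow_natCast, ← hk]]
    exact h.1
  · rw [show a ^ k = (a ^ k.natAbs)⁻¹ by rw [← zpow_natCast, ← zpow_neg, ← hk], inv_inv]
    exact h.2

/-- Collecting the letters `a` on the left of a word. -/
theorem wordBall_insert_subset {a : G} {c : ℕ} {S'' : Set G}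
    (hc : ∀ s ∈ S, iterComm a s c = 1) (hS : ∀ s ∈ S, ∀ i < c, iterComm a s i ∈ S'') (n : ℕ)
    {g : G} (hg : g ∈ wordBall (insert a S) n) :
    ∃ k : ℤ, k.natAbs ≤ n ∧ ∃ u ∈ wordBall S'' (n * (n + 1) ^ c), g = a ^ k * u := by
  obtain ⟨l, h1, h2, rfl⟩ := hg
  induction l generalizing n with
  | nil => exact ⟨0, by simp, 1, one_mem_wordBall _ _, by simp⟩
  | cons s l ih =>
    obtain ⟨n, rfl⟩ : ∃ m, n = m + 1 := ⟨n - 1, by simp at h1; omega⟩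
    obtain ⟨k, hk, u, hu, hl⟩ := ih n (by simpa using h1) fun t ht => h2 t (by simp [ht])
    have hle : n * (n + 1) ^ c ≤ (n + 1) * (n + 1 + 1) ^ c := by gcongr <;> omega
    have hle2 : (k.natAbs + 1) ^ c + n * (n + 1) ^ c ≤ (n + 1) * (n + 1 + 1) ^ c := by
      calc (k.natAbs + 1) ^ c + n * (n + 1) ^ c
          ≤ (n + 1 + 1) ^ c + n * (n + 1 + 1) ^ c := by gcongr <;> omega
        _ = _ := by ring
    rw [List.prod_cons, hl]
    rcases h2 s (by simp) with (rfl | hs) | (hs | hs)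
    · exact ⟨k + 1, by omega, u, wordBall_mono hle hu, by rw [add_comm, zpow_add]; group⟩
    · refine ⟨k, by omega, _, wordBall_mono hle2 (mul_mem_wordBall
        (conj_zpow_mem_wordBall (hc s hs) (hS s hs) k) hu), by group⟩
    · refine ⟨k - 1, by omega, u, wordBall_mono hle hu, ?_⟩
      rw [inv_eq_iff_eq_inv.1 hs, sub_eq_neg_add, zpow_add]; group
    · refine ⟨k, by omega, _, wordBall_mono hle2 (mul_mem_wordBall (inv_mem_wordBall
        (conj_zpow_mem_wordBall (hc _ hs) (hS _ hs) k)) hu), by group⟩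

theorem HasPolynomialGrowth.insert {a : G} {c : ℕ} {S'' : Set G}
    (hc : ∀ s ∈ S, iterComm a s c = 1) (hS : ∀ s ∈ S, ∀ i < c, iterComm a s i ∈ S'')
    (h : HasPolynomialGrowth S'') : HasPolynomialGrowth (insert a S) := by
  classical
  obtain ⟨C, d, h⟩ := h
  refine ⟨2 * C, 1 + (c + 1) * d, fun n => ?_⟩
  obtain ⟨F, hF, hcard⟩ := h (n * (n + 1) ^ c)
  refine ⟨Finset.image₂ (fun (k : ℤ) u => a ^ k * u) (Finset.Icc (-n : ℤ) n) F, ?_, ?_⟩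
  · intro g hg
    obtain ⟨k, hk, u, hu, rfl⟩ := wordBall_insert_subset hc hS n hg
    rw [Finset.mem_coe, Finset.mem_image₂]
    exact ⟨k, by rw [Finset.mem_Icc]; omega, u, hF hu, rfl⟩
  · refine (Finset.card_image₂_le _ _ _).trans ?_
    have h1 : (Finset.Icc (-n : ℤ) n).card ≤ 2 * (n + 1) := by simp; omega
    have h2 : n * (n + 1) ^ c + 1 ≤ (n + 1) ^ (c + 1) := by
      have : 1 ≤ (n + 1) ^ c := Nat.one_le_pow _ _ (by omega)
      calc n * (n + 1) ^ c + 1 ≤ n * (n + 1) ^ c + (n + 1) ^ c := by omega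
        _ = _ := by ring
    calc _ ≤ (2 * (n + 1)) * (C * ((n + 1) ^ (c + 1)) ^ d) :=
          Nat.mul_le_mul h1 (hcard.trans (by gcongr))
      _ = _ := by rw [← pow_mul]; ring

theorem HasPolynomialGrowth.mono {S' : Set G} (hS : S ⊆ S') (h : HasPolynomialGrowth S') :
    HasPolynomialGrowth S := by
  obtain ⟨C, d, h⟩ := h
  refine ⟨C, d, fun n => ?_⟩
  obtain ⟨F, hF, hcard⟩ := h n
  refine ⟨F, fun g hg => hF ?_, hcard⟩
  obtain ⟨l, h1, h2, h3⟩ := hg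
  exact ⟨l, h1, fun s hs => (h2 s hs).imp (@hS _) (@hS _), h3⟩

theorem iterComm_mem_lowerCentralSeries {a s : G} {w : ℕ}
    (hs : s ∈ Subgroup.lowerCentralSeries (⊤ : Subgroup G) w)
    (i : ℕ) : iterComm a s i ∈ Subgroup.lowerCentralSeries (⊤ : Subgroup G) (w + i) := by
  induction i with
  | zero => exact hs
  | succ i ih =>
    rw [← add_assoc, Subgroup.lowerCentralSeries_succ]
    have h := Subgroup.commutator_mem_commutator (Subgroup.inv_mem _ ih)
      (Subgroup.mem_top a⁻¹)
    convert h using 1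
    simp [iterComm, commutatorElement_def]; group

/-- Finite subsets of a nilpotent group have polynomial growth: by descending induction along the
lower central series, the elements of lowest weight are collected one at a time, which replaces
them by iterated commutators of higher weight. -/
theorem hasPolynomialGrowth_of_isNilpotent [Group.IsNilpotent G] (hS : S.Finite) :
    HasPolynomialGrowth S := by
  obtain ⟨c, hc⟩ := Subgroup.nilpotent_iff_lowerCentralSeries.1
    (inferInstance : Group.IsNilpotent G)
  have key : ∀ m w, w + m = c → ∀ S : Set G, S.Finite →
      S ⊆ ↑(Subgroup.lowerCentralSeries (⊤ : Subgroup G) w) → HasPolynomialGrowth S := by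
    intro m
    induction m with
    | zero =>
      intro w hw S _ hSw
      rw [show w = c by omega, hc] at hSw
      refine ⟨1, 0, fun n => ⟨{1}, ?_, by simp⟩⟩
      rintro g ⟨l, -, h2, rfl⟩
      have h0 : ∀ s ∈ l, s = 1 := fun s hs => by
        rcases h2 s hs with h | h
        · simpa using hSw h
        · simpa using hSw h
      simp [List.prod_eq_one h0]
    | succ m ih =>
      intro w hw S hS hSw
      have key2 : ∀ S₀ : Set G, S₀.Finite → S₀ ⊆ ↑(Subgroup.lowerCentralSeries (⊤ : Subgroup G) w) →
          ∀ S₁ : Set G, S₁.Finite → S₁ ⊆ ↑(Subgroup.lowerCentralSeries (⊤ : Subgroup G) (w + 1)) →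
          HasPolynomialGrowth (S₀ ∪ S₁) := by
        intro S₀ hS₀
        induction S₀, hS₀ using Set.Finite.induction_on with
        | empty =>
          intro _ S₁ hf hS₁
          rw [Set.empty_union]
          exact ih (w + 1) (by omega) S₁ hf hS₁
        | @insert a S₀ _ hS₀ ih2 =>
          intro hw0 S₁ hf hS₁
          rw [Set.insert_union]
          have hsub : ∀ s ∈ S₀ ∪ S₁, s ∈ Subgroup.lowerCentralSeries (⊤ : Subgroup G) w := by
            rintro s (hs | hs)
            · exact hw0 (Set.mem_insert_of_mem _ hs)
            · exact Subgroup.lowerCentralSeries_antitone _ (Nat.le_succ w) (hS₁ hs)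
          have hfin : ((S₀ ∪ S₁) ×ˢ (Set.Iio c : Set ℕ)).Finite :=
            (hS₀.union hf).prod (Set.finite_Iio c)
          refine HasPolynomialGrowth.insert (c := c)
            (S'' := S₀ ∪ (S₁ ∪ (fun q : G × ℕ => iterComm a q.1 (q.2 + 1)) ''
              ((S₀ ∪ S₁) ×ˢ (Set.Iio c : Set ℕ)))) ?_ ?_
            (ih2 (fun s hs => hw0 (Set.mem_insert_of_mem _ hs)) _ (hf.union (hfin.image _)) ?_)
          · intro s hs
            have := Subgroup.lowerCentralSeries_antitone _ (show c ≤ w + c by omega)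
              (iterComm_mem_lowerCentralSeries (a := a) (hsub s hs) c)
            rw [hc] at this
            simpa using this
          · rintro s hs (_ | i) hi
            · rcases hs with hs | hs
              · exact Or.inl hs
              · exact Or.inr (Or.inl hs)
            · exact Or.inr (Or.inr ⟨(s, i), ⟨hs, (Nat.lt_succ_self i).trans hi⟩, rfl⟩)
          · rintro x (hx | ⟨⟨s, i⟩, ⟨hs, -⟩, rfl⟩)
            · exact hS₁ hx
            · exact Subgroup.lowerCentralSeries_antitone _ (show w + 1 ≤ w + (i + 1) by omega)
                (iterComm_mem_lowerCentralSeries (hsub s hs) (i + 1))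
      simpa using key2 S hS hSw ∅ Set.finite_empty (Set.empty_subset _)
  exact key c 0 (by omega) S hS (by simp)

/-- Passage from a subgroup of finite index, by Schreier generators. -/
theorem hasPolynomialGrowth_of_isVirtuallyNilpotent (hG : Group.IsVirtuallyNilpotent G)
    (hS : S.Finite) : HasPolynomialGrowth S := by
  classical
  obtain ⟨N, hN, hfin⟩ := hG
  let r : G → G := fun g => (Quotient.out (QuotientGroup.mk g⁻¹ : G ⧸ N))⁻¹
  have hr : ∀ g, g * (r g)⁻¹ ∈ N := fun g => by
    have h := QuotientGroup.mk_out_eq_mul N g⁻¹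
    obtain ⟨n, hn⟩ := h
    simp only [r, inv_inv, hn]
    simp
  let R : Set G := Set.range r
  have hR : R.Finite := by
    have : R ⊆ Set.range fun q : G ⧸ N => (Quotient.out q)⁻¹ := by
      rintro _ ⟨g, rfl⟩
      exact ⟨_, rfl⟩
    exact (Set.finite_range _).subset this
  let P : Set (G × G) := R ×ˢ (S ∪ S⁻¹ ∪ {1})
  have hP : P.Finite := hR.prod ((hS.union hS.inv).union (Set.finite_singleton 1))
  let T : Set N := (fun p : G × G => (⟨p.1 * p.2 * (r (p.1 * p.2))⁻¹, hr _⟩ : N)) '' P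
  obtain ⟨C, d, h⟩ := hasPolynomialGrowth_of_isNilpotent (hP.image _ : T.Finite)
  -- the letters are read from left to right, starting at the representative of `1`
  have key : ∀ l : List G, (∀ s ∈ l, s ∈ S ∨ s⁻¹ ∈ S) → ∀ n, l.length ≤ n → ∀ q ∈ R,
      ∃ u ∈ wordBall T n, ∃ q' ∈ R, q * l.prod = u * q' := by
    intro l
    induction l with
    | nil => exact fun _ n _ q hq => ⟨1, one_mem_wordBall _ _, q, hq, by simp⟩
    | cons s l ih =>
      intro hl n hn q hq
      obtain ⟨n, rfl⟩ : ∃ m, n = m + 1 := ⟨n - 1, by simp at hn; omega⟩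
      obtain ⟨u, hu, q', hq', h'⟩ := ih (fun t ht => hl t (by simp [ht])) n (by simpa using hn)
        (r (q * s)) ⟨_, rfl⟩
      refine ⟨⟨q * s * (r (q * s))⁻¹, hr _⟩ * u, ?_, q', hq', ?_⟩
      · rw [add_comm]
        refine mul_mem_wordBall (mem_wordBall_one ⟨(q, s), ⟨hq, Or.inl ?_⟩, rfl⟩) hu
        simpa using hl s (by simp)
      · rw [Subgroup.coe_mul, mul_assoc (_ : G) (u : G), ← h', List.prod_cons]
        group
  refine ⟨C * hR.toFinset.card, d, fun n => ?_⟩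
  obtain ⟨F, hF, hcard⟩ := h n
  refine ⟨Finset.image₂ (fun (u : N) q => (r 1)⁻¹ * (u * q)) F hR.toFinset, ?_, ?_⟩
  · rintro g ⟨l, h1, h2, rfl⟩
    obtain ⟨u, hu, q', hq', h'⟩ := key l h2 n h1 (r 1) ⟨1, rfl⟩
    rw [Finset.mem_coe, Finset.mem_image₂]
    exact ⟨u, hF hu, q', by simpa using hq', by rw [← h']; group⟩
  · refine (Finset.card_image₂_le _ _ _).trans ?_
    calc _ ≤ (C * (n + 1) ^ d) * hR.toFinset.card := Nat.mul_le_mul_right _ hcard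
      _ = _ := by ring

/-! ### The word length -/

theorem exists_list_of_closure_eq_top (hS : Subgroup.closure S = ⊤) (g : G) :
    ∃ l : List G, (∀ s ∈ l, s ∈ S ∨ s⁻¹ ∈ S) ∧ l.prod = g := by
  have hg : g ∈ Submonoid.closure (S ∪ S⁻¹) := by
    rw [← Subgroup.closure_toSubmonoid, hS]; trivial
  simpa using Submonoid.exists_list_of_mem_closure hg

theorem exists_list_length_eq_wordLength (hS : Subgroup.closure S = ⊤) (g : G) :
    ∃ l : List G, l.length = wordLength S g ∧ (∀ s ∈ l, s ∈ S ∨ s⁻¹ ∈ S) ∧ l.prod = g := by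
  obtain ⟨l, h1, h2⟩ := exists_list_of_closure_eq_top hS g
  exact Nat.sInf_mem (s := {n | ∃ l : List G, l.length = n ∧ (∀ s ∈ l, s ∈ S ∨ s⁻¹ ∈ S) ∧
    l.prod = g}) ⟨_, l, rfl, h1, h2⟩

theorem wordLength_le {g : G} {n : ℕ} (hg : g ∈ wordBall S n) : wordLength S g ≤ n := by
  obtain ⟨l, h1, h2⟩ := hg
  have h : wordLength S g ≤ l.length := Nat.sInf_le ⟨l, rfl, h2⟩
  exact h.trans h1

theorem mem_wordBall_wordLength (hS : Subgroup.closure S = ⊤) (g : G) :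
    g ∈ wordBall S (wordLength S g) := by
  obtain ⟨l, h1, h2⟩ := exists_list_length_eq_wordLength hS g
  exact ⟨l, h1.le, h2⟩

theorem wordLength_mul_le (hS : Subgroup.closure S = ⊤) (g h : G) :
    wordLength S (g * h) ≤ wordLength S g + wordLength S h :=
  wordLength_le (mul_mem_wordBall (mem_wordBall_wordLength hS g) (mem_wordBall_wordLength hS h))

theorem wordLength_inv_le (hS : Subgroup.closure S = ⊤) (g : G) :
    wordLength S g⁻¹ ≤ wordLength S g :=
  wordLength_le (inv_mem_wordBall (mem_wordBall_wordLength hS g))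

theorem wordLength_inv (hS : Subgroup.closure S = ⊤) (g : G) :
    wordLength S g⁻¹ = wordLength S g :=
  (wordLength_inv_le hS g).antisymm (by simpa using wordLength_inv_le hS g⁻¹)

theorem wordLength_one : wordLength S (1 : G) = 0 :=
  Nat.le_zero.1 (wordLength_le (one_mem_wordBall S 0))

theorem abs_wordLength_sub_le (hS : Subgroup.closure S = ⊤) (g h : G) :
    |(wordLength S h : ℝ) - wordLength S (g⁻¹ * h)| ≤ wordLength S g := by
  have h1 := wordLength_mul_le hS g (g⁻¹ * h)
  have h2 := wordLength_mul_le hS g⁻¹ h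
  rw [mul_inv_cancel_left] at h1
  rw [wordLength_inv hS] at h2
  rw [abs_sub_le_iff]
  constructor <;> rw [sub_le_iff_le_add] <;> exact_mod_cast (by omega)

/-- In a finitely generated virtually nilpotent group, some negative power of the word length is
summable. -/
theorem exists_summable_wordLength (hG : Group.IsVirtuallyNilpotent G) (hfin : S.Finite)
    (hS : Subgroup.closure S = ⊤) :
    ∃ d : ℕ, Summable fun g : G => ((1 + (wordLength S g : ℝ)) ^ d)⁻¹ := by
  classical
  obtain ⟨C, d, h⟩ := hasPolynomialGrowth_of_isVirtuallyNilpotent hG hfin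
  refine ⟨d + 2, ?_⟩
  have hfib : ∀ n : ℕ, ∃ F : Finset G, wordBall S n ⊆ F ∧ (F.card : ℝ) ≤ C * (n + 1) ^ d := by
    intro n
    obtain ⟨F, hF, hcard⟩ := h n
    exact ⟨F, hF, by exact_mod_cast hcard⟩
  have hs : Summable fun n : ℕ => (C : ℝ) * (1 / ((n : ℝ) + 1) ^ 2) :=
    ((summable_nat_add_iff 1 (f := fun n : ℕ => 1 / (n : ℝ) ^ 2)).2
      (Real.summable_one_div_nat_pow.2 one_lt_two) |>.congr (by intro n; simp)).mul_left _
  refine summable_of_sum_le (c := ∑' n : ℕ, (C : ℝ) * (1 / ((n : ℝ) + 1) ^ 2))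
    (fun g => by positivity) fun u => ?_
  let t := u.image (wordLength S)
  have hmaps : ∀ g ∈ u, wordLength S g ∈ t := fun g hg => Finset.mem_image_of_mem _ hg
  rw [← Finset.sum_fiberwise_of_maps_to hmaps]
  refine le_trans (Finset.sum_le_sum fun n _ => ?_) (hs.sum_le_tsum t fun n _ => by positivity)
  obtain ⟨F, hF, hcard⟩ := hfib n
  calc ∑ g ∈ u with wordLength S g = n, ((1 + (wordLength S g : ℝ)) ^ (d + 2))⁻¹
      = ∑ g ∈ u with wordLength S g = n, ((1 + (n : ℝ)) ^ (d + 2))⁻¹ :=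
        Finset.sum_congr rfl fun g hg => by rw [(Finset.mem_filter.1 hg).2]
    _ = (u.filter (fun g => wordLength S g = n)).card * ((1 + (n : ℝ)) ^ (d + 2))⁻¹ := by
        rw [Finset.sum_const, nsmul_eq_mul]
    _ ≤ (C * (n + 1) ^ d) * ((1 + (n : ℝ)) ^ (d + 2))⁻¹ := by
        gcongr
        refine le_trans ?_ hcard
        exact_mod_cast Finset.card_le_card (s := u.filter fun g => wordLength S g = n)
          fun g hg => hF
          ((Finset.mem_filter.1 hg).2 ▸ mem_wordBall_wordLength hS g)
    _ = C * (1 / ((n : ℝ) + 1) ^ 2) := by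
        rw [add_comm (1 : ℝ), pow_add]
        field_simp

end WordBall

/-! ### Elements with smooth image under a family of representations -/

theorem map_ringInverse {R R' F : Type*} [Ring R] [Ring R'] [FunLike F R R']
    [MonoidHomClass F R R'] (φ : F) {x : R} (hx : IsUnit x) :
    φ (Ring.inverse x) = Ring.inverse (φ x) := by
  obtain ⟨u, rfl⟩ := hx
  rw [Ring.inverse_unit]
  exact (Ring.inverse_unit (Units.map (φ : R →* R') u)).symm

section SmoothSubalgebra

variable {B 𝓛 V κ : Type*} [NormedRing B] [NormedAlgebra ℂ B]
  [NormedRing 𝓛] [NormedAlgebra ℂ 𝓛]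
  [NormedAddCommGroup V] [NormedSpace ℝ V]

/-- The elements `a` of `B` for which all the maps `y ↦ ρ k y a` are smooth on `U k`, where
the `ρ k y` are representations of `B` in the Banach algebra `𝓛`. The index `k` stands for a
chart of the parameter space of the family, with coordinate `y`. -/
def smoothSubalgebra (ρ : κ → V → B →ₐ[ℂ] 𝓛) (U : κ → Set V) : Subalgebra ℂ B where
  carrier := {a | ∀ k, ContDiffOn ℝ ∞ (fun y => ρ k y a) (U k)}
  mul_mem' := fun {a b} ha hb k => by
    simpa only [map_mul] using (ha k).mul (hb k)
  add_mem' := fun {a b} ha hb k => by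
    simpa only [map_add] using (ha k).add (hb k)
  algebraMap_mem' := fun r k => by
    simpa only [AlgHom.commutes] using contDiffOn_const

variable {ρ : κ → V → B →ₐ[ℂ] 𝓛} {U : κ → Set V}

theorem ringInverse_mem_smoothSubalgebra [CompleteSpace 𝓛] {a : B}
    (ha : a ∈ smoothSubalgebra ρ U) (hu : IsUnit a) :
    Ring.inverse a ∈ smoothSubalgebra ρ U := by
  intro k y hy
  simp only [map_ringInverse _ hu]
  obtain ⟨u, hu'⟩ := hu.map (ρ k y)
  have h := contDiffAt_ringInverse ℝ (n := ∞) u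
  rw [hu'] at h
  exact h.comp_contDiffWithinAt y (ha k y hy)

/-! ### Holomorphic functional calculus -/

/-- Integration of a continuous `𝓛`-valued function over the unit interval. -/
noncomputable def unitIntervalIntegral (𝓛 : Type*) [NormedRing 𝓛] [NormedAlgebra ℂ 𝓛] :
    C(Set.Icc (0 : ℝ) 1, 𝓛) →L[ℝ] 𝓛 :=
  LinearMap.mkContinuous
    { toFun := fun g => ∫ s in (0 : ℝ)..1, g (Set.projIcc 0 1 zero_le_one s)
      map_add' := fun g h => by
        simp only [ContinuousMap.add_apply]
        exact intervalIntegral.integral_add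
          (g.continuous.comp continuous_projIcc).continuousOn.intervalIntegrable
          (h.continuous.comp continuous_projIcc).continuousOn.intervalIntegrable
      map_smul' := fun r g => by
        simp only [ContinuousMap.smul_apply, RingHom.id_apply]
        exact intervalIntegral.integral_smul r _ }
    1 fun g => by
      have h := intervalIntegral.norm_integral_le_of_norm_le_const (a := (0 : ℝ)) (b := 1)
        (f := fun s => g (Set.projIcc 0 1 zero_le_one s)) (C := ‖g‖)
        fun s _ => g.norm_coe_le_norm _
      simpa using h

theorem unitIntervalIntegral_apply (g : C(Set.Icc (0 : ℝ) 1, 𝓛)) :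
    unitIntervalIntegral 𝓛 g = ∫ s in (0 : ℝ)..1, g (Set.projIcc 0 1 zero_le_one s) := rfl

theorem continuousOn_resolvent [CompleteSpace B] (a : B) :
    ContinuousOn (resolvent a) (resolventSet ℂ a) := fun _ hz =>
  (spectrum.hasDerivAt_resolvent_const_left hz).continuousAt.continuousWithinAt

/-- The constant functions in `C([0, 1], 𝓛)`. -/
noncomputable def constCurve (𝓛 : Type*) [NormedRing 𝓛] [NormedAlgebra ℂ 𝓛] :
    𝓛 →L[ℝ] C(Set.Icc (0 : ℝ) 1, 𝓛) :=
  LinearMap.mkContinuous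
    { toFun := fun x => ContinuousMap.const _ x
      map_add' := fun _ _ => rfl
      map_smul' := fun _ _ => rfl }
    1 fun x => by
      rw [one_mul]
      exact (ContinuousMap.norm_le _ (norm_nonneg x)).2 fun _ => le_rfl

/-- A scalar curve as a curve of scalar multiples of the identity in `𝓛`. -/
noncomputable def scalarCurve (𝓛 : Type*) [NormedRing 𝓛] [NormedAlgebra ℂ 𝓛]
    (c : C(Set.Icc (0 : ℝ) 1, ℂ)) : C(Set.Icc (0 : ℝ) 1, 𝓛) :=
  ⟨fun s => algebraMap ℂ 𝓛 (c s), (algebraMapCLM ℂ 𝓛).continuous.comp c.continuous⟩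

theorem scalarCurve_apply (c : C(Set.Icc (0 : ℝ) 1, ℂ)) (s : Set.Icc (0 : ℝ) 1) :
    scalarCurve 𝓛 c s = algebraMap ℂ 𝓛 (c s) := rfl

theorem isUnit_scalarCurve_sub [CompleteSpace 𝓛] (c : C(Set.Icc (0 : ℝ) 1, ℂ))
    {b : 𝓛} (hb : ∀ s, c s ∈ resolventSet ℂ b) : IsUnit (scalarCurve 𝓛 c - constCurve 𝓛 b) := by
  rw [ContinuousMap.isUnit_iff_forall_isUnit]
  exact fun s => spectrum.mem_resolventSet_iff.1 (hb s)

/-- The Cauchy integral over a curve is a smooth function of the Banach algebra element: it is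
obtained from inversion in the Banach algebra `C([0, 1], 𝓛)` by continuous linear operations. -/
theorem contDiffAt_curveIntegral_resolvent [CompleteSpace 𝓛] (w c : C(Set.Icc (0 : ℝ) 1, ℂ))
    {b : 𝓛} (hb : ∀ s, c s ∈ resolventSet ℂ b) :
    ContDiffAt ℝ ∞ (fun x : 𝓛 => unitIntervalIntegral 𝓛
      (scalarCurve 𝓛 w * Ring.inverse (scalarCurve 𝓛 c - constCurve 𝓛 x))) b := by
  obtain ⟨u, hu⟩ := isUnit_scalarCurve_sub c hb
  have h := contDiffAt_ringInverse ℝ (n := ∞) u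
  rw [hu] at h
  exact (unitIntervalIntegral 𝓛).contDiff.contDiffAt.comp b (contDiffAt_const.mul
    (h.comp b (contDiffAt_const.sub (constCurve 𝓛).contDiff.contDiffAt)))

theorem curveIntegral_resolvent_eq [CompleteSpace 𝓛] (w c : C(Set.Icc (0 : ℝ) 1, ℂ))
    {b : 𝓛} (hb : ∀ s, c s ∈ resolventSet ℂ b) :
    unitIntervalIntegral 𝓛 (scalarCurve 𝓛 w * Ring.inverse (scalarCurve 𝓛 c - constCurve 𝓛 b)) =
      ∫ s in (0 : ℝ)..1, w (Set.projIcc 0 1 zero_le_one s) •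
        resolvent b (c (Set.projIcc 0 1 zero_le_one s)) := by
  rw [unitIntervalIntegral_apply]
  congr 1
  funext s
  have h : (Ring.inverse (scalarCurve 𝓛 c - constCurve 𝓛 b))
      (Set.projIcc 0 1 zero_le_one s) = resolvent b (c (Set.projIcc 0 1 zero_le_one s)) :=
    map_ringInverse ((Pi.evalRingHom _ (Set.projIcc (0 : ℝ) 1 zero_le_one s)).comp
      ContinuousMap.coeFnRingHom)
      (isUnit_scalarCurve_sub c hb)
  rw [ContinuousMap.mul_apply, h, scalarCurve_apply, Algebra.smul_def]

theorem mem_resolventSet_map (φ : B →ₐ[ℂ] 𝓛) {a : B} {z : ℂ} (hz : z ∈ resolventSet ℂ a) :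
    z ∈ resolventSet ℂ (φ a) := by
  have h := IsUnit.map φ (spectrum.mem_resolventSet_iff.1 hz)
  rwa [map_sub, AlgHom.commutes] at h

theorem map_resolvent (φ : B →ₐ[ℂ] 𝓛) {a : B} {z : ℂ} (hz : z ∈ resolventSet ℂ a) :
    φ (resolvent a z) = resolvent (φ a) z := by
  rw [resolvent, map_ringInverse φ (spectrum.mem_resolventSet_iff.1 hz), map_sub,
    AlgHom.commutes, resolvent]

theorem isClosedUnderHolomorphicCalculus_smoothSubalgebra [CompleteSpace B] [CompleteSpace 𝓛]
    (hρ : ∀ k y a, ‖ρ k y a‖ ≤ ‖a‖) :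
    IsClosedUnderHolomorphicCalculus (smoothSubalgebra ρ U) := by
  rintro a ha W f b ⟨hW, haW, hf, c, rfl⟩
  have hmem : ∀ i, ∀ s ∈ Set.Icc (0 : ℝ) 1, c.loop i s ∈ resolventSet ℂ a := fun i s hs =>
    not_not.1 (c.mem i s hs).2
  have hcont : ∀ i, ContinuousOn (c.loop i) (Set.Icc 0 1) := fun i => (c.contDiffOn i).continuousOn
  have hw : ∀ i, ContinuousOn
      (fun s => f (c.loop i s) * derivWithin (c.loop i) (Set.Icc 0 1) s) (Set.Icc 0 1) := fun i =>
    (hf.continuousOn.comp (hcont i) fun s hs => (c.mem i s hs).1).mul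
      ((c.contDiffOn i).continuousOn_derivWithin (uniqueDiffOn_Icc zero_lt_one) le_rfl)
  let w' : Fin c.n → C(Set.Icc (0 : ℝ) 1, ℂ) := fun i => ⟨_, (hw i).domRestrict⟩
  let c' : Fin c.n → C(Set.Icc (0 : ℝ) 1, ℂ) := fun i => ⟨_, (hcont i).domRestrict⟩
  have key : ∀ k y, ρ k y (c.integral f a) = (2 * Real.pi * Complex.I : ℂ)⁻¹ •
      ∑ i, unitIntervalIntegral 𝓛 (scalarCurve 𝓛 (w' i) *
        Ring.inverse (scalarCurve 𝓛 (c' i) - constCurve 𝓛 (ρ k y a))) := by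
    intro k y
    rw [CauchyCycle.integral, map_smul, map_sum]
    congr 1
    refine Finset.sum_congr rfl fun i _ => ?_
    rw [curveIntegral_resolvent_eq _ _ fun s => mem_resolventSet_map (ρ k y) (hmem i s s.2)]
    let φ : B →L[ℂ] 𝓛 := (ρ k y).toLinearMap.mkContinuous 1 fun x => by simpa using hρ k y x
    have hint : IntervalIntegrable (fun s => (f (c.loop i s) *
        derivWithin (c.loop i) (Set.Icc 0 1) s) • resolvent a (c.loop i s))
        MeasureTheory.volume 0 1 := by
      apply ContinuousOn.intervalIntegrable
      rw [Set.uIcc_of_le zero_le_one]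
      exact (hw i).smul ((continuousOn_resolvent a).comp (hcont i) (hmem i))
    refine (φ.intervalIntegral_comp_comm hint).symm.trans ?_
    refine intervalIntegral.integral_congr fun s hs => ?_
    rw [Set.uIcc_of_le zero_le_one] at hs
    simp only [Set.projIcc_of_mem _ hs]
    change ρ k y _ = _
    rw [map_smul, map_resolvent _ (hmem i s hs)]
    rfl
  intro k y hy
  simp only [key]
  refine ContDiffWithinAt.const_smul _ (ContDiffWithinAt.sum fun i _ => ?_)
  have h := (contDiffAt_curveIntegral_resolvent (w' i) (c' i) fun s =>
    mem_resolventSet_map (ρ k y) (hmem i s s.2)).comp_contDiffWithinAt y (ha k y hy)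
  exact h

/-! ### Lifting of idempotents -/

/-- The binomial coefficients `choose (-1/2) n`, the Taylor coefficients of `(1 + z) ^ (-1/2)`. -/
noncomputable def invSqrtCoeff (n : ℕ) : ℂ := Ring.choose (-1 / 2 : ℂ) n

theorem ringChoose_succ (r : ℂ) (n : ℕ) :
    Ring.choose r (n + 1) = Ring.choose r n * ((r - n) / (n + 1)) := by
  rw [Ring.choose_eq_smul, Ring.choose_eq_smul, descPochhammer_succ_right]
  simp [Polynomial.smeval_mul, Polynomial.smeval_sub, Polynomial.smeval_natCast,
    Nat.factorial_succ]
  field_simp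

theorem norm_invSqrtCoeff_le (n : ℕ) : ‖invSqrtCoeff n‖ ≤ 1 := by
  induction n with
  | zero => simp [invSqrtCoeff]
  | succ n ih =>
    have h : ‖((-1 / 2 : ℂ) - n) / (n + 1)‖ ≤ 1 := by
      have h1 : ((-1 / 2 : ℂ) - n) / (n + 1) = ((((-1 / 2 : ℝ) - n) / (n + 1) : ℝ) : ℂ) := by
        push_cast; ring
      rw [h1, Complex.norm_real, Real.norm_eq_abs, abs_div,
        abs_of_pos (by positivity : (0 : ℝ) < n + 1),
        div_le_one (by positivity), abs_le]
      constructor <;> linarith [(Nat.cast_nonneg n : (0 : ℝ) ≤ n)]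
    rw [invSqrtCoeff, ringChoose_succ, norm_mul]
    exact mul_le_one₀ ih (norm_nonneg _) h

theorem sum_invSqrtCoeff_mul (n : ℕ) :
    ∑ p ∈ Finset.HasAntidiagonal.antidiagonal n, invSqrtCoeff p.1 * invSqrtCoeff p.2 =
      (-1) ^ n := by
  have h : ∀ n, Ring.choose (-1 : ℂ) n = (-1) ^ n := by
    intro n
    induction n with
    | zero => simp
    | succ n ih =>
      rw [ringChoose_succ, ih, pow_succ, show ((-1 : ℂ) - n) / (n + 1) = -1 from ?_]
      rw [div_eq_iff (Nat.cast_add_one_ne_zero n)]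
      ring
  rw [← h, show (-1 : ℂ) = -1 / 2 + -1 / 2 by norm_num, Ring.add_choose_eq n (Commute.all _ _)]
  rfl

/-- The power series of `(1 + y) ^ (-1/2)`, in a Banach algebra. -/
noncomputable def invSqrtSeries (y : 𝓛) : 𝓛 := ∑' n, invSqrtCoeff n • y ^ n

theorem summable_norm_pow_of_lt_one {R : Type*} [NormedRing R] {y : R} (hy : ‖y‖ < 1) :
    Summable fun n : ℕ => ‖y ^ n‖ := by
  refine (summable_nat_add_iff 1).1 (Summable.of_nonneg_of_le (fun _ => norm_nonneg _)
    (fun n => norm_pow_le' y n.succ_pos)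
    ((summable_nat_add_iff 1).2 (summable_geometric_of_lt_one (norm_nonneg y) hy)))

theorem summable_norm_invSqrtCoeff_smul {y : 𝓛} (hy : ‖y‖ < 1) :
    Summable fun n : ℕ => ‖invSqrtCoeff n • y ^ n‖ :=
  Summable.of_nonneg_of_le (fun _ => norm_nonneg _) (fun n => by
    rw [norm_smul]
    exact mul_le_of_le_one_left (norm_nonneg _) (norm_invSqrtCoeff_le n))
    (summable_norm_pow_of_lt_one hy)

theorem invSqrtSeries_mul_self [CompleteSpace 𝓛] {y : 𝓛} (hy : ‖y‖ < 1) :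
    invSqrtSeries y * invSqrtSeries y * (1 + y) = 1 := by
  have hs := summable_norm_invSqrtCoeff_smul hy
  rw [invSqrtSeries, tsum_mul_tsum_eq_tsum_sum_antidiagonal_of_summable_norm hs hs]
  have h : ∀ n, ∑ p ∈ Finset.HasAntidiagonal.antidiagonal n,
      invSqrtCoeff p.1 • y ^ p.1 * invSqrtCoeff p.2 • y ^ p.2 = (-y) ^ n := by
    intro n
    rw [neg_pow, ← map_one (algebraMap ℂ 𝓛), ← map_neg, ← map_pow, ← Algebra.smul_def,
      ← sum_invSqrtCoeff_mul, Finset.sum_smul]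
    refine Finset.sum_congr rfl fun p hp => ?_
    rw [smul_mul_smul_comm, ← pow_add, Finset.HasAntidiagonal.mem_antidiagonal.1 hp]
  simp_rw [h]
  have := geom_series_mul_neg (-y) (by rwa [norm_neg])
  rwa [sub_neg_eq_add] at this

theorem commute_invSqrtSeries [CompleteSpace 𝓛] {x y : 𝓛} (h : Commute x y) (hy : ‖y‖ < 1) :
    Commute x (invSqrtSeries y) := by
  have hs := (summable_norm_invSqrtCoeff_smul hy).of_norm
  rw [Commute, SemiconjBy, invSqrtSeries, ← hs.tsum_mul_left, ← hs.tsum_mul_right]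
  congr 1
  funext n
  exact (h.pow_right n).smul_right _

theorem norm_invSqrtSeries_sub_one_le [CompleteSpace 𝓛] {y : 𝓛} (hy : ‖y‖ ≤ 1 / 2) :
    ‖invSqrtSeries y - 1‖ ≤ 2 * ‖y‖ := by
  have hy1 : ‖y‖ < 1 := by linarith
  have hs := (summable_norm_invSqrtCoeff_smul hy1)
  rw [invSqrtSeries, hs.of_norm.tsum_eq_zero_add]
  have h0 : invSqrtCoeff 0 • y ^ 0 = 1 := by simp [invSqrtCoeff]
  rw [h0, add_sub_cancel_left]
  have hg : HasSum (fun n : ℕ => ‖y‖ * ‖y‖ ^ n) (‖y‖ * (1 - ‖y‖)⁻¹) :=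
    (hasSum_geometric_of_lt_one (norm_nonneg y) hy1).mul_left _
  refine (tsum_of_norm_bounded hg fun n => ?_).trans ?_
  · rw [norm_smul, ← pow_succ']
    exact (mul_le_of_le_one_left (norm_nonneg _) (norm_invSqrtCoeff_le _)).trans
      (norm_pow_le' y n.succ_pos)
  · rw [mul_comm]
    refine mul_le_mul_of_nonneg_right ?_ (norm_nonneg _)
    rw [inv_le_comm₀ (by linarith) (by norm_num)]
    linarith

theorem contDiffAt_invSqrtSeries [CompleteSpace 𝓛] {y : 𝓛} (hy : ‖y‖ < 1) :
    ContDiffAt ℝ ∞ (invSqrtSeries : 𝓛 → 𝓛) y := by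
  let p := FormalMultilinearSeries.ofScalars 𝓛 invSqrtCoeff
  have hr : ENNReal.ofReal 1 ≤ p.radius := by
    refine p.le_radius_of_bound (max 1 ‖p 0‖) fun n => ?_
    rw [Real.coe_toNNReal 1 zero_le_one, one_pow, mul_one]
    rcases Nat.eq_zero_or_pos n with rfl | hn
    · exact le_max_right _ _
    · exact ((FormalMultilinearSeries.ofScalars_norm_le 𝓛 _ n hn).trans
        (norm_invSqrtCoeff_le n)).trans (le_max_left _ _)
  rw [ENNReal.ofReal_one] at hr
  have h1 := p.hasFPowerSeriesOnBall (lt_of_lt_of_le one_pos hr)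
  have h2 : p.sum = (invSqrtSeries : 𝓛 → 𝓛) := by
    funext x
    exact FormalMultilinearSeries.ofScalars_sum_eq invSqrtCoeff x
  rw [h2] at h1
  have h3 : y ∈ Metric.eball (0 : 𝓛) p.radius := by
    refine Metric.eball_subset_eball hr ?_
    rw [Metric.mem_eball, edist_zero_right, ← ofReal_norm]
    exact ENNReal.ofReal_lt_one.2 hy
  exact (h1.analyticAt_of_mem h3).contDiffAt.restrict_scalars ℝ

theorem map_invSqrtSeries [CompleteSpace B] (φ : B →ₐ[ℂ] 𝓛) (hφ : Continuous φ)
    {y : B} (hy : ‖y‖ < 1) : φ (invSqrtSeries y) = invSqrtSeries (φ y) := by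
  have hs := (summable_norm_invSqrtCoeff_smul hy).of_norm
  refine ((hs.hasSum.map φ hφ).tsum_eq.symm).trans ?_
  simp only [Function.comp_def, map_smul, map_pow]
  rfl

/-- An element which is nearly idempotent is close to an idempotent, obtained from it by the
function `z ↦ (1 + (2 z - 1) (1 + 4 (z² - z)) ^ (-1/2)) / 2`. -/
noncomputable def nearbyIdempotent (a : B) : B :=
  (1 / 2 : ℂ) • (1 + (2 * a - 1) * invSqrtSeries (4 * (a * a - a)))

theorem norm_four_mul_le (x : B) : ‖4 * x‖ ≤ 4 * ‖x‖ := by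
  have h : (4 : B) * x = (4 : ℂ) • x := by rw [Algebra.smul_def, map_ofNat]
  rw [h, norm_smul]; norm_num

theorem nearbyIdempotent_mul_self [CompleteSpace B] {a : B} (ha : ‖a * a - a‖ ≤ 1 / 8) :
    nearbyIdempotent a * nearbyIdempotent a = nearbyIdempotent a := by
  have hy : ‖4 * (a * a - a)‖ < 1 := (norm_four_mul_le _).trans_lt (by linarith)
  set y := 4 * (a * a - a) with hyd
  have hcomm : Commute (2 * a - 1) (invSqrtSeries y) := by
    refine commute_invSqrtSeries ?_ hy
    have h : Commute (2 * a - 1) a :=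
      ((Commute.ofNat_left 2 a).mul_left (Commute.refl a)).sub_left (Commute.one_left a)
    exact (Commute.ofNat_right _ 4).mul_right ((h.mul_right h).sub_right h)
  have hsq : (2 * a - 1) * (2 * a - 1) = 1 + y := by rw [hyd]; noncomm_ring
  have hone : ((2 * a - 1) * invSqrtSeries y) * ((2 * a - 1) * invSqrtSeries y) = 1 := by
    have h2 := commute_invSqrtSeries (x := 1 + y)
      ((Commute.one_left y).add_left (Commute.refl y)) hy
    calc ((2 * a - 1) * invSqrtSeries y) * ((2 * a - 1) * invSqrtSeries y)
        = (2 * a - 1) * (invSqrtSeries y * (2 * a - 1)) * invSqrtSeries y := by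
          simp only [mul_assoc]
      _ = (1 + y) * (invSqrtSeries y * invSqrtSeries y) := by
          rw [← hcomm.eq, ← mul_assoc, hsq, mul_assoc]
      _ = invSqrtSeries y * invSqrtSeries y * (1 + y) := (h2.mul_right h2).eq
      _ = 1 := invSqrtSeries_mul_self hy
  rw [nearbyIdempotent, ← hyd]
  set u := (2 * a - 1) * invSqrtSeries y
  have h3 : (1 + u) * (1 + u) = (2 : ℂ) • (1 + u) := by
    rw [two_smul, mul_add, add_mul, add_mul, hone]; simp only [one_mul, mul_one]; abel
  rw [smul_mul_smul_comm, h3, smul_smul]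
  norm_num

theorem norm_nearbyIdempotent_sub_le [CompleteSpace B] {a : B} (ha : ‖a * a - a‖ ≤ 1 / 8) :
    ‖nearbyIdempotent a - a‖ ≤ 4 * ‖2 * a - 1‖ * ‖a * a - a‖ := by
  have hy := norm_four_mul_le (a * a - a)
  have h1 := norm_invSqrtSeries_sub_one_le (y := 4 * (a * a - a)) (by linarith)
  have h : nearbyIdempotent a - a =
      (1 / 2 : ℂ) • ((2 * a - 1) * (invSqrtSeries (4 * (a * a - a)) - 1)) := by
    have h2 : a = (1 / 2 : ℂ) • (2 * a) := by
      rw [two_mul, ← two_smul ℂ, smul_smul]; norm_num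
    conv_lhs => rw [nearbyIdempotent]; rhs; rw [h2]
    rw [← smul_sub]
    congr 1
    noncomm_ring
  rw [h, norm_smul]
  have h3 := norm_mul_le (2 * a - 1) (invSqrtSeries (4 * (a * a - a)) - 1)
  have h4 : ‖(1 / 2 : ℂ)‖ = 1 / 2 := by norm_num
  rw [h4]
  nlinarith [norm_nonneg (2 * a - 1), mul_le_mul_of_nonneg_left (h1.trans
    (mul_le_mul_of_nonneg_left hy zero_le_two)) (norm_nonneg (2 * a - 1))]

theorem nearbyIdempotent_mem_smoothSubalgebra [CompleteSpace B] [CompleteSpace 𝓛]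
    (hρ : ∀ k y a, ‖ρ k y a‖ ≤ ‖a‖) {a : B} (ha : a ∈ smoothSubalgebra ρ U)
    (hle : ‖a * a - a‖ ≤ 1 / 8) : nearbyIdempotent a ∈ smoothSubalgebra ρ U := by
  have hy : ‖4 * (a * a - a)‖ < 1 := (norm_four_mul_le _).trans_lt (by linarith)
  have hmem : 4 * (a * a - a) ∈ smoothSubalgebra ρ U :=
    mul_mem (ofNat_mem _ 4) (sub_mem (mul_mem ha ha) ha)
  refine Subalgebra.smul_mem _ (add_mem (one_mem _) (mul_mem
    (sub_mem (mul_mem (ofNat_mem _ 2) ha) (one_mem _)) fun k y hyU => ?_)) _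
  have hcont : ∀ k y, Continuous (ρ k y) := fun k y =>
    AddMonoidHomClass.continuous_of_bound (ρ k y) 1 fun x => by simpa using hρ k y x
  simp only [map_invSqrtSeries _ (hcont _ _) hy]
  exact (contDiffAt_invSqrtSeries ((hρ k y _).trans_lt hy)).comp_contDiffWithinAt y
    (hmem k y hyU)

end SmoothSubalgebra

/-! ### Matrices over a smooth subalgebra -/

section MatrixNorm

attribute [local instance] Matrix.linftyOpNormedAddCommGroup Matrix.linftyOpNormedRing
  Matrix.linftyOpNormedAlgebra

theorem norm_entry_le {R m n : Type*} [NormedRing R] [Fintype m] [Fintype n] (M : Matrix m n R)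
    (i : m) (j : n) : ‖M i j‖ ≤ ‖M‖ := by
  rw [Matrix.linfty_opNorm_def]
  have h1 : ‖M i j‖₊ ≤ ∑ j, ‖M i j‖₊ :=
    Finset.single_le_sum (f := fun j => ‖M i j‖₊) (fun _ _ => zero_le) (Finset.mem_univ j)
  have h2 := Finset.le_sup (f := fun i => ∑ j, ‖M i j‖₊) (Finset.mem_univ i)
  exact_mod_cast h1.trans h2

theorem norm_le_of_entry_norm_le {R m n : Type*} [NormedRing R] [Fintype m] [Fintype n]
    {M : Matrix m n R} {ε : ℝ} (hε : 0 ≤ ε) (h : ∀ i j, ‖M i j‖ ≤ ε) :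
    ‖M‖ ≤ Fintype.card n * ε := by
  lift ε to NNReal using hε
  rw [Matrix.linfty_opNorm_def]
  have : (Finset.univ.sup fun i => ∑ j, ‖M i j‖₊) ≤ Fintype.card n * ε :=
    Finset.sup_le fun i _ => (Finset.sum_le_card_nsmul _ _ ε fun j _ => h i j).trans
      (by simp [Finset.card_univ])
  exact_mod_cast this

theorem exists_matrix_mem_norm_sub_lt {R m n : Type*} [NormedRing R] [Fintype m] [Fintype n]
    {A : Set R} (hA : Dense A) (M : Matrix m n R) {ε : ℝ} (hε : 0 < ε) :
    ∃ M' : Matrix m n R, (∀ i j, M' i j ∈ A) ∧ ‖M' - M‖ < ε := by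
  have hη : 0 < ε / (Fintype.card n + 1) := by positivity
  choose f hf hlt using fun i j => hA.exists_dist_lt (M i j) hη
  refine ⟨Matrix.of f, hf, ?_⟩
  refine (norm_le_of_entry_norm_le (ε := ε / (Fintype.card n + 1)) hη.le fun i j => ?_).trans_lt ?_
  · rw [Matrix.sub_apply, Matrix.of_apply, ← dist_eq_norm, dist_comm]
    exact (hlt i j).le
  · rw [mul_div_assoc', div_lt_iff₀ (by positivity), mul_comm]
    gcongr
    linarith

theorem completeSpace_matrix {R m n : Type*} [NormedRing R] [CompleteSpace R] [Fintype m]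
    [Fintype n] : CompleteSpace (Matrix m n R) := by
  refine Metric.complete_of_cauchySeq_tendsto fun u hu => ?_
  have h : ∀ i j, CauchySeq fun k => u k i j := fun i j => by
    rw [Metric.cauchySeq_iff] at hu ⊢
    intro ε hε
    obtain ⟨N, hN⟩ := hu ε hε
    refine ⟨N, fun k hk l hl => lt_of_le_of_lt ?_ (hN k hk l hl)⟩
    rw [dist_eq_norm, dist_eq_norm]
    exact norm_entry_le (u k - u l) i j
  choose M hM using fun i j => cauchySeq_tendsto_of_complete (h i j)
  refine ⟨Matrix.of M, ?_⟩
  rw [Metric.tendsto_atTop]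
  intro ε hε
  have hη : 0 < ε / (Fintype.card n + 1) := by positivity
  have hev : ∀ᶠ k in Filter.atTop, ∀ i j, ‖u k i j - M i j‖ < ε / (Fintype.card n + 1) :=
    Filter.eventually_all.2 fun i => Filter.eventually_all.2 fun j => by
      simpa only [dist_eq_norm] using (Metric.tendsto_nhds.1 (hM i j)) _ hη
  obtain ⟨N, hN⟩ := Filter.eventually_atTop.1 hev
  refine ⟨N, fun k hk => ?_⟩
  rw [dist_eq_norm]
  refine (norm_le_of_entry_norm_le (ε := ε / (Fintype.card n + 1)) hη.le
    fun i j => (hN k hk i j).le).trans_lt ?_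
  rw [mul_div_assoc', div_lt_iff₀ (by positivity), mul_comm]
  gcongr
  linarith

theorem completeSpace_squareMatrix {R n : Type*} [NormedRing R] [CompleteSpace R] [Fintype n]
    [DecidableEq n] : @CompleteSpace (Matrix n n R)
      Matrix.linftyOpNormedRing.toMetricSpace.toPseudoMetricSpace.toUniformSpace :=
  completeSpace_matrix

attribute [local instance] completeSpace_squareMatrix

section Smooth

variable {B 𝓛 V κ n : Type*} [NormedRing B] [NormedAlgebra ℂ B]
  [NormedRing 𝓛] [NormedAlgebra ℂ 𝓛] [NormedAddCommGroup V] [NormedSpace ℝ V]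
  [Fintype n] [DecidableEq n]
  {ρ : κ → V → B →ₐ[ℂ] 𝓛} {U : κ → Set V}

/-- The entry `M ↦ M i j` as a continuous linear functional. -/
noncomputable def entryCLM (R : Type*) [NormedRing R] [NormedAlgebra ℂ R] (i j : n) :
    Matrix n n R →L[ℝ] R :=
  ((Matrix.entryLinearMap ℂ R i j).mkContinuous 1 fun M => by
    simpa using norm_entry_le M i j).restrictScalars ℝ

/-- The matrix with the entry `x` at `i j` and zeros elsewhere. -/
noncomputable def singleCLM (R : Type*) [NormedRing R] [NormedAlgebra ℂ R] (i j : n) :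
    R →L[ℝ] Matrix n n R :=
  ((Matrix.singleLinearMap ℂ i j).mkContinuous (Fintype.card n) fun x =>
    norm_le_of_entry_norm_le (norm_nonneg x) fun k l => by
      rw [Matrix.singleLinearMap_apply, Matrix.single_apply]
      split_ifs
      · exact le_rfl
      · simp).restrictScalars ℝ

theorem sum_singleCLM {R : Type*} [NormedRing R] [NormedAlgebra ℂ R] (M : Matrix n n R) :
    M = ∑ i, ∑ j, singleCLM R i j (M i j) := by
  conv_lhs => rw [Matrix.matrix_eq_sum_single M]
  rfl

theorem mem_smoothSubalgebra_mapMatrix {M : Matrix n n B} :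
    M ∈ smoothSubalgebra (fun k y => (ρ k y).mapMatrix (m := n)) U ↔
      ∀ i j, M i j ∈ smoothSubalgebra ρ U := by
  constructor
  · intro h i j k
    exact (entryCLM 𝓛 i j).contDiff.comp_contDiffOn (h k)
  · intro h k
    have : (fun y => (ρ k y).mapMatrix M) =
        fun y => ∑ i, ∑ j, singleCLM 𝓛 i j (ρ k y (M i j)) := by
      funext y
      exact sum_singleCLM _
    rw [this]
    exact ContDiffOn.sum fun i _ => ContDiffOn.sum fun j _ =>
      (singleCLM 𝓛 i j).contDiff.comp_contDiffOn (h i j k)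

theorem norm_mapMatrix_le {φ : B →ₐ[ℂ] 𝓛} (hφ : ∀ a, ‖φ a‖ ≤ ‖a‖) (M : Matrix n n B) :
    ‖φ.mapMatrix M‖ ≤ ‖M‖ := by
  rw [Matrix.linfty_opNorm_def, Matrix.linfty_opNorm_def]
  rw [NNReal.coe_le_coe]
  exact Finset.sup_mono_fun fun i _ => Finset.sum_le_sum fun j _ => hφ (M i j)

end Smooth

/-! ### Dense subalgebras and `K₀` -/

/-- A subset of a Banach algebra `B` which is stable at the level of matrices under inverses taken
in `B` and under the passage from near idempotents to idempotents. -/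
structure IsStableOnMatrices {B : Type*} [NormedRing B] [NormedAlgebra ℂ B] (A : Set B) :
    Prop where
  inverse : ∀ (n : ℕ) (M : Matrix (Fin n) (Fin n) B), (∀ i j, M i j ∈ A) → IsUnit M →
    ∀ i j, Ring.inverse M i j ∈ A
  idempotent : ∀ (n : ℕ) (M : Matrix (Fin n) (Fin n) B), (∀ i j, M i j ∈ A) →
    ‖M * M - M‖ ≤ 1 / 8 → ∀ i j, nearbyIdempotent M i j ∈ A

theorem isStableOnMatrices_smoothSubalgebra {B 𝓛 V κ : Type*} [NormedRing B] [NormedAlgebra ℂ B]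
    [NormedRing 𝓛] [NormedAlgebra ℂ 𝓛] [NormedAddCommGroup V] [NormedSpace ℝ V]
    [CompleteSpace B] [CompleteSpace 𝓛] {ρ : κ → V → B →ₐ[ℂ] 𝓛} {U : κ → Set V}
    (hρ : ∀ k y a, ‖ρ k y a‖ ≤ ‖a‖) :
    IsStableOnMatrices (smoothSubalgebra ρ U : Set B) where
  inverse _ _ hM hu := mem_smoothSubalgebra_mapMatrix.1
    (ringInverse_mem_smoothSubalgebra (mem_smoothSubalgebra_mapMatrix.2 hM) hu)
  idempotent _ _ hM h := mem_smoothSubalgebra_mapMatrix.1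
    (nearbyIdempotent_mem_smoothSubalgebra (fun k y => norm_mapMatrix_le (hρ k y))
      (mem_smoothSubalgebra_mapMatrix.2 hM) h)

section KTheory

variable {B : Type*} [NormedRing B] [NormedAlgebra ℂ B] {A : Subalgebra ℂ B}

/-- A matrix over `B` with entries in `A`, as a matrix over `A`. -/
def liftMatrix {m n : Type*} (M : Matrix m n B) (h : ∀ i j, M i j ∈ A) : Matrix m n A :=
  fun i j => ⟨M i j, h i j⟩

theorem map_liftMatrix {m n : Type*} (M : Matrix m n B) (h : ∀ i j, M i j ∈ A) :
    (liftMatrix M h).map A.val = M := rfl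

theorem matrix_mul_mem {l m n : Type*} [Fintype m] {M : Matrix l m B} {N : Matrix m n B}
    (hM : ∀ i j, M i j ∈ A) (hN : ∀ i j, N i j ∈ A) (i : l) (j : n) : (M * N) i j ∈ A :=
  sum_mem fun k _ => mul_mem (hM i k) (hN k j)

theorem matrix_one_mem {n : Type*} [DecidableEq n] (i j : n) : (1 : Matrix n n B) i j ∈ A := by
  rw [Matrix.one_apply]
  split_ifs
  exacts [one_mem A, zero_mem A]

/-- Close idempotents are equivalent. -/
theorem matrixEquiv_of_norm_sub_lt {B : Type*} [NormedRing B] [CompleteSpace B] {n : ℕ}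
    {e p : Matrix (Fin n) (Fin n) B} (he : e * e = e) (hp : p * p = p)
    (h : ‖2 * e - 1‖ * ‖p - e‖ < 1) : MatrixEquiv p e := by
  have hu : IsUnit (1 - (-((2 * e - 1) * (p - e)))) := by
    refine isUnit_one_sub_of_norm_lt_one ?_
    rw [norm_neg]
    exact (norm_mul_le _ _).trans_lt h
  obtain ⟨u, hu⟩ := hu
  have h1 : e * u = e * p := by
    rw [hu]
    calc e * (1 - (-((2 * e - 1) * (p - e)))) =
        e + (2 * (e * e) * p - 2 * (e * e) * e - e * p + e * e) := by noncomm_ring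
      _ = e * p := by rw [he]; noncomm_ring; rw [he]; abel
  have h2 : (u : Matrix (Fin n) (Fin n) B) * p = e * p := by
    rw [hu]
    calc (1 - (-((2 * e - 1) * (p - e)))) * p =
        p + (2 * e * (p * p) - 2 * (e * e) * p - p * p + e * p) := by noncomm_ring
      _ = e * p := by rw [he, hp]; noncomm_ring
  refine ⟨(↑u⁻¹ : Matrix (Fin n) (Fin n) B) * e, e * u, ?_, ?_⟩
  · rw [mul_assoc, ← mul_assoc e e, he, h1, ← h2, Units.inv_mul_cancel_left]
  · rw [mul_assoc, Units.mul_inv_cancel_left, he]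

theorem exists_idempotentMatrix_map_equiv [CompleteSpace B] (hd : Dense (A : Set B))
    (hA : IsStableOnMatrices (A : Set B)) (e : IdempotentMatrix B) :
    ∃ p : IdempotentMatrix A, MatrixEquiv (p.map (A.val : A →+* B)).mat e.mat := by
  obtain ⟨n, e, he⟩ := e
  have hc1 : Continuous fun a : Matrix (Fin n) (Fin n) B => ‖a * a - a‖ := by fun_prop
  have hc2 : Continuous fun a : Matrix (Fin n) (Fin n) B =>
      ‖2 * e - 1‖ * (4 * ‖2 * a - 1‖ * ‖a * a - a‖ + ‖a - e‖) := by fun_prop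
  have h1 := hc1.continuousAt.eventually_lt (continuousAt_const (y := (1 / 8 : ℝ))) (x₀ := e)
    (by simp [he])
  have h2 := hc2.continuousAt.eventually_lt (continuousAt_const (y := (1 : ℝ))) (x₀ := e)
    (by simp [he])
  obtain ⟨ε, hε, hball⟩ := Metric.eventually_nhds_iff.1 (h1.and h2)
  obtain ⟨a, haA, hlt⟩ := exists_matrix_mem_norm_sub_lt hd e hε
  obtain ⟨h3, h4⟩ := hball (show dist a e < ε by rwa [dist_eq_norm])
  have hp := nearbyIdempotent_mul_self h3.le
  have hpA := hA.idempotent n a haA h3.le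
  refine ⟨⟨n, liftMatrix _ hpA, ?_⟩, ?_⟩
  · ext i j
    have := congrFun (congrFun hp i) j
    rw [← map_liftMatrix _ hpA, ← Matrix.map_mul] at this
    exact this
  · refine matrixEquiv_of_norm_sub_lt he hp (lt_of_le_of_lt ?_ h4)
    refine mul_le_mul_of_nonneg_left ?_ (norm_nonneg _)
    refine (norm_sub_le_norm_sub_add_norm_sub _ a _).trans ?_
    gcongr
    exact norm_nearbyIdempotent_sub_le h3.le

/-- Idempotents over `A` that are equivalent over `B` are equivalent over `A`: the matrices that
implement the equivalence are approximated by matrices over `A`, and the errors are corrected by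
inverting matrices over `A` close to the identity. -/
theorem matrixEquiv_of_map [CompleteSpace B] (hd : Dense (A : Set B))
    (hA : IsStableOnMatrices (A : Set B))
    {p q : IdempotentMatrix A}
    (h : MatrixEquiv (p.map (A.val : A →+* B)).mat (q.map (A.val : A →+* B)).mat) :
    MatrixEquiv p.mat q.mat := by
  obtain ⟨m, p, hp⟩ := p
  obtain ⟨n, q, hq⟩ := q
  obtain ⟨x, y, hxy, hyx⟩ := h
  change Matrix (Fin m) (Fin n) B at x
  change Matrix (Fin n) (Fin m) B at y
  set P : Matrix (Fin m) (Fin m) B := p.map A.val with hPd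
  set Q : Matrix (Fin n) (Fin n) B := q.map A.val with hQd
  change x * y = P at hxy
  change y * x = Q at hyx
  have hP : P * P = P := by rw [hPd, ← Matrix.map_mul, hp]
  have hQ : Q * Q = Q := by rw [hQd, ← Matrix.map_mul, hq]
  have hPA : ∀ i j, P i j ∈ A := fun i j => (p i j).2
  have hQA : ∀ i j, Q i j ∈ A := fun i j => (q i j).2
  have hc1 : Continuous fun z : Matrix (Fin m) (Fin n) B × Matrix (Fin n) (Fin m) B =>
      ‖P * z.1 * Q * (Q * z.2 * P) - P‖ :=
    ((((continuous_const.matrix_mul continuous_fst).matrix_mul continuous_const).matrix_mul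
      ((continuous_const.matrix_mul continuous_snd).matrix_mul continuous_const)).sub
      continuous_const).norm
  have hc2 : Continuous fun z : Matrix (Fin m) (Fin n) B × Matrix (Fin n) (Fin m) B =>
      ‖Q * z.2 * P * (P * z.1 * Q) - Q‖ :=
    ((((continuous_const.matrix_mul continuous_snd).matrix_mul continuous_const).matrix_mul
      ((continuous_const.matrix_mul continuous_fst).matrix_mul continuous_const)).sub
      continuous_const).norm
  have e1 : P * x * Q * (Q * y * P) = P := by
    calc P * x * Q * (Q * y * P) = P * x * (Q * Q) * y * P := by simp only [Matrix.mul_assoc]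
      _ = P * ((x * y) * (x * y)) * P := by rw [hQ, ← hyx]; simp only [Matrix.mul_assoc]
      _ = P := by rw [hxy, hP, hP, hP]
  have e2 : Q * y * P * (P * x * Q) = Q := by
    calc Q * y * P * (P * x * Q) = Q * y * (P * P) * x * Q := by simp only [Matrix.mul_assoc]
      _ = Q * ((y * x) * (y * x)) * Q := by rw [hP, ← hxy]; simp only [Matrix.mul_assoc]
      _ = Q := by rw [hyx, hQ, hQ, hQ]
  have h1 := hc1.continuousAt.eventually_lt (continuousAt_const (y := (1 : ℝ))) (x₀ := (x, y))
    (by simp [e1])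
  have h2 := hc2.continuousAt.eventually_lt (continuousAt_const (y := (1 : ℝ))) (x₀ := (x, y))
    (by simp [e2])
  obtain ⟨ε, hε, hball⟩ := Metric.eventually_nhds_iff.1 (h1.and h2)
  obtain ⟨x', hxA, hx'⟩ := exists_matrix_mem_norm_sub_lt hd x hε
  obtain ⟨y', hyA, hy'⟩ := exists_matrix_mem_norm_sub_lt hd y hε
  obtain ⟨h3, h4⟩ := hball (y := (x', y'))
    (by rw [Prod.dist_eq, max_lt_iff, dist_eq_norm, dist_eq_norm]; exact ⟨hx', hy'⟩)
  set x₀ := P * x' * Q with hx₀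
  set y₀ := Q * y' * P with hy₀
  have hx₀A : ∀ i j, x₀ i j ∈ A := matrix_mul_mem (matrix_mul_mem hPA hxA) hQA
  have hy₀A : ∀ i j, y₀ i j ∈ A := matrix_mul_mem (matrix_mul_mem hQA hyA) hPA
  have hPx : P * x₀ = x₀ := by rw [hx₀]; simp only [← Matrix.mul_assoc, hP]
  have hxQ : x₀ * Q = x₀ := by rw [hx₀, Matrix.mul_assoc, hQ]
  have hQy : Q * y₀ = y₀ := by rw [hy₀]; simp only [← Matrix.mul_assoc, hQ]
  have hyP : y₀ * P = y₀ := by rw [hy₀, Matrix.mul_assoc, hP]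
  clear_value x₀ y₀
  -- the inverses of `x₀ y₀` and `y₀ x₀` in the corners cut out by `P` and `Q`
  have hv : IsUnit (x₀ * y₀ + 1 - P) := by
    have := isUnit_one_sub_of_norm_lt_one (x := -(x₀ * y₀ - P)) (by rwa [norm_neg])
    convert this using 1; abel
  have hv' : IsUnit (y₀ * x₀ + 1 - Q) := by
    have := isUnit_one_sub_of_norm_lt_one (x := -(y₀ * x₀ - Q)) (by rwa [norm_neg])
    convert this using 1; abel
  have hvA : ∀ i j, (x₀ * y₀ + 1 - P : Matrix (Fin m) (Fin m) B) i j ∈ A := fun i j =>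
    sub_mem (add_mem (matrix_mul_mem hx₀A hy₀A i j) (matrix_one_mem i j)) (hPA i j)
  have hwA := hA.inverse m _ hvA hv
  set w := Ring.inverse (x₀ * y₀ + 1 - P) with hw
  set w' := Ring.inverse (y₀ * x₀ + 1 - Q) with hw'
  have e3 : x₀ * (y₀ * w) = P := by
    have : x₀ * y₀ = P * (x₀ * y₀ + 1 - P) := by
      rw [mul_sub, mul_add, mul_one, hP, ← Matrix.mul_assoc, hPx]; abel
    rw [← Matrix.mul_assoc, show x₀ * y₀ * w = P * (x₀ * y₀ + 1 - P) * w by rw [← this],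
      mul_assoc, hw, Ring.mul_inverse_cancel _ hv, mul_one]
  have e4 : w' * y₀ * x₀ = Q := by
    have : y₀ * x₀ = (y₀ * x₀ + 1 - Q) * Q := by
      rw [sub_mul, add_mul, one_mul, hQ, Matrix.mul_assoc, hxQ]; abel
    rw [Matrix.mul_assoc, show w' * (y₀ * x₀) = w' * ((y₀ * x₀ + 1 - Q) * Q) by rw [← this],
      ← mul_assoc, hw', Ring.inverse_mul_cancel _ hv', one_mul]
  have e5 : y₀ * w = w' * y₀ := by
    calc y₀ * w = Q * (y₀ * w) := by rw [← Matrix.mul_assoc, hQy]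
      _ = w' * y₀ * (x₀ * (y₀ * w)) := by rw [← e4]; simp only [Matrix.mul_assoc]
      _ = w' * y₀ := by rw [e3, Matrix.mul_assoc, hyP]
  have e6 : y₀ * w * x₀ = Q := by rw [e5, e4]
  have hYA : ∀ i j, (y₀ * w) i j ∈ A := matrix_mul_mem hy₀A hwA
  refine ⟨liftMatrix x₀ hx₀A, liftMatrix _ hYA, ?_, ?_⟩
  · have : (liftMatrix x₀ hx₀A * liftMatrix _ hYA).map A.val = p.map A.val := by
      rw [Matrix.map_mul, map_liftMatrix, map_liftMatrix, e3]
    exact Matrix.map_injective Subtype.val_injective this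
  · have : (liftMatrix _ hYA * liftMatrix x₀ hx₀A).map A.val = q.map A.val := by
      rw [Matrix.map_mul, map_liftMatrix, map_liftMatrix, e6]
    exact Matrix.map_injective Subtype.val_injective this

theorem bijective_vMonoidMap [CompleteSpace B] (hd : Dense (A : Set B))
    (hA : IsStableOnMatrices (A : Set B)) :
    Function.Bijective (VMonoid.map (A.val : A →+* B)) := by
  constructor
  · rintro ⟨p⟩ ⟨q⟩ h
    exact VMonoid.mk_eq (matrixEquiv_of_map hd hA (Quotient.exact h))
  · rintro ⟨e⟩
    obtain ⟨p, hp⟩ := exists_idempotentMatrix_map_equiv hd hA e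
    exact ⟨VMonoid.mk p, VMonoid.mk_eq hp⟩

theorem grothendieckAddGroup_lift_of {M G : Type*} [AddCommMonoid M] [AddCommGroup G] (f : M →+ G)
    (x : M) : Algebra.GrothendieckAddGroup.lift f (Algebra.GrothendieckAddGroup.of x) = f x :=
  DFunLike.congr_fun (Algebra.GrothendieckAddGroup.lift.symm_apply_apply f) x

theorem bijective_kZeroMap {R R' : Type*} [Ring R] [Ring R'] {f : R →+* R'}
    (hf : Function.Bijective (VMonoid.map f)) : Function.Bijective (KZero.map f) := by
  let e := AddEquiv.ofBijective (VMonoid.map f) hf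
  let g : KZero R' →+ KZero R := Algebra.GrothendieckAddGroup.lift
    (Algebra.GrothendieckAddGroup.of.comp (e.symm : VMonoid R' →+ VMonoid R))
  have h1 : g.comp (KZero.map f) = AddMonoidHom.id _ := by
    apply Algebra.GrothendieckAddGroup.lift.symm.injective
    refine DFunLike.ext _ _ fun x => ?_
    change g (KZero.map f (Algebra.GrothendieckAddGroup.of x)) =
      Algebra.GrothendieckAddGroup.of x
    rw [KZero.map, grothendieckAddGroup_lift_of]
    change g (Algebra.GrothendieckAddGroup.of (e x)) = _
    rw [grothendieckAddGroup_lift_of]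
    exact congrArg Algebra.GrothendieckAddGroup.of (e.symm_apply_apply x)
  have h2 : (KZero.map f).comp g = AddMonoidHom.id _ := by
    apply Algebra.GrothendieckAddGroup.lift.symm.injective
    refine DFunLike.ext _ _ fun x => ?_
    change KZero.map f (g (Algebra.GrothendieckAddGroup.of x)) =
      Algebra.GrothendieckAddGroup.of x
    rw [grothendieckAddGroup_lift_of]
    change KZero.map f (Algebra.GrothendieckAddGroup.of (e.symm x)) = _
    rw [KZero.map, grothendieckAddGroup_lift_of]
    exact congrArg Algebra.GrothendieckAddGroup.of (e.apply_symm_apply x)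
  exact ⟨Function.LeftInverse.injective (g := g) fun x => DFunLike.congr_fun h1 x,
    Function.RightInverse.surjective (g := g) fun x => DFunLike.congr_fun h2 x⟩

end KTheory

end MatrixNorm

/-! ### Uniformly smooth families of functions -/

section UniformlySmooth

variable {I V : Type*} [NormedAddCommGroup V] [NormedSpace ℝ V]

/-- A family of smooth functions on `U` whose derivatives of each order are bounded on compact
sets, uniformly over the family. -/
structure IsUniformlySmooth (f : I → V → ℂ) (U : Set V) : Prop where
  contDiffOn : ∀ i, ContDiffOn ℝ ∞ (f i) U
  bound : ∀ K ⊆ U, IsCompact K → ∀ k : ℕ, ∃ C : ℝ, ∀ i, ∀ y ∈ K,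
    ‖iteratedFDeriv ℝ k (f i) y‖ ≤ C

open Classical in
/-- The point `(f i y)_i` of `ℓ^∞(I)`, where this family is bounded, and `0` elsewhere. -/
noncomputable def toLinfty (f : I → V → ℂ) (y : V) : lp (fun _ : I => ℂ) ∞ :=
  if h : Memℓp (E := fun _ : I => ℂ) (fun i => f i y) ∞ then ⟨_, h⟩ else 0

variable {f : I → V → ℂ} {U : Set V}

theorem IsUniformlySmooth.exists_bound (hf : IsUniformlySmooth f U) {y : V} (hy : y ∈ U) :
    ∃ C : ℝ, ∀ i, ‖f i y‖ ≤ C := by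
  obtain ⟨C, hC⟩ := hf.bound {y} (by simpa using hy) isCompact_singleton 0
  exact ⟨C, fun i => by simpa using hC i y rfl⟩

theorem toLinfty_apply_of_bound {V : Type*} {f : I → V → ℂ} {y : V} {C : ℝ}
    (h : ∀ i, ‖f i y‖ ≤ C) (i : I) :
    toLinfty f y i = f i y := by
  have hm : Memℓp (E := fun _ : I => ℂ) (fun i => f i y) ∞ :=
    memℓp_infty ⟨C, by rintro _ ⟨i, rfl⟩; exact h i⟩
  rw [toLinfty, dif_pos hm]

theorem IsUniformlySmooth.toLinfty_apply (hf : IsUniformlySmooth f U) {y : V} (hy : y ∈ U)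
    (i : I) : toLinfty f y i = f i y := by
  obtain ⟨C, hC⟩ := hf.exists_bound hy
  exact toLinfty_apply_of_bound hC i

theorem IsUniformlySmooth.differentiableAt (hf : IsUniformlySmooth f U) (hU : IsOpen U) {y : V}
    (hy : y ∈ U) (i : I) : DifferentiableAt ℝ (f i) y :=
  ((hf.contDiffOn i).contDiffAt (hU.mem_nhds hy)).differentiableAt (by simp)

theorem IsUniformlySmooth.fderiv_apply (hf : IsUniformlySmooth f U) (hU : IsOpen U) (v : V) :
    IsUniformlySmooth (fun i y => fderiv ℝ (f i) y v) U where
  contDiffOn i := ((hf.contDiffOn i).fderiv_of_isOpen hU (by simp)).clm_apply contDiffOn_const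
  bound K hKU hK k := by
    obtain ⟨C, hC⟩ := hf.bound K hKU hK (k + 1)
    refine ⟨‖v‖ * C, fun i y hy => ?_⟩
    have h1 : ContDiffAt ℝ ∞ (fderiv ℝ (f i)) y :=
      ((hf.contDiffOn i).fderiv_of_isOpen hU (by simp)).contDiffAt (hU.mem_nhds (hKU hy))
    refine (norm_iteratedFDeriv_clm_apply_const (h1.of_le (by exact_mod_cast le_top))
      le_rfl).trans ?_
    rw [norm_iteratedFDeriv_fderiv]
    exact mul_le_mul_of_nonneg_left (hC i y hy) (norm_nonneg v)

theorem norm_sub_sub_fderiv_le {g : V → ℂ} {y : V} {r C : ℝ}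
    (hg : ∀ z ∈ Metric.closedBall y r, ContDiffAt ℝ ∞ g z)
    (hC : ∀ z ∈ Metric.closedBall y r, ‖iteratedFDeriv ℝ 2 g z‖ ≤ C) {z : V}
    (hz : z ∈ Metric.closedBall y r) :
    ‖g z - g y - fderiv ℝ g y (z - y)‖ ≤ C * ‖z - y‖ ^ 2 := by
  have hr : 0 ≤ r := dist_nonneg.trans hz
  have hy : y ∈ Metric.closedBall y r := Metric.mem_closedBall_self hr
  have hC0 : 0 ≤ C := (norm_nonneg _).trans (hC y hy)
  have h1 : ∀ x ∈ Metric.closedBall y r, ‖fderiv ℝ g x - fderiv ℝ g y‖ ≤ C * ‖x - y‖ := by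
    intro x hx
    refine (convex_closedBall y r).norm_image_sub_le_of_norm_fderiv_le (𝕜 := ℝ)
      (f := fderiv ℝ g) (fun w hw => ?_) (fun w hw => ?_) hy hx
    · exact ((hg w hw).fderiv_right (m := ∞) (by simp)).differentiableAt
        (by simp)
    · refine le_trans (le_of_eq ?_) (hC w hw)
      rw [← norm_iteratedFDeriv_one, norm_iteratedFDeriv_fderiv]
  have hsub : Metric.closedBall y ‖z - y‖ ⊆ Metric.closedBall y r :=
    Metric.closedBall_subset_closedBall (by rwa [Metric.mem_closedBall, dist_eq_norm] at hz)
  have h2 := (convex_closedBall y ‖z - y‖).norm_image_sub_le_of_norm_fderiv_le' (𝕜 := ℝ)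
    (f := g) (φ := fderiv ℝ g y) (C := C * ‖z - y‖)
    (fun w hw => (hg w (hsub hw)).differentiableAt (by simp))
    (fun w hw => (h1 w (hsub hw)).trans (mul_le_mul_of_nonneg_left
      (by rwa [Metric.mem_closedBall, dist_eq_norm] at hw) hC0))
    (Metric.mem_closedBall_self (norm_nonneg _))
    (show z ∈ Metric.closedBall y ‖z - y‖ by rw [Metric.mem_closedBall, dist_eq_norm])
  calc _ ≤ _ := h2
    _ = _ := by ring

variable [FiniteDimensional ℝ V]

/-- The derivative of `y ↦ (f i y)_i` as a map to `ℓ^∞(I)` is taken coordinatewise. -/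
theorem IsUniformlySmooth.hasFDerivAt_toLinfty (hf : IsUniformlySmooth f U) (hU : IsOpen U) {y : V}
    (hy : y ∈ U) : ∃ L : V →L[ℝ] lp (fun _ : I => ℂ) ∞, HasFDerivAt (toLinfty f) L y ∧
      ∀ v, L v = toLinfty (fun i z => fderiv ℝ (f i) z v) y := by
  obtain ⟨C₁, hC₁⟩ := hf.bound {y} (by simpa using hy) isCompact_singleton 1
  have hb : ∀ i, ‖fderiv ℝ (f i) y‖ ≤ C₁ := fun i => by
    simpa using hC₁ i y rfl
  have happ : ∀ v i, toLinfty (fun i z => fderiv ℝ (f i) z v) y i = fderiv ℝ (f i) y v :=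
    fun v i => (hf.fderiv_apply hU v).toLinfty_apply hy i
  let L : V →L[ℝ] lp (fun _ : I => ℂ) ∞ := LinearMap.mkContinuous
    { toFun := fun v => toLinfty (fun i z => fderiv ℝ (f i) z v) y
      map_add' := fun v w => by
        ext i
        rw [lp.coeFn_add, Pi.add_apply, happ, happ, happ, map_add]
      map_smul' := fun r v => by
        ext i
        rw [lp.coeFn_smul, Pi.smul_apply, happ, RingHom.id_apply, happ, map_smul] }
    (max C₁ 0) fun v => lp.norm_le_of_forall_le (by positivity) fun i => by
      refine (le_of_eq (congrArg _ (happ v i))).trans (((fderiv ℝ (f i) y).le_opNorm v).trans ?_)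
      gcongr
      exact (hb i).trans (le_max_left _ _)
  refine ⟨L, ?_, fun v => rfl⟩
  obtain ⟨r, hr, hball⟩ := Metric.nhds_basis_closedBall.mem_iff.1 (hU.mem_nhds hy)
  obtain ⟨C, hC⟩ := hf.bound _ hball (isCompact_closedBall y r) 2
  refine HasFDerivAt.of_isLittleO (Asymptotics.IsBigO.trans_isLittleO (Asymptotics.IsBigO.of_bound
    (max C 0) ?_) (Asymptotics.isLittleO_pow_sub_sub y one_lt_two))
  filter_upwards [Metric.closedBall_mem_nhds y hr] with z hz
  refine lp.norm_le_of_forall_le (by positivity) fun i => ?_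
  rw [lp.coeFn_sub, lp.coeFn_sub, Pi.sub_apply, Pi.sub_apply, hf.toLinfty_apply (hball hz),
    hf.toLinfty_apply hy]
  refine (le_of_eq (congrArg (fun x => ‖f i z - f i y - x‖) (happ (z - y) i))).trans ?_
  refine (norm_sub_sub_fderiv_le (C := C)
    (fun w hw => (hf.contDiffOn i).contDiffAt (hU.mem_nhds (hball hw)))
    (fun w hw => hC i w hw) hz).trans ?_
  rw [Real.norm_eq_abs, abs_of_nonneg (by positivity)]
  gcongr
  exact le_max_left _ _

theorem IsUniformlySmooth.contDiffOn_toLinfty (hf : IsUniformlySmooth f U) (hU : IsOpen U) :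
    ContDiffOn ℝ ∞ (toLinfty f) U := by
  rw [contDiffOn_infty]
  intro n
  induction n generalizing f with
  | zero =>
    exact contDiffOn_zero.2 fun y hy =>
      (hf.hasFDerivAt_toLinfty hU hy).choose_spec.1.continuousAt.continuousWithinAt
  | succ n ih =>
    rw [Nat.cast_succ, contDiffOn_succ_iff_fderiv_of_isOpen hU]
    refine ⟨fun y hy => (hf.hasFDerivAt_toLinfty hU
      hy).choose_spec.1.differentiableAt.differentiableWithinAt, by simp, ?_⟩
    rw [contDiffOn_clm_apply]
    intro v
    refine (ih (hf.fderiv_apply hU v)).congr fun y hy => ?_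
    obtain ⟨L, hL, hLv⟩ := hf.hasFDerivAt_toLinfty hU hy
    rw [hL.fderiv, hLv]

end UniformlySmooth

/-! ### The regular representation on the orbits -/

section WeightedComp

variable {X Y : Type*}

theorem memlp_weightedComp (c : X → ℂ) {C : ℝ} (hc : ∀ x, ‖c x‖ ≤ C) (σ : X ↪ Y)
    (ξ : lp (fun _ : Y => ℂ) 2) : Memℓp (E := fun _ : X => ℂ) (fun x => c x * ξ (σ x)) 2 := by
  apply memℓp_gen
  have h : Summable fun y => ‖ξ y‖ ^ (2 : ℝ≥0∞).toReal := (lp.memℓp ξ).summable (by norm_num)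
  refine Summable.of_nonneg_of_le (fun x => by positivity) (fun x => ?_)
    ((h.comp_injective σ.injective).mul_left (C ^ (2 : ℝ≥0∞).toReal))
  rw [norm_mul, Real.mul_rpow (norm_nonneg _) (norm_nonneg _)]
  exact mul_le_mul_of_nonneg_right
    (Real.rpow_le_rpow (norm_nonneg _) (hc x) (by norm_num)) (by positivity)

theorem norm_weightedComp_le (c : X → ℂ) {C : ℝ} (hC : 0 ≤ C) (hc : ∀ x, ‖c x‖ ≤ C) (σ : X ↪ Y)
    (ξ : lp (fun _ : Y => ℂ) 2) :
    ‖(⟨_, memlp_weightedComp c hc σ ξ⟩ : lp (fun _ : X => ℂ) 2)‖ ≤ C * ‖ξ‖ := by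
  refine lp.norm_le_of_forall_sum_le (by norm_num) (by positivity) fun s => ?_
  rw [Real.mul_rpow hC (norm_nonneg _)]
  refine le_trans ?_ (mul_le_mul_of_nonneg_left
    (lp.sum_rpow_le_norm_rpow (by norm_num) ξ (s.map σ)) (by positivity))
  rw [Finset.sum_map, Finset.mul_sum]
  refine Finset.sum_le_sum fun x _ => ?_
  change ‖c x * ξ (σ x)‖ ^ _ ≤ _ * ‖ξ (σ x)‖ ^ _
  rw [norm_mul, Real.mul_rpow (norm_nonneg _) (norm_nonneg _)]
  exact mul_le_mul_of_nonneg_right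
    (Real.rpow_le_rpow (norm_nonneg _) (hc x) (by norm_num)) (by positivity)

/-- The operator `ξ ↦ c · (ξ ∘ σ)` from `ℓ²(Y)` to `ℓ²(X)`, for a bounded function `c` on `X` and
an injection `σ : X → Y`. -/
noncomputable def weightedComp (c : X → ℂ) (C : ℝ) (hC : 0 ≤ C) (hc : ∀ x, ‖c x‖ ≤ C) (σ : X ↪ Y) :
    lp (fun _ : Y => ℂ) 2 →L[ℂ] lp (fun _ : X => ℂ) 2 :=
  LinearMap.mkContinuous
    { toFun := fun ξ => ⟨fun x => c x * ξ (σ x), memlp_weightedComp c hc σ ξ⟩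
      map_add' := fun ξ η => by
        ext x
        exact mul_add (c x) (ξ (σ x)) (η (σ x))
      map_smul' := fun r ξ => by
        ext x
        exact mul_left_comm (c x) r (ξ (σ x)) }
    C fun ξ => norm_weightedComp_le c hC hc σ ξ

variable {c : X → ℂ} {C : ℝ} {hC : 0 ≤ C} {hc : ∀ x, ‖c x‖ ≤ C} {σ : X ↪ Y}

theorem weightedComp_apply (ξ : lp (fun _ : Y => ℂ) 2) (x : X) :
    weightedComp c C hC hc σ ξ x = c x * ξ (σ x) := rfl

theorem norm_weightedComp_le_const : ‖weightedComp c C hC hc σ‖ ≤ C :=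
  LinearMap.mkContinuous_norm_le _ hC _

theorem adjoint_weightedComp_apply (ξ : lp (fun _ : X => ℂ) 2) (x : X) :
    ContinuousLinearMap.adjoint (weightedComp c C hC hc σ) ξ (σ x) =
      (starRingEnd ℂ) (c x) * ξ x := by
  classical
  have h1 : weightedComp c C hC hc σ (lp.single 2 (σ x) 1) = lp.single 2 x (c x) := by
    ext z
    rw [weightedComp_apply, lp.single_apply, lp.single_apply]
    by_cases hz : z = x
    · subst hz; simp
    · simp [hz, σ.injective.eq_iff]
  have h2 := lp.inner_single_left (𝕜 := ℂ) (σ x) (1 : ℂ)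
    (ContinuousLinearMap.adjoint (weightedComp c C hC hc σ) ξ)
  rw [ContinuousLinearMap.adjoint_inner_right, h1, lp.inner_single_left] at h2
  simp only [RCLike.inner_apply, map_one, mul_one] at h2
  rw [← h2, mul_comm]

/-- A phase function times composition with an injection is a coisometry. -/
theorem weightedComp_comp_adjoint (h : ∀ x, ‖c x‖ = 1) :
    (weightedComp c C hC hc σ) ∘L ContinuousLinearMap.adjoint (weightedComp c C hC hc σ) =
      ContinuousLinearMap.id ℂ _ := by
  ext ξ x
  rw [ContinuousLinearMap.comp_apply, weightedComp_apply, adjoint_weightedComp_apply, ← mul_assoc,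
    Complex.mul_conj, Complex.normSq_eq_norm_sq, h]
  simp

end WeightedComp

section CrossedProduct

variable {Γ T : Type*} [Group Γ] [MulAction Γᵐᵒᵖ T]

theorem groupoidShift_apply (g : Γ) (x : T × Γ) :
    groupoidShift g x = (MulOpposite.op g • x.1, g⁻¹ * x.2) := rfl

/-- The phase `exp (i s ℓ(h))`. -/
noncomputable def phase {Γ : Type*} (ℓ : Γ → ℝ) (s : ℝ) (h : Γ) : ℂ :=
  Complex.exp ((s * ℓ h : ℝ) * Complex.I)

theorem norm_phase {Γ : Type*} (ℓ : Γ → ℝ) (s : ℝ) (h : Γ) : ‖phase ℓ s h‖ = 1 :=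
  Complex.norm_exp_ofReal_mul_I _

/-- The parametrization `h ↦ (x · h⁻¹, h)` of an orbit of the shifts of `T × Γ`. -/
def orbitEmbedding (Γ : Type*) {T : Type*} [Group Γ] [MulAction Γᵐᵒᵖ T] (x : T) : Γ ↪ T × Γ where
  toFun h := (MulOpposite.op h⁻¹ • x, h)
  inj' _ _ h := (Prod.ext_iff.1 h).2

theorem groupoidShift_orbitEmbedding (x : T) (g h : Γ) :
    groupoidShift g (orbitEmbedding Γ x h) = orbitEmbedding Γ x (g⁻¹ * h) := by
  simp [groupoidShift_apply, orbitEmbedding, mul_smul]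

/-- The restriction of `ℓ²(T × Γ)` to the orbit of `x`, followed by multiplication with the phase
function. -/
noncomputable def orbitRestrict (ℓ : Γ → ℝ) (s : ℝ) (x : T) :
    EllTwo T Γ →L[ℂ] lp (fun _ : Γ => ℂ) 2 :=
  weightedComp (phase ℓ s) 1 zero_le_one (fun h => (norm_phase ℓ s h).le) (orbitEmbedding Γ x)

theorem orbitRestrict_apply (ℓ : Γ → ℝ) (s : ℝ) (x : T) (ξ : EllTwo T Γ) (h : Γ) :
    orbitRestrict ℓ s x ξ h = phase ℓ s h * ξ (MulOpposite.op h⁻¹ • x, h) := rfl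

theorem norm_orbitRestrict_le (ℓ : Γ → ℝ) (s : ℝ) (x : T) :
    ‖orbitRestrict (Γ := Γ) ℓ s x‖ ≤ 1 := norm_weightedComp_le_const

/-- The operator `ξ ↦ c · ξ(g⁻¹ ·)` on `ℓ²(Γ)`. -/
noncomputable def shiftOp (c : Γ → ℂ) (C : ℝ) (hC : 0 ≤ C) (hc : ∀ h, ‖c h‖ ≤ C) (g : Γ) :
    lp (fun _ : Γ => ℂ) 2 →L[ℂ] lp (fun _ : Γ => ℂ) 2 :=
  weightedComp c C hC hc (Equiv.mulLeft g⁻¹).toEmbedding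

/-- The weights of the operator by which the monomial `f g` acts on the orbit of `x`. -/
noncomputable def orbitWeight (ℓ : Γ → ℝ) (s : ℝ) (x : T) (f : T → ℂ) (g h : Γ) : ℂ :=
  Complex.exp ((s * (ℓ h - ℓ (g⁻¹ * h)) : ℝ) * Complex.I) * f (MulOpposite.op h⁻¹ • x)

theorem orbitRestrict_comp_adjoint (ℓ : Γ → ℝ) (s : ℝ) (x : T) :
    orbitRestrict (Γ := Γ) ℓ s x ∘L ContinuousLinearMap.adjoint (orbitRestrict ℓ s x) =
      ContinuousLinearMap.id ℂ _ :=
  weightedComp_comp_adjoint (norm_phase ℓ s)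

open Classical in
/-- The matrix entry at `h`, `k` of an operator on `ℓ²(Γ)`. -/
noncomputable def matrixEntry {Γ : Type*} (h k : Γ) :
    (lp (fun _ : Γ => ℂ) 2 →L[ℂ] lp (fun _ : Γ => ℂ) 2) →L[ℂ] ℂ :=
  LinearMap.mkContinuous
    { toFun := fun A => A (lp.single 2 k 1) h
      map_add' := fun _ _ => rfl
      map_smul' := fun _ _ => rfl }
    1 fun A => by
      refine (lp.norm_apply_le_norm (by norm_num) _ h).trans ((A.le_opNorm _).trans ?_)
      rw [lp.norm_single (by norm_num), norm_one, mul_one, one_mul]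

theorem norm_matrixEntry_le {Γ : Type*} (h k : Γ) : ‖matrixEntry h k‖ ≤ 1 :=
  LinearMap.mkContinuous_norm_le _ zero_le_one _

theorem eq_of_matrixEntry_eq {Γ : Type*} {A A' : lp (fun _ : Γ => ℂ) 2 →L[ℂ] lp (fun _ : Γ => ℂ) 2}
    (hA : ∀ h k, matrixEntry h k A = matrixEntry h k A') : A = A' := by
  classical
  refine lp.ext_continuousLinearMap (by norm_num) fun k => ?_
  ext h
  exact hA h k

open Classical in
theorem matrixEntry_shiftOp {c : Γ → ℂ} {C : ℝ} {hC : 0 ≤ C} {hc : ∀ h, ‖c h‖ ≤ C} (g h k : Γ) :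
    matrixEntry h k (shiftOp c C hC hc g) = if h * k⁻¹ = g then c h else 0 := by
  change c h * (lp.single 2 k (1 : ℂ) : lp (fun _ : Γ => ℂ) 2) (g⁻¹ * h) = _
  rw [lp.single_apply, Pi.single_apply, mul_ite, mul_one, mul_zero]
  congr 1
  rw [inv_mul_eq_iff_eq_mul, mul_inv_eq_iff_eq_mul]

variable [TopologicalSpace T] [CompactSpace T]

theorem norm_orbitWeight_le (ℓ : Γ → ℝ) (s : ℝ) (x : T) (f : C(T, ℂ)) (g h : Γ) :
    ‖orbitWeight ℓ s x f g h‖ ≤ ‖f‖ := by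
  rw [orbitWeight, norm_mul, Complex.norm_exp_ofReal_mul_I, one_mul]
  exact f.norm_coe_le_norm _

theorem regularOp_apply (f : C(T, ℂ)) (g : Γ) (ξ : EllTwo T Γ) (x : T × Γ) :
    regularOp f g ξ x = f x.1 * ξ (groupoidShift g x) := rfl

theorem norm_regularOp_le (f : C(T, ℂ)) (g : Γ) : ‖regularOp f g‖ ≤ ‖f‖ :=
  LinearMap.mkContinuous_norm_le _ (norm_nonneg f) _

theorem regularOp_sub (f f' : C(T, ℂ)) (g : Γ) :
    regularOp f g - regularOp f' g = regularOp (f - f') g := by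
  ext ξ x
  exact (sub_mul (f x.1) (f' x.1) _).symm

theorem regularOp_one : regularOp (1 : C(T, ℂ)) (1 : Γ) = 1 := by
  ext ξ x
  rw [regularOp_apply, groupoidShift_apply]
  simp

theorem orbitRestrict_comp_regularOp (ℓ : Γ → ℝ) (s : ℝ) (x : T) (f : C(T, ℂ)) (g : Γ) :
    orbitRestrict ℓ s x ∘L regularOp f g =
      shiftOp (orbitWeight ℓ s x f g) ‖f‖ (norm_nonneg f) (norm_orbitWeight_le ℓ s x f g) g ∘L
        orbitRestrict ℓ s x := by
  ext ξ h
  change phase ℓ s h * (f (MulOpposite.op h⁻¹ • x) * ξ (groupoidShift g (orbitEmbedding Γ x h))) =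
    orbitWeight ℓ s x f g h * (phase ℓ s (g⁻¹ * h) * ξ (orbitEmbedding Γ x (g⁻¹ * h)))
  rw [groupoidShift_orbitEmbedding, orbitWeight, phase, phase]
  have : Complex.exp ((s * ℓ h : ℝ) * Complex.I) =
      Complex.exp ((s * (ℓ h - ℓ (g⁻¹ * h)) : ℝ) * Complex.I) *
        Complex.exp ((s * ℓ (g⁻¹ * h) : ℝ) * Complex.I) := by
    rw [← Complex.exp_add]
    congr 1
    push_cast
    ring
  rw [this]
  ring

/-- Compression of an operator to an orbit. -/
noncomputable def orbitCompress (ℓ : Γ → ℝ) (s : ℝ) (x : T) :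
    ReducedCrossedProduct Γ T →L[ℂ] (lp (fun _ : Γ => ℂ) 2 →L[ℂ] lp (fun _ : Γ => ℂ) 2) :=
  LinearMap.mkContinuous
    { toFun := fun a => orbitRestrict ℓ s x ∘L (a : EllTwo T Γ →L[ℂ] EllTwo T Γ) ∘L
        ContinuousLinearMap.adjoint (orbitRestrict ℓ s x)
      map_add' := fun a b => by
        simp [ContinuousLinearMap.add_comp, ContinuousLinearMap.comp_add]
      map_smul' := fun r a => by
        simp [ContinuousLinearMap.smul_comp] }
    1 fun a => by
      have h1 := norm_orbitRestrict_le ℓ s x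
      have h2 : ‖ContinuousLinearMap.adjoint (orbitRestrict (Γ := Γ) ℓ s x)‖ ≤ 1 := by
        rwa [LinearIsometryEquiv.norm_map]
      refine (ContinuousLinearMap.opNorm_comp_le _ _).trans (mul_le_mul h1
        ((ContinuousLinearMap.opNorm_comp_le _ _).trans ?_) (norm_nonneg _) zero_le_one)
      exact mul_le_of_le_one_right (norm_nonneg _) h2

theorem orbitCompress_apply (ℓ : Γ → ℝ) (s : ℝ) (x : T) (a : ReducedCrossedProduct Γ T) :
    orbitCompress ℓ s x a = orbitRestrict ℓ s x ∘L (a : EllTwo T Γ →L[ℂ] EllTwo T Γ) ∘L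
        ContinuousLinearMap.adjoint (orbitRestrict ℓ s x) := rfl

theorem orbitCompress_monomial (ℓ : Γ → ℝ) (s : ℝ) (x : T) (f : C(T, ℂ)) (g : Γ) :
    orbitCompress ℓ s x (monomial f g) =
      shiftOp (orbitWeight ℓ s x f g) ‖f‖ (norm_nonneg f) (norm_orbitWeight_le ℓ s x f g) g := by
  rw [orbitCompress_apply]
  change orbitRestrict ℓ s x ∘L regularOp f g ∘L _ = _
  rw [← ContinuousLinearMap.comp_assoc, orbitRestrict_comp_regularOp,
    ContinuousLinearMap.comp_assoc, orbitRestrict_comp_adjoint, ContinuousLinearMap.comp_id]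

/-- The coefficient `t_γ(θ)` of `∑ t_γ γ`. -/
noncomputable def coefficient (γ : Γ) (θ : T) : ReducedCrossedProduct Γ T →L[ℂ] ℂ :=
  matrixEntry 1 γ⁻¹ ∘L orbitCompress 0 0 θ

open Classical in
theorem coefficient_monomial (γ g : Γ) (θ : T) (f : C(T, ℂ)) :
    coefficient γ θ (monomial f g) = if γ = g then f θ else 0 := by
  change matrixEntry 1 γ⁻¹ (orbitCompress 0 0 θ (monomial f g)) = _
  rw [orbitCompress_monomial, matrixEntry_shiftOp]
  simp [orbitWeight]

variable [ContinuousConstSMul Γᵐᵒᵖ T]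

/-- The translate `θ ↦ f (θ · g)` of a continuous function. -/
noncomputable def translateMap (g : Γ) (f : C(T, ℂ)) : C(T, ℂ) :=
  f.comp ⟨fun θ => MulOpposite.op g • θ, continuous_const_smul _⟩

theorem translateMap_apply {Γ T : Type*} [Group Γ] [MulAction Γᵐᵒᵖ T] [TopologicalSpace T]
    [ContinuousConstSMul Γᵐᵒᵖ T] (g : Γ) (f : C(T, ℂ)) (θ : T) :
    translateMap g f θ = f (MulOpposite.op g • θ) := rfl

theorem regularOp_mul (f f' : C(T, ℂ)) (g g' : Γ) :
    regularOp f g * regularOp f' g' = regularOp (f * translateMap g f') (g * g') := by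
  ext ξ x
  rw [mul_apply_eq_comp, regularOp_apply, regularOp_apply, regularOp_apply,
    ContinuousMap.mul_apply, translateMap_apply, mul_assoc]
  simp [groupoidShift_apply, mul_smul, mul_assoc]

theorem star_regularOp (f : C(T, ℂ)) (g : Γ) :
    star (regularOp f g) = regularOp (translateMap g⁻¹ (star f)) g⁻¹ := by
  rw [ContinuousLinearMap.star_eq_adjoint, eq_comm, ContinuousLinearMap.eq_adjoint_iff]
  intro ξ η
  rw [lp.inner_eq_tsum, lp.inner_eq_tsum, ← (groupoidShift (T := T) g).tsum_eq]
  refine tsum_congr fun z => ?_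
  rw [regularOp_apply, regularOp_apply, translateMap_apply]
  simp only [groupoidShift_apply, MulOpposite.op_inv, inv_smul_smul, inv_inv, mul_inv_cancel_left,
    ContinuousMap.star_apply, RCLike.inner_apply, map_mul, RCLike.star_def, RCLike.conj_conj]
  ring

theorem dense_span_monomial :
    Dense (Submodule.span ℂ (Set.range fun p : C(T, ℂ) × Γ => monomial p.1 p.2) :
      Set (ReducedCrossedProduct Γ T)) := by
  set s : Set (EllTwo T Γ →L[ℂ] EllTwo T Γ) :=
    {A | ∃ (f : C(T, ℂ)) (g : Γ), A = regularOp f g} with hs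
  have hstar : s ∪ star s ⊆ s := by
    rintro A (hA | ⟨f, g, hA⟩)
    · exact hA
    · exact ⟨_, _, by rw [← star_regularOp, ← hA, star_star]⟩
  have hmon : (Submonoid.closure (s ∪ star s) : Set (EllTwo T Γ →L[ℂ] EllTwo T Γ)) ⊆ s := by
    intro A hA
    induction hA using Submonoid.closure_induction with
    | mem x hx => exact hstar hx
    | one => exact ⟨1, 1, regularOp_one.symm⟩
    | mul x y _ _ hx hy =>
      obtain ⟨f, g, rfl⟩ := hx
      obtain ⟨f', g', rfl⟩ := hy
      exact ⟨_, _, regularOp_mul f f' g g'⟩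
  intro a
  rw [closure_subtype]
  refine closure_mono ?_ a.2
  intro A hA
  have h1 : A ∈ Submodule.span ℂ s := by
    refine Submodule.span_mono hmon ?_
    rw [← StarAlgebra.adjoin_eq_span]
    exact hA
  have h2 : s = (ReducedCrossedProduct Γ T).toSubalgebra.toSubmodule.subtype ''
      (Set.range fun p : C(T, ℂ) × Γ => monomial p.1 p.2) := by
    ext A
    constructor
    · rintro ⟨f, g, rfl⟩
      exact ⟨monomial f g, ⟨(f, g), rfl⟩, rfl⟩
    · rintro ⟨_, ⟨⟨f, g⟩, rfl⟩, rfl⟩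
      exact ⟨f, g, rfl⟩
  rw [h2, ← Submodule.map_span] at h1
  exact h1

theorem crossedProduct_ext {W : Type*} [NormedAddCommGroup W] [NormedSpace ℂ W]
    {φ ψ : ReducedCrossedProduct Γ T →L[ℂ] W}
    (h : ∀ (f : C(T, ℂ)) (g : Γ), φ (monomial f g) = ψ (monomial f g)) : φ = ψ :=
  ContinuousLinearMap.ext_on dense_span_monomial (by rintro _ ⟨⟨f, g⟩, rfl⟩; exact h f g)

theorem orbitCompress_comp_orbitRestrict (ℓ : Γ → ℝ) (s : ℝ) (x : T)
    (a : ReducedCrossedProduct Γ T) :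
    orbitCompress ℓ s x a ∘L orbitRestrict ℓ s x =
      orbitRestrict ℓ s x ∘L (a : EllTwo T Γ →L[ℂ] EllTwo T Γ) := by
  let φ : ReducedCrossedProduct Γ T →L[ℂ] (EllTwo T Γ →L[ℂ] lp (fun _ : Γ => ℂ) 2) :=
    ((ContinuousLinearMap.compL ℂ _ _ _).flip (orbitRestrict ℓ s x)) ∘L orbitCompress ℓ s x
  let ψ : ReducedCrossedProduct Γ T →L[ℂ] (EllTwo T Γ →L[ℂ] lp (fun _ : Γ => ℂ) 2) :=
    (ContinuousLinearMap.compL ℂ _ _ _ (orbitRestrict ℓ s x)) ∘L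
      (ReducedCrossedProduct Γ T).toSubalgebra.toSubmodule.subtypeL
  have h : φ = ψ := crossedProduct_ext fun f g => by
    change orbitCompress ℓ s x (monomial f g) ∘L orbitRestrict ℓ s x =
      orbitRestrict ℓ s x ∘L regularOp f g
    rw [orbitCompress_monomial, orbitRestrict_comp_regularOp]
  exact DFunLike.congr_fun h a

/-- The representation of `C⁰(T) ⋊ Γ` on `ℓ²(Γ)`, identified with `ℓ²` of the orbit of `x`, and
conjugated by the phase function. -/
noncomputable def orbitRep (ℓ : Γ → ℝ) (s : ℝ) (x : T) :
    ReducedCrossedProduct Γ T →ₐ[ℂ] (lp (fun _ : Γ => ℂ) 2 →L[ℂ] lp (fun _ : Γ => ℂ) 2) :=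
  AlgHom.ofLinearMap (orbitCompress ℓ s x).toLinearMap
    (orbitRestrict_comp_adjoint ℓ s x) fun a b => by
      change orbitRestrict ℓ s x ∘L ((a : EllTwo T Γ →L[ℂ] EllTwo T Γ) ∘L
        (b : EllTwo T Γ →L[ℂ] EllTwo T Γ)) ∘L _ = orbitCompress ℓ s x a ∘L orbitCompress ℓ s x b
      rw [orbitCompress_apply ℓ s x b, ← ContinuousLinearMap.comp_assoc (orbitCompress ℓ s x a),
        orbitCompress_comp_orbitRestrict]
      simp only [ContinuousLinearMap.comp_assoc]

theorem norm_orbitRep_le (ℓ : Γ → ℝ) (s : ℝ) (x : T) (a : ReducedCrossedProduct Γ T) :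
    ‖orbitRep ℓ s x a‖ ≤ ‖a‖ := by
  have h := (orbitCompress ℓ s x).le_of_opNorm_le
    (LinearMap.mkContinuous_norm_le _ zero_le_one _) a
  rwa [one_mul] at h

/-- The matrix entries in all the representations are given by the coefficients. -/
theorem matrixEntry_orbitRep (ℓ : Γ → ℝ) (s : ℝ) (x : T) (h k : Γ)
    (a : ReducedCrossedProduct Γ T) :
    matrixEntry h k (orbitRep ℓ s x a) = Complex.exp ((s * (ℓ h - ℓ k) : ℝ) * Complex.I) *
      coefficient (h * k⁻¹) (MulOpposite.op h⁻¹ • x) a := by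
  classical
  have : matrixEntry h k ∘L orbitCompress ℓ s x =
      Complex.exp ((s * (ℓ h - ℓ k) : ℝ) * Complex.I) •
        coefficient (h * k⁻¹) (MulOpposite.op h⁻¹ • x) := by
    refine crossedProduct_ext fun f g => ?_
    change matrixEntry h k (orbitCompress ℓ s x (monomial f g)) =
      Complex.exp ((s * (ℓ h - ℓ k) : ℝ) * Complex.I) *
        coefficient (h * k⁻¹) (MulOpposite.op h⁻¹ • x) (monomial f g)
    rw [orbitCompress_monomial, matrixEntry_shiftOp, coefficient_monomial]
    split_ifs with hg
    · rw [orbitWeight, ← hg]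
      simp
    · rw [mul_zero]
  exact DFunLike.congr_fun this a

theorem eq_of_coefficient_eq {a b : ReducedCrossedProduct Γ T}
    (h : ∀ γ θ, coefficient γ θ a = coefficient γ θ b) : a = b := by
  have h1 : ∀ x : T, orbitCompress (Γ := Γ) 0 0 x a = orbitCompress 0 0 x b := fun x =>
    eq_of_matrixEntry_eq fun k l => by
      have ha := matrixEntry_orbitRep 0 0 x k l a
      rw [h, ← matrixEntry_orbitRep] at ha
      exact ha
  apply Subtype.ext
  ext ξ ⟨θ, k⟩
  have ha := orbitCompress_comp_orbitRestrict 0 0 (MulOpposite.op k • θ) a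
  rw [h1, orbitCompress_comp_orbitRestrict] at ha
  have h2 : orbitRestrict 0 0 (MulOpposite.op k • θ) ((b : EllTwo T Γ →L[ℂ] EllTwo T Γ) ξ) k =
      orbitRestrict 0 0 (MulOpposite.op k • θ) ((a : EllTwo T Γ →L[ℂ] EllTwo T Γ) ξ) k :=
    congrArg (fun A : EllTwo T Γ →L[ℂ] lp (fun _ : Γ => ℂ) 2 => A ξ k) ha
  rw [orbitRestrict_apply, orbitRestrict_apply] at h2
  have h3 := mul_left_cancel₀ (norm_ne_zero_iff.1 (by rw [norm_phase]; exact one_ne_zero)) h2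
  simpa using h3.symm

end CrossedProduct

/-! ### Derivatives of isometries -/

section LocalIsometry

-- needed for the normed group structure of the space of trilinear maps
set_option maxSynthPendingDepth 3

variable {E : Type*} [NormedAddCommGroup E] [NormedSpace ℝ E]

/-- A smooth Riemannian metric on the open subset `U` of the vector space `E`. -/
structure IsLocalMetric (G : E → E →L[ℝ] E →L[ℝ] ℝ) (U : Set E) : Prop where
  isOpen : IsOpen U
  contDiffOn : ContDiffOn ℝ ∞ G U
  symm : ∀ y ∈ U, ∀ v w, G y v w = G y w v
  pos : ∀ y ∈ U, ∀ v, v ≠ 0 → 0 < G y v v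

/-- A smooth map on the open set `s` which is isometric from the metric `G₁` on `U₁` to the
metric `G₂` on `U₂`. -/
structure IsLocalIsometry (G₁ G₂ : E → E →L[ℝ] E →L[ℝ] ℝ) (U₁ U₂ s : Set E) (ψ : E → E) :
    Prop where
  isOpen : IsOpen s
  contDiffOn : ContDiffOn ℝ ∞ ψ s
  subset : s ⊆ U₁
  mapsTo : Set.MapsTo ψ s U₂
  isometry : ∀ y ∈ s, ∀ v w, G₂ (ψ y) (fderiv ℝ ψ y v) (fderiv ℝ ψ y w) = G₁ y v w

/-- Twice the Christoffel symbol of the first kind, `w ↦ D_u(v, w) + D_v(u, w) - D_w(u, v)`, for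
the derivative `D` of a metric. -/
noncomputable def christoffelForm (D : E →L[ℝ] E →L[ℝ] E →L[ℝ] ℝ) (u v : E) : E →L[ℝ] ℝ :=
  D u v + D v u - (D.flip u).flip v

theorem christoffelForm_apply (D : E →L[ℝ] E →L[ℝ] E →L[ℝ] ℝ) (u v w : E) :
    christoffelForm D u v w = D u v w + D v u w - D w u v := rfl

variable {G₁ G₂ : E → E →L[ℝ] E →L[ℝ] ℝ} {U₁ U₂ s : Set E} {ψ : E → E}

theorem IsLocalMetric.differentiableAt {G : E → E →L[ℝ] E →L[ℝ] ℝ} {U : Set E}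
    (hG : IsLocalMetric G U) {y : E} (hy : y ∈ U) : DifferentiableAt ℝ G y :=
  (hG.contDiffOn.contDiffAt (hG.isOpen.mem_nhds hy)).differentiableAt (by simp)

theorem IsLocalIsometry.contDiffAt (h : IsLocalIsometry G₁ G₂ U₁ U₂ s ψ) {y : E} (hy : y ∈ s) :
    ContDiffAt ℝ ∞ ψ y :=
  h.contDiffOn.contDiffAt (h.isOpen.mem_nhds hy)

/-- The derivative of the isometry equation. -/
theorem IsLocalIsometry.fderiv_isometry (h₁ : IsLocalMetric G₁ U₁) (h₂ : IsLocalMetric G₂ U₂)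
    (h : IsLocalIsometry G₁ G₂ U₁ U₂ s ψ) {y : E} (hy : y ∈ s) (u v w : E) :
    fderiv ℝ G₂ (ψ y) (fderiv ℝ ψ y u) (fderiv ℝ ψ y v) (fderiv ℝ ψ y w)
      + G₂ (ψ y) (fderiv ℝ (fderiv ℝ ψ) y u v) (fderiv ℝ ψ y w)
      + G₂ (ψ y) (fderiv ℝ ψ y v) (fderiv ℝ (fderiv ℝ ψ) y u w) = fderiv ℝ G₁ y u v w := by
  have hψ : HasFDerivAt ψ (fderiv ℝ ψ y) y :=
    ((h.contDiffAt hy).differentiableAt (by simp)).hasFDerivAt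
  have hdψ : HasFDerivAt (fderiv ℝ ψ) (fderiv ℝ (fderiv ℝ ψ) y) y :=
    (((h.contDiffAt hy).fderiv_right (m := ∞) (by simp)).differentiableAt (by simp)).hasFDerivAt
  have hG₂ : HasFDerivAt (fun z => G₂ (ψ z)) ((fderiv ℝ G₂ (ψ y)).comp (fderiv ℝ ψ y)) y :=
    (h₂.differentiableAt (h.mapsTo hy)).hasFDerivAt.comp y hψ
  have hd : ∀ v, HasFDerivAt (fun z => fderiv ℝ ψ z v)
      ((ContinuousLinearMap.apply ℝ E v).comp (fderiv ℝ (fderiv ℝ ψ) y)) y := fun v =>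
    (ContinuousLinearMap.apply ℝ E v).hasFDerivAt.comp y hdψ
  have h3 := (hG₂.clm_apply (hd v)).clm_apply (hd w)
  have h4 : HasFDerivAt (fun z => G₁ z v w)
      (((ContinuousLinearMap.apply ℝ ℝ w).comp (ContinuousLinearMap.apply ℝ (E →L[ℝ] ℝ) v)).comp
        (fderiv ℝ G₁ y)) y :=
    ((ContinuousLinearMap.apply ℝ ℝ w).comp
      (ContinuousLinearMap.apply ℝ (E →L[ℝ] ℝ) v)).hasFDerivAt.comp y
        (h₁.differentiableAt (h.subset hy)).hasFDerivAt
  have h5 := h4.congr_of_eventuallyEq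
    (f₁ := fun z => G₂ (ψ z) (fderiv ℝ ψ z v) (fderiv ℝ ψ z w))
    (by filter_upwards [h.isOpen.mem_nhds hy] with z hz using h.isometry z hz v w)
  have h6 := DFunLike.congr_fun (h3.unique h5) u
  simp at h6
  rw [← h6]
  ring

/-- An isometry maps Christoffel symbols to Christoffel symbols; this determines the second
derivative by the first. -/
theorem IsLocalIsometry.koszul (h₁ : IsLocalMetric G₁ U₁) (h₂ : IsLocalMetric G₂ U₂)
    (h : IsLocalIsometry G₁ G₂ U₁ U₂ s ψ) {y : E} (hy : y ∈ s) (u v w : E) :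
    G₂ (ψ y) (fderiv ℝ (fderiv ℝ ψ) y u v) (fderiv ℝ ψ y w) =
      (2⁻¹ : ℝ) * (christoffelForm (fderiv ℝ G₁ y) u v w - christoffelForm (fderiv ℝ G₂ (ψ y))
        (fderiv ℝ ψ y u) (fderiv ℝ ψ y v) (fderiv ℝ ψ y w)) := by
  have hs : ∀ a b, fderiv ℝ (fderiv ℝ ψ) y a b = fderiv ℝ (fderiv ℝ ψ) y b a :=
    (h.contDiffAt hy).isSymmSndFDerivAt
      (by simpa using le_of_lt (WithTop.coe_lt_coe.2 (ENat.natCast_lt_top 2)))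
  have e1 := h.fderiv_isometry h₁ h₂ hy u v w
  have e2 := h.fderiv_isometry h₁ h₂ hy v u w
  have e3 := h.fderiv_isometry h₁ h₂ hy w u v
  rw [hs v u, h₂.symm _ (h.mapsTo hy) (fderiv ℝ ψ y u)] at e2
  rw [hs w u, hs w v, h₂.symm _ (h.mapsTo hy) (fderiv ℝ (fderiv ℝ ψ) y u w)] at e3
  rw [h₂.symm _ (h.mapsTo hy) (fderiv ℝ (fderiv ℝ ψ) y v w)] at e2
  rw [h₂.symm _ (h.mapsTo hy) _ (fderiv ℝ (fderiv ℝ ψ) y v w)] at e2 e3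
  rw [christoffelForm_apply, christoffelForm_apply]
  linarith

variable [FiniteDimensional ℝ E]

theorem IsLocalMetric.isInvertible {G : E → E →L[ℝ] E →L[ℝ] ℝ} {U : Set E}
    (hG : IsLocalMetric G U) {y : E} (hy : y ∈ U) : (G y).IsInvertible := by
  have hinj : Function.Injective (G y : E →ₗ[ℝ] (E →L[ℝ] ℝ)) := by
    rw [← LinearMap.ker_eq_bot, LinearMap.ker_eq_bot']
    intro v hv
    by_contra hne
    have := hG.pos y hy v hne
    rw [show G y v = 0 from hv] at this
    simp at this
  have hrank : Module.finrank ℝ E = Module.finrank ℝ (E →L[ℝ] ℝ) := by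
    rw [← (LinearMap.toContinuousLinearMap (𝕜 := ℝ) (E := E) (F' := ℝ)).finrank_eq]
    exact (Subspace.dual_finrank_eq (K := ℝ) (V := E)).symm
  exact ⟨(LinearEquiv.ofInjectiveOfFinrankEq _ hinj hrank).toContinuousLinearEquiv, rfl⟩

theorem IsLocalIsometry.surjective_fderiv (h₁ : IsLocalMetric G₁ U₁)
    (h : IsLocalIsometry G₁ G₂ U₁ U₂ s ψ) {y : E} (hy : y ∈ s) :
    Function.Surjective (fderiv ℝ ψ y) := by
  refine LinearMap.surjective_of_injective (f := (fderiv ℝ ψ y : E →ₗ[ℝ] E)) ?_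
  rw [← LinearMap.ker_eq_bot, LinearMap.ker_eq_bot']
  intro v hv
  by_contra hne
  have := h₁.pos y (h.subset hy) v hne
  rw [← h.isometry y hy, show fderiv ℝ ψ y v = 0 from hv] at this
  simp at this

/-- The second derivative, in the directions `u` and `v`, of an isometry with value `p.2.1` and
derivative `p.2.2` at the point `p.1`. -/
noncomputable def isometrySndDeriv (G₁ G₂ : E → E →L[ℝ] E →L[ℝ] ℝ) (u v : E)
    (p : E × E × (E →L[ℝ] E)) : E :=
  p.2.2 ((G₁ p.1).inverse ((2⁻¹ : ℝ) • (christoffelForm (fderiv ℝ G₁ p.1) u v -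
    (christoffelForm (fderiv ℝ G₂ p.2.1) (p.2.2 u) (p.2.2 v)).comp p.2.2)))

theorem IsLocalIsometry.fderiv_fderiv (h₁ : IsLocalMetric G₁ U₁) (h₂ : IsLocalMetric G₂ U₂)
    (h : IsLocalIsometry G₁ G₂ U₁ U₂ s ψ) {y : E} (hy : y ∈ s) (u v : E) :
    fderiv ℝ (fderiv ℝ ψ) y u v = isometrySndDeriv G₁ G₂ u v (y, ψ y, fderiv ℝ ψ y) := by
  obtain ⟨X, hX⟩ := h.surjective_fderiv h₁ hy (fderiv ℝ (fderiv ℝ ψ) y u v)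
  have key : G₁ y X = (2⁻¹ : ℝ) • (christoffelForm (fderiv ℝ G₁ y) u v -
      (christoffelForm (fderiv ℝ G₂ (ψ y)) (fderiv ℝ ψ y u) (fderiv ℝ ψ y v)).comp
        (fderiv ℝ ψ y)) := by
    ext w
    rw [← h.isometry y hy, hX, h.koszul h₁ h₂ hy]
    rfl
  rw [isometrySndDeriv, ← key, (h₁.isInvertible (h.subset hy)).inverse_apply_eq.2 rfl, hX]

theorem ContDiffOn.christoffelForm {V : Type*} [NormedAddCommGroup V] [NormedSpace ℝ V]
    {t : Set V} {D : V → E →L[ℝ] E →L[ℝ] E →L[ℝ] ℝ} {u v : V → E} (hD : ContDiffOn ℝ ∞ D t)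
    (hu : ContDiffOn ℝ ∞ u t) (hv : ContDiffOn ℝ ∞ v t) :
    ContDiffOn ℝ ∞ (fun z => christoffelForm (D z) (u z) (v z)) t := by
  rw [contDiffOn_clm_apply]
  intro w
  simp only [christoffelForm_apply]
  exact (((hD.clm_apply hu).clm_apply hv).clm_apply contDiffOn_const |>.add
    (((hD.clm_apply hv).clm_apply hu).clm_apply contDiffOn_const)).sub
    (((hD.clm_apply contDiffOn_const).clm_apply hu).clm_apply hv)

theorem contDiffOn_isometrySndDeriv (h₁ : IsLocalMetric G₁ U₁) (h₂ : IsLocalMetric G₂ U₂)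
    (u v : E) :
    ContDiffOn ℝ ∞ (isometrySndDeriv G₁ G₂ u v) (U₁ ×ˢ U₂ ×ˢ Set.univ) := by
  have f1 : ContDiffOn ℝ ∞ (fun p : E × E × (E →L[ℝ] E) => p.1) (U₁ ×ˢ U₂ ×ˢ Set.univ) :=
    contDiff_fst.contDiffOn
  have f2 : ContDiffOn ℝ ∞ (fun p : E × E × (E →L[ℝ] E) => p.2.1) (U₁ ×ˢ U₂ ×ˢ Set.univ) :=
    (contDiff_fst.comp contDiff_snd).contDiffOn
  have f3 : ContDiffOn ℝ ∞ (fun p : E × E × (E →L[ℝ] E) => p.2.2) (U₁ ×ˢ U₂ ×ˢ Set.univ) :=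
    (contDiff_snd.comp contDiff_snd).contDiffOn
  have g1 : ContDiffOn ℝ ∞ (fun p : E × E × (E →L[ℝ] E) => fderiv ℝ G₁ p.1)
      (U₁ ×ˢ U₂ ×ˢ Set.univ) :=
    (h₁.contDiffOn.fderiv_of_isOpen h₁.isOpen (by simp)).comp f1 fun p hp => hp.1
  have g2 : ContDiffOn ℝ ∞ (fun p : E × E × (E →L[ℝ] E) => fderiv ℝ G₂ p.2.1)
      (U₁ ×ˢ U₂ ×ˢ Set.univ) :=
    (h₂.contDiffOn.fderiv_of_isOpen h₂.isOpen (by simp)).comp f2 fun p hp => hp.2.1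
  have g3 : ContDiffOn ℝ ∞ (fun p : E × E × (E →L[ℝ] E) => (G₁ p.1).inverse)
      (U₁ ×ˢ U₂ ×ˢ Set.univ) := by
    intro p hp
    exact (h₁.isInvertible hp.1).contDiffAt_map_inverse.comp_contDiffWithinAt p
      ((h₁.contDiffOn.comp f1 fun p hp => hp.1) p hp)
  exact f3.clm_apply (g3.clm_apply (ContDiffOn.const_smul _
    ((g1.christoffelForm contDiffOn_const contDiffOn_const).sub
      ((g2.christoffelForm (f3.clm_apply contDiffOn_const)
        (f3.clm_apply contDiffOn_const)).clm_comp f3))))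

/-- Isometries satisfy a second order differential equation `D²ψ = F(y, ψ, Dψ)` with a smooth
function `F`. -/
theorem exists_isometry_equation (h₁ : IsLocalMetric G₁ U₁) (h₂ : IsLocalMetric G₂ U₂) :
    ∃ F : E × E × (E →L[ℝ] E) → E →L[ℝ] E →L[ℝ] E,
      ContDiffOn ℝ ∞ F (U₁ ×ˢ U₂ ×ˢ Set.univ) ∧ ∀ (s : Set E) (ψ : E → E),
        IsLocalIsometry G₁ G₂ U₁ U₂ s ψ → ∀ y ∈ s,
          fderiv ℝ (fderiv ℝ ψ) y = F (y, ψ y, fderiv ℝ ψ y) := by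
  let b := Module.finBasis ℝ E
  let c : Fin (Module.finrank ℝ E) → E →L[ℝ] ℝ := fun i => (b.coord i).toContinuousLinearMap
  refine ⟨fun p => ∑ i, (c i).smulRight (∑ j, (c j).smulRight
    (isometrySndDeriv G₁ G₂ (b i) (b j) p)), ?_, fun s ψ h y hy => ?_⟩
  · exact ContDiffOn.sum fun i _ => contDiffOn_const.smulRight (ContDiffOn.sum fun j _ =>
      contDiffOn_const.smulRight (contDiffOn_isometrySndDeriv h₁ h₂ _ _))
  · simp only [← h.fderiv_fderiv h₁ h₂ hy]
    have hc : ∀ v, ∑ i, c i v • b i = v := fun v => b.sum_repr v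
    ext u v
    conv_lhs => rw [← hc u, ← hc v]
    simp only [map_sum, map_smul, sum_apply, smul_apply,
      ContinuousLinearMap.smulRight_apply, Finset.smul_sum]
    rw [Finset.sum_comm]
    exact Finset.sum_congr rfl fun i _ => Finset.sum_congr rfl fun j _ => smul_comm _ _ _

end LocalIsometry

/-! ### Uniform bounds for isometries -/

section IsometryBounds

set_option maxSynthPendingDepth 3

variable {E : Type*} [NormedAddCommGroup E] [NormedSpace ℝ E]
  {G₁ G₂ : E → E →L[ℝ] E →L[ℝ] ℝ} {U₁ U₂ : Set E}

theorem ContDiffOn.exists_norm_iteratedFDerivWithin_le {V W : Type*} [NormedAddCommGroup V]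
    [NormedSpace ℝ V] [NormedAddCommGroup W] [NormedSpace ℝ W] {f : V → W} {U K : Set V}
    (hf : ContDiffOn ℝ ∞ f U) (hU : IsOpen U) (hK : IsCompact K) (hKU : K ⊆ U) (k : ℕ) :
    ∃ C : ℝ, ∀ i ≤ k, ∀ y ∈ K, ‖iteratedFDerivWithin ℝ i f U y‖ ≤ C := by
  induction k with
  | zero =>
    obtain ⟨C, hC⟩ := hK.exists_bound_of_continuousOn
      ((hf.continuousOn_iteratedFDerivWithin (m := 0) (by simp) hU.uniqueDiffOn).mono hKU)
    exact ⟨C, fun i hi y hy => by obtain rfl := Nat.le_zero.1 hi; exact hC y hy⟩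
  | succ k ih =>
    obtain ⟨C, hC⟩ := ih
    obtain ⟨C', hC'⟩ := hK.exists_bound_of_continuousOn
      ((hf.continuousOn_iteratedFDerivWithin (m := k + 1)
        (by exact_mod_cast le_top) hU.uniqueDiffOn).mono hKU)
    refine ⟨max C C', fun i hi y hy => ?_⟩
    rcases Nat.le_succ_iff.1 hi with h | rfl
    · exact (hC i h y hy).trans (le_max_left _ _)
    · exact (hC' y hy).trans (le_max_right _ _)

theorem norm_iteratedFDeriv_id_le {V : Type*} [NormedAddCommGroup V] [NormedSpace ℝ V] {i : ℕ}
    (hi : 1 ≤ i) (y : V) : ‖iteratedFDeriv ℝ i (fun z : V => z) y‖ ≤ 1 := by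
  obtain ⟨j, rfl⟩ := Nat.exists_eq_add_of_le' hi
  rw [← norm_iteratedFDeriv_fderiv, show fderiv ℝ (fun z : V => z) =
    fun _ => ContinuousLinearMap.id ℝ V from funext fun z => fderiv_fun_id]
  rcases Nat.eq_zero_or_pos j with rfl | hj
  · simpa using ContinuousLinearMap.norm_id_le
  · rw [iteratedFDeriv_const_of_ne hj.ne']
    simp

variable [FiniteDimensional ℝ E]

/-- A smooth metric is bounded from below on compact sets. -/
theorem IsLocalMetric.exists_le {G : E → E →L[ℝ] E →L[ℝ] ℝ} {U : Set E}
    (hG : IsLocalMetric G U) {K : Set E} (hK : IsCompact K) (hKU : K ⊆ U) :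
    ∃ m : ℝ, 0 < m ∧ ∀ y ∈ K, ∀ v, m * ‖v‖ ^ 2 ≤ G y v v := by
  rcases (K ×ˢ Metric.sphere (0 : E) 1).eq_empty_or_nonempty with h | h
  · refine ⟨1, one_pos, fun y hy v => ?_⟩
    by_cases hv : v = 0
    · simp [hv]
    · have : (y, ‖v‖⁻¹ • v) ∈ K ×ˢ Metric.sphere (0 : E) 1 :=
        ⟨hy, by simp [norm_smul, hv]⟩
      simp [h] at this
  · have hc : ContinuousOn (fun p : E × E => G p.1 p.2 p.2) (K ×ˢ Metric.sphere (0 : E) 1) :=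
      (((hG.contDiffOn.continuousOn.mono hKU).comp continuousOn_fst fun p hp => hp.1).clm_apply
        continuousOn_snd).clm_apply continuousOn_snd
    obtain ⟨p, hp, hmin⟩ := (hK.prod (isCompact_sphere (0 : E) 1)).exists_isMinOn h hc
    refine ⟨G p.1 p.2 p.2, hG.pos _ (hKU hp.1) _ fun h0 => ?_, fun y hy v => ?_⟩
    · have := hp.2
      simp [h0] at this
    · by_cases hv : v = 0
      · simp [hv]
      · have h1 : G p.1 p.2 p.2 ≤ G y (‖v‖⁻¹ • v) (‖v‖⁻¹ • v) :=
          hmin (a := (y, ‖v‖⁻¹ • v)) ⟨hy, by simp [norm_smul, hv]⟩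
        have hv' : 0 < ‖v‖ := norm_pos_iff.2 hv
        calc _ ≤ G y (‖v‖⁻¹ • v) (‖v‖⁻¹ • v) * ‖v‖ ^ 2 := by gcongr
          _ = _ := by
            simp only [map_smul, smul_apply, smul_eq_mul]
            field_simp

/-- The derivative of an isometry is bounded in terms of the metrics. -/
theorem exists_norm_fderiv_isometry_le (h₁ : IsLocalMetric G₁ U₁) (h₂ : IsLocalMetric G₂ U₂)
    {K₁ K₂ : Set E} (hK₁ : IsCompact K₁) (hK₂ : IsCompact K₂) (hKU₁ : K₁ ⊆ U₁) (hKU₂ : K₂ ⊆ U₂) :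
    ∃ M : ℝ, ∀ (s : Set E) (ψ : E → E), IsLocalIsometry G₁ G₂ U₁ U₂ s ψ →
      ∀ y ∈ s, y ∈ K₁ → ψ y ∈ K₂ → ‖fderiv ℝ ψ y‖ ≤ M := by
  obtain ⟨m, hm, hlow⟩ := h₂.exists_le hK₂ hKU₂
  obtain ⟨C, hC⟩ := hK₁.exists_bound_of_continuousOn (h₁.contDiffOn.continuousOn.mono hKU₁)
  refine ⟨√(C / m), fun s ψ h y hys hy hψ => ?_⟩
  refine ContinuousLinearMap.opNorm_le_bound _ (Real.sqrt_nonneg _) fun v => ?_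
  have hC0 : 0 ≤ C := (norm_nonneg _).trans (hC y hy)
  have h3 : m * ‖fderiv ℝ ψ y v‖ ^ 2 ≤ C * ‖v‖ ^ 2 :=
    calc _ ≤ G₂ (ψ y) (fderiv ℝ ψ y v) (fderiv ℝ ψ y v) := hlow _ hψ _
      _ = G₁ y v v := h.isometry y hys v v
      _ ≤ ‖G₁ y v v‖ := Real.le_norm_self _
      _ ≤ ‖G₁ y‖ * ‖v‖ * ‖v‖ := (G₁ y).le_opNorm₂ v v
      _ ≤ C * ‖v‖ * ‖v‖ := by gcongr; exact hC y hy
      _ = _ := by ring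
  refine abs_le_of_sq_le_sq' ?_ (by positivity) |>.2
  rw [mul_pow, Real.sq_sqrt (by positivity), div_mul_eq_mul_div, le_div_iff₀ hm]
  linarith

/-- All derivatives of isometries are bounded in terms of the metrics: the equation
`D²ψ = F(y, ψ, Dψ)` bounds the derivative of order `k + 2` by those of lower order. -/
theorem exists_norm_iteratedFDeriv_isometry_le (h₁ : IsLocalMetric G₁ U₁)
    (h₂ : IsLocalMetric G₂ U₂) {K₁ K₂ : Set E} (hK₁ : IsCompact K₁) (hK₂ : IsCompact K₂)
    (hKU₁ : K₁ ⊆ U₁) (hKU₂ : K₂ ⊆ U₂) (k : ℕ) :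
    ∃ M : ℝ, 1 ≤ M ∧ ∀ (s : Set E) (ψ : E → E), IsLocalIsometry G₁ G₂ U₁ U₂ s ψ →
      ∀ y ∈ s, y ∈ K₁ → ψ y ∈ K₂ → ∀ i ≤ k, ‖iteratedFDeriv ℝ (i + 1) ψ y‖ ≤ M := by
  induction k with
  | zero =>
    obtain ⟨M, hM⟩ := exists_norm_fderiv_isometry_le h₁ h₂ hK₁ hK₂ hKU₁ hKU₂
    refine ⟨max 1 M, le_max_left _ _, fun s ψ h y hys hy hψ i hi => ?_⟩
    obtain rfl := Nat.le_zero.1 hi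
    rw [norm_iteratedFDeriv_one]
    exact (hM s ψ h y hys hy hψ).trans (le_max_right _ _)
  | succ k ih =>
    obtain ⟨M, hM1, hM⟩ := ih
    obtain ⟨F, hF, hFψ⟩ := exists_isometry_equation h₁ h₂
    have hUo : IsOpen (U₁ ×ˢ U₂ ×ˢ (Set.univ : Set (E →L[ℝ] E))) :=
      h₁.isOpen.prod (h₂.isOpen.prod isOpen_univ)
    obtain ⟨C, hC⟩ := hF.exists_norm_iteratedFDerivWithin_le hUo
      (hK₁.prod (hK₂.prod (isCompact_closedBall (0 : E →L[ℝ] E) M)))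
      (Set.prod_mono hKU₁ (Set.prod_mono hKU₂ (Set.subset_univ _))) k
    refine ⟨max M (k.factorial * C * M ^ k), hM1.trans (le_max_left _ _),
      fun s ψ h y hys hy hψ i hi => ?_⟩
    rcases Nat.le_succ_iff.1 hi with hi' | rfl
    · exact (hM s ψ h y hys hy hψ i hi').trans (le_max_left _ _)
    refine le_trans ?_ (le_max_right _ _)
    have hd : ContDiffOn ℝ ∞ (fderiv ℝ ψ) s := h.contDiffOn.fderiv_of_isOpen h.isOpen (by simp)
    rw [← norm_iteratedFDeriv_fderiv, ← norm_iteratedFDeriv_fderiv,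
      ← iteratedFDerivWithin_of_isOpen k h.isOpen hys,
      iteratedFDerivWithin_congr (hFψ s ψ h) hys]
    refine norm_iteratedFDerivWithin_comp_le (N := ∞) (t := U₁ ×ˢ U₂ ×ˢ Set.univ)
      (f := fun z => (z, ψ z, fderiv ℝ ψ z)) hF (contDiffOn_id.prodMk (h.contDiffOn.prodMk hd))
      (by exact_mod_cast le_top) hUo.uniqueDiffOn h.isOpen.uniqueDiffOn
      (fun z hz => ⟨h.subset hz, h.mapsTo hz, trivial⟩) hys (fun j hj => hC j hj _
        ⟨hy, hψ, ?_⟩) fun j hj hjk => ?_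
    · rw [mem_closedBall_zero_iff, ← norm_iteratedFDeriv_one]
      exact hM s ψ h y hys hy hψ 0 (Nat.zero_le k)
    · have hψd := h.contDiffAt hys
      have hd' := hd.contDiffAt (h.isOpen.mem_nhds hys)
      rw [iteratedFDerivWithin_of_isOpen j h.isOpen hys,
        iteratedFDeriv_prodMk (n := ∞) contDiffAt_fun_id (hψd.prodMk hd')
          (by exact_mod_cast le_top), ContinuousMultilinearMap.opNorm_prod,
        iteratedFDeriv_prodMk (n := ∞) hψd hd' (by exact_mod_cast le_top),
        ContinuousMultilinearMap.opNorm_prod]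
      obtain ⟨l, rfl⟩ := Nat.exists_eq_add_of_le' hj
      refine le_trans ?_ (le_self_pow₀ hM1 (by omega))
      refine max_le ((norm_iteratedFDeriv_id_le hj y).trans hM1) (max_le ?_ ?_)
      · exact hM s ψ h y hys hy hψ l (by omega)
      · rw [norm_iteratedFDeriv_fderiv]
        exact hM s ψ h y hys hy hψ (l + 1) hjk

/-- The derivatives of the composition with an isometry are bounded by those of the function, with
a constant depending only on the metrics. -/
theorem exists_norm_iteratedFDeriv_comp_isometry_le (h₁ : IsLocalMetric G₁ U₁)
    (h₂ : IsLocalMetric G₂ U₂) {K₁ K₂ : Set E} (hK₁ : IsCompact K₁) (hK₂ : IsCompact K₂)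
    (hKU₁ : K₁ ⊆ U₁) (hKU₂ : K₂ ⊆ U₂) (k : ℕ) :
    ∃ M : ℝ, 0 ≤ M ∧ ∀ (s : Set E) (ψ : E → E), IsLocalIsometry G₁ G₂ U₁ U₂ s ψ →
      ∀ f : E → ℂ, ContDiffOn ℝ ∞ f U₂ → ∀ C : ℝ, ∀ y ∈ s, y ∈ K₁ → ψ y ∈ K₂ →
        (∀ i ≤ k, ‖iteratedFDeriv ℝ i f (ψ y)‖ ≤ C) →
          ‖iteratedFDeriv ℝ k (f ∘ ψ) y‖ ≤ M * C := by
  obtain ⟨M, hM1, hM⟩ := exists_norm_iteratedFDeriv_isometry_le h₁ h₂ hK₁ hK₂ hKU₁ hKU₂ k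
  refine ⟨k.factorial * M ^ k, by positivity, fun s ψ h f hf C y hys hy hψ hC => ?_⟩
  rw [mul_right_comm, ← iteratedFDerivWithin_of_isOpen k h.isOpen hys]
  refine norm_iteratedFDerivWithin_comp_le (N := ∞) hf h.contDiffOn (by exact_mod_cast le_top)
    h₂.isOpen.uniqueDiffOn h.isOpen.uniqueDiffOn h.mapsTo hys (fun i hi => ?_) fun i hi hik => ?_
  · rw [iteratedFDerivWithin_of_isOpen i h₂.isOpen (hKU₂ hψ)]
    exact hC i hi
  · rw [iteratedFDerivWithin_of_isOpen i h.isOpen hys]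
    obtain ⟨l, rfl⟩ := Nat.exists_eq_add_of_le' hi
    exact (hM s ψ h y hys hy hψ l (by omega)).trans (le_self_pow₀ hM1 (by omega))

end IsometryBounds

/-! ### Isometries of manifolds in charts -/

section ChartCover

/-- A compact manifold is covered by finitely many compact subsets of charts. -/
theorem exists_compact_chart_cover {E T : Type*} [NormedAddCommGroup E] [NormedSpace ℝ E]
    [FiniteDimensional ℝ E] [TopologicalSpace T] [ChartedSpace E T] [CompactSpace T] :
    ∃ (J : Finset T) (L : T → Set E),
      (∀ θ, IsCompact (L θ) ∧ L θ ⊆ (extChartAt 𝓘(ℝ, E) θ).target) ∧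
      ∀ x : T, ∃ θ ∈ J, x ∈ (extChartAt 𝓘(ℝ, E) θ).source ∧ extChartAt 𝓘(ℝ, E) θ x ∈ L θ := by
  have h1 : ∀ θ : T, ∃ r : ℝ, 0 < r ∧ Metric.closedBall (extChartAt 𝓘(ℝ, E) θ θ) r ⊆
      (extChartAt 𝓘(ℝ, E) θ).target := fun θ =>
    Metric.nhds_basis_closedBall.mem_iff.1 (extChartAt_target_mem_nhds θ)
  choose r hr hball using h1
  have h2 : ∀ θ : T, (extChartAt 𝓘(ℝ, E) θ).source ∩ extChartAt 𝓘(ℝ, E) θ ⁻¹'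
      Metric.closedBall (extChartAt 𝓘(ℝ, E) θ θ) (r θ) ∈ nhds θ := fun θ =>
    Filter.inter_mem (extChartAt_source_mem_nhds θ)
      ((continuousAt_extChartAt θ).preimage_mem_nhds (Metric.closedBall_mem_nhds _ (hr θ)))
  obtain ⟨J, -, hJ⟩ := isCompact_univ.elim_nhds_subcover _ fun θ _ => h2 θ
  refine ⟨J, fun θ => Metric.closedBall (extChartAt 𝓘(ℝ, E) θ θ) (r θ),
    fun θ => ⟨isCompact_closedBall _ _, hball θ⟩, fun x => ?_⟩
  obtain ⟨θ, hθ, hx⟩ := Set.mem_iUnion₂.1 (hJ (Set.mem_univ x))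
  exact ⟨θ, hθ, hx⟩

end ChartCover

section ChartMetric

variable {E T : Type*} [NormedAddCommGroup E] [NormedSpace ℝ E] [TopologicalSpace T]
  [ChartedSpace E T] [IsManifold 𝓘(ℝ, E) ∞ T]

/-- The inner product at the point `x`, on the model space. -/
noncomputable def metricAt (g : Bundle.ContMDiffRiemannianMetric 𝓘(ℝ, E) ∞ E
    (fun θ : T => TangentSpace 𝓘(ℝ, E) θ)) (x : T) : E →L[ℝ] E →L[ℝ] ℝ :=
  g.inner x

/-- The derivative of the inverse of the chart at `θ₀`. -/
noncomputable def chartSymmDeriv (θ₀ : T) (y : E) : E →L[ℝ] E :=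
  mfderiv 𝓘(ℝ, E) 𝓘(ℝ, E) (extChartAt 𝓘(ℝ, E) θ₀).symm y

variable (g : Bundle.ContMDiffRiemannianMetric 𝓘(ℝ, E) ∞ E
    (fun θ : T => TangentSpace 𝓘(ℝ, E) θ))

theorem metricAt_symm (x : T) (v w : E) : metricAt g x v w = metricAt g x w v := g.symm x v w

theorem metricAt_pos (x : T) {v : E} (hv : v ≠ 0) : 0 < metricAt g x v v := g.pos x v hv

/-- The expression of a Riemannian metric in the chart at `θ₀`. -/
noncomputable def chartMetric (θ₀ : T) (y : E) : E →L[ℝ] E →L[ℝ] ℝ :=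
  (metricAt g ((extChartAt 𝓘(ℝ, E) θ₀).symm y)).bilinearComp (chartSymmDeriv θ₀ y)
    (chartSymmDeriv θ₀ y)

theorem chartMetric_apply (θ₀ : T) (y v w : E) : chartMetric g θ₀ y v w =
    metricAt g ((extChartAt 𝓘(ℝ, E) θ₀).symm y) (chartSymmDeriv θ₀ y v) (chartSymmDeriv θ₀ y w) :=
  rfl

theorem contDiffOn_chartMetric_apply (θ₀ : T) (v w : E) :
    ContDiffOn ℝ ∞ (fun y => chartMetric g θ₀ y v w) (extChartAt 𝓘(ℝ, E) θ₀).target := by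
  have hopen : IsOpen (extChartAt 𝓘(ℝ, E) θ₀).target := isOpen_extChartAt_target θ₀
  have hsymm : ContMDiffOn 𝓘(ℝ, E) 𝓘(ℝ, E) ∞ (extChartAt 𝓘(ℝ, E) θ₀).symm
      (extChartAt 𝓘(ℝ, E) θ₀).target := contMDiffOn_extChartAt_symm θ₀
  have hvec : ∀ v : E, ContMDiffOn 𝓘(ℝ, E) 𝓘(ℝ, E).tangent ∞
      (fun y => (⟨(extChartAt 𝓘(ℝ, E) θ₀).symm y, chartSymmDeriv θ₀ y v⟩ :
        TangentBundle 𝓘(ℝ, E) T)) (extChartAt 𝓘(ℝ, E) θ₀).target := by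
    intro v
    have h1 : ContMDiffOn 𝓘(ℝ, E) 𝓘(ℝ, E).tangent ∞
        (fun y => (⟨y, v⟩ : TangentBundle 𝓘(ℝ, E) E)) (extChartAt 𝓘(ℝ, E) θ₀).target :=
      contMDiffOn_vectorSpace_iff_contDiffOn.2 contDiffOn_const
    refine ((hsymm.contMDiffOn_tangentMapWithin (m := ∞) (by simp) hopen.uniqueMDiffOn).comp h1
      fun y hy => hy).congr fun y hy => ?_
    simp only [Function.comp, tangentMapWithin, chartSymmDeriv]
    rw [mfderivWithin_of_isOpen hopen hy]
    rfl
  rw [← contMDiffOn_iff_contDiffOn]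
  intro y hy
  have : ContMDiffWithinAt 𝓘(ℝ, E) (𝓘(ℝ, E).prod 𝓘(ℝ)) ∞
      (fun y => Bundle.TotalSpace.mk' ℝ (E := Bundle.Trivial T ℝ) ((extChartAt 𝓘(ℝ, E) θ₀).symm y)
        (g.inner ((extChartAt 𝓘(ℝ, E) θ₀).symm y) (chartSymmDeriv θ₀ y v)
          (chartSymmDeriv θ₀ y w))) (extChartAt 𝓘(ℝ, E) θ₀).target y := by
    apply ContMDiffWithinAt.clm_bundle_apply₂ (F₁ := E) (F₂ := E)
    · exact ContMDiffAt.comp_contMDiffWithinAt y g.contMDiff.contMDiffAt (hsymm y hy)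
    · exact hvec v y hy
    · exact hvec w y hy
  simp only [Bundle.contMDiffWithinAt_totalSpace] at this
  exact this.2

theorem chartSymmDeriv_injective {θ₀ : T} {y : E}
    (hy : y ∈ (extChartAt 𝓘(ℝ, E) θ₀).target) : Function.Injective (chartSymmDeriv θ₀ y) := by
  have h := isInvertible_mfderivWithin_extChartAt_symm (I := 𝓘(ℝ, E)) hy
  rw [modelWithCornersSelf_coe, Set.range_id, mfderivWithin_univ] at h
  exact h.injective

theorem isLocalMetric_chartMetric [FiniteDimensional ℝ E] (θ₀ : T) :
    IsLocalMetric (chartMetric g θ₀) (extChartAt 𝓘(ℝ, E) θ₀).target where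
  isOpen := isOpen_extChartAt_target θ₀
  contDiffOn := by
    rw [contDiffOn_clm_apply]
    intro v
    rw [contDiffOn_clm_apply]
    exact contDiffOn_chartMetric_apply g θ₀ v
  symm y hy v w := by
    rw [chartMetric_apply, chartMetric_apply, metricAt_symm]
  pos y hy v hv := by
    rw [chartMetric_apply]
    exact metricAt_pos g _ fun h0 =>
      hv (chartSymmDeriv_injective hy (h0.trans (map_zero (chartSymmDeriv θ₀ y)).symm))

/-- The expression of a self-map of `T` in the charts at `θ₀` and `θ₁`. -/
noncomputable def chartMap (φ : T → T) (θ₀ θ₁ : T) (y : E) : E :=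
  extChartAt 𝓘(ℝ, E) θ₁ (φ ((extChartAt 𝓘(ℝ, E) θ₀).symm y))

/-- The domain of the expression of a self-map of `T` in the charts at `θ₀` and `θ₁`. -/
def chartMapDomain (φ : T → T) (θ₀ θ₁ : T) : Set E :=
  (extChartAt 𝓘(ℝ, E) θ₀).target ∩
    (extChartAt 𝓘(ℝ, E) θ₀).symm ⁻¹' (φ ⁻¹' (extChartAt 𝓘(ℝ, E) θ₁).source)

theorem isLocalIsometry_chartMap {φ : T → T} (hφ : ContMDiff 𝓘(ℝ, E) 𝓘(ℝ, E) ∞ φ)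
    (hiso : ∀ (θ : T) (v w : E), metricAt g (φ θ)
      (mfderiv 𝓘(ℝ, E) 𝓘(ℝ, E) φ θ v) (mfderiv 𝓘(ℝ, E) 𝓘(ℝ, E) φ θ w) = metricAt g θ v w)
    (θ₀ θ₁ : T) :
    IsLocalIsometry (chartMetric g θ₀) (chartMetric g θ₁) (extChartAt 𝓘(ℝ, E) θ₀).target
      (extChartAt 𝓘(ℝ, E) θ₁).target (chartMapDomain φ θ₀ θ₁) (chartMap φ θ₀ θ₁) := by
  have hopen : IsOpen (chartMapDomain (E := E) φ θ₀ θ₁) :=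
    (continuousOn_extChartAt_symm θ₀).isOpen_inter_preimage (isOpen_extChartAt_target θ₀)
      ((isOpen_extChartAt_source θ₁).preimage hφ.continuous)
  have hsymm : ∀ θ : T, ContMDiffOn 𝓘(ℝ, E) 𝓘(ℝ, E) ∞ (extChartAt 𝓘(ℝ, E) θ).symm
      (extChartAt 𝓘(ℝ, E) θ).target := fun θ => contMDiffOn_extChartAt_symm θ
  have hψ : ContMDiffOn 𝓘(ℝ, E) 𝓘(ℝ, E) ∞ (chartMap φ θ₀ θ₁)
      (chartMapDomain (E := E) φ θ₀ θ₁) := by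
    refine (contMDiffOn_extChartAt (I := 𝓘(ℝ, E)) (x := θ₁)).comp
      (hφ.comp_contMDiffOn ((hsymm θ₀).mono fun y hy => hy.1)) fun y hy => ?_
    rw [← extChartAt_source 𝓘(ℝ, E)]
    exact hy.2
  have hmaps : Set.MapsTo (chartMap φ θ₀ θ₁) (chartMapDomain (E := E) φ θ₀ θ₁)
      (extChartAt 𝓘(ℝ, E) θ₁).target := fun y hy => (extChartAt 𝓘(ℝ, E) θ₁).map_source hy.2
  refine ⟨hopen, contMDiffOn_iff_contDiffOn.1 hψ, fun y hy => hy.1, hmaps, fun y hy v w => ?_⟩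
  have hpt : ∀ z ∈ chartMapDomain (E := E) φ θ₀ θ₁,
      (extChartAt 𝓘(ℝ, E) θ₁).symm (chartMap φ θ₀ θ₁ z) = φ ((extChartAt 𝓘(ℝ, E) θ₀).symm z) :=
    fun z hz => (extChartAt 𝓘(ℝ, E) θ₁).left_inv hz.2
  have hd : ∀ {θ : T} {z : E}, z ∈ (extChartAt 𝓘(ℝ, E) θ).target →
      MDifferentiableAt 𝓘(ℝ, E) 𝓘(ℝ, E) (extChartAt 𝓘(ℝ, E) θ).symm z := fun {θ z} hz =>
    ((hsymm θ).contMDiffAt ((isOpen_extChartAt_target θ).mem_nhds hz)).mdifferentiableAt (by simp)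
  have hder : ∀ u : E, chartSymmDeriv θ₁ (chartMap φ θ₀ θ₁ y) (fderiv ℝ (chartMap φ θ₀ θ₁) y u) =
      mfderiv 𝓘(ℝ, E) 𝓘(ℝ, E) φ ((extChartAt 𝓘(ℝ, E) θ₀).symm y) (chartSymmDeriv θ₀ y u) := by
    intro u
    have h1 := mfderiv_comp y (hd (hmaps hy))
      ((hψ.contMDiffAt (hopen.mem_nhds hy)).mdifferentiableAt (by simp))
    have h2 := mfderiv_comp y (hφ.contMDiffAt.mdifferentiableAt (by simp)) (hd hy.1)
    have h3 : ((extChartAt 𝓘(ℝ, E) θ₁).symm ∘ chartMap φ θ₀ θ₁) =ᶠ[nhds y]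
        (φ ∘ (extChartAt 𝓘(ℝ, E) θ₀).symm) := by
      filter_upwards [hopen.mem_nhds hy] with z hz using hpt z hz
    have h4 := h3.mfderiv_eq (I := 𝓘(ℝ, E)) (I' := 𝓘(ℝ, E))
    rw [h1, h2, mfderiv_eq_fderiv] at h4
    exact DFunLike.congr_fun h4 u
  rw [chartMetric_apply, chartMetric_apply, hder, hder, hpt y hy, hiso]

/-- Composition with isometries does not increase derivatives by more than a constant factor which
does not depend on the isometry. -/
theorem exists_norm_iteratedFDeriv_comp_chart_le [FiniteDimensional ℝ E] {J : Finset T}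
    {L : T → Set E} (hL : ∀ θ, IsCompact (L θ) ∧ L θ ⊆ (extChartAt 𝓘(ℝ, E) θ).target)
    (hJ : ∀ x : T, ∃ θ ∈ J, x ∈ (extChartAt 𝓘(ℝ, E) θ).source ∧ extChartAt 𝓘(ℝ, E) θ x ∈ L θ)
    {θ₀ : T} {K : Set E} (hK : IsCompact K) (hKt : K ⊆ (extChartAt 𝓘(ℝ, E) θ₀).target) (k : ℕ) :
    ∃ M : ℝ, 0 ≤ M ∧ ∀ φ : T → T, ContMDiff 𝓘(ℝ, E) 𝓘(ℝ, E) ∞ φ →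
      (∀ (θ : T) (v w : E), metricAt g (φ θ) (mfderiv 𝓘(ℝ, E) 𝓘(ℝ, E) φ θ v)
        (mfderiv 𝓘(ℝ, E) 𝓘(ℝ, E) φ θ w) = metricAt g θ v w) →
      ∀ (f : T → ℂ), ContMDiff 𝓘(ℝ, E) 𝓘(ℝ, ℂ) ∞ f → ∀ C : ℝ,
        (∀ θ ∈ J, ∀ i ≤ k, ∀ w ∈ L θ,
          ‖iteratedFDeriv ℝ i (fun z => f ((extChartAt 𝓘(ℝ, E) θ).symm z)) w‖ ≤ C) →
        ∀ y ∈ K, ‖iteratedFDeriv ℝ k (fun z => f (φ ((extChartAt 𝓘(ℝ, E) θ₀).symm z))) y‖ ≤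
          M * C := by
  have h := fun θ : T => exists_norm_iteratedFDeriv_comp_isometry_le
    (isLocalMetric_chartMetric g θ₀) (isLocalMetric_chartMetric g θ) hK (hL θ).1 hKt (hL θ).2 k
  choose M hM0 hM using h
  refine ⟨∑ θ ∈ J, M θ, Finset.sum_nonneg fun θ _ => hM0 θ, fun φ hφ hiso f hf C hC y hy => ?_⟩
  obtain ⟨θ, hθ, hs, hθL⟩ := hJ (φ ((extChartAt 𝓘(ℝ, E) θ₀).symm y))
  have hloc := isLocalIsometry_chartMap g hφ hiso θ₀ θ
  have hys : y ∈ chartMapDomain (E := E) φ θ₀ θ := ⟨hKt hy, hs⟩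
  have hC0 : 0 ≤ C := (norm_nonneg _).trans (hC θ hθ 0 (Nat.zero_le k) _ hθL)
  have heq : (fun z => f (φ ((extChartAt 𝓘(ℝ, E) θ₀).symm z))) =ᶠ[nhds y]
      (fun z => f ((extChartAt 𝓘(ℝ, E) θ).symm z)) ∘ chartMap φ θ₀ θ := by
    filter_upwards [hloc.isOpen.mem_nhds hys] with z hz
    exact congrArg f ((extChartAt 𝓘(ℝ, E) θ).left_inv hz.2).symm
  rw [(heq.iteratedFDeriv ℝ k).eq_of_nhds]
  refine (hM θ _ _ hloc _ (contMDiffOn_iff_contDiffOn.1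
    (hf.comp_contMDiffOn (contMDiffOn_extChartAt_symm θ))) C y hys hy hθL
    fun i hi => hC θ hθ i hi _ hθL).trans ?_
  gcongr
  exact Finset.single_le_sum (f := M) (fun θ _ => hM0 θ) hθ

end ChartMetric

/-! ### Decay of coefficients and smoothness in the phase -/

section Phase

variable {I E : Type*} [NormedAddCommGroup E] [NormedSpace ℝ E] {Ω : Set E}

theorem hasDerivAt_phase (r s : ℝ) :
    HasDerivAt (fun s : ℝ => Complex.exp ((s * r : ℝ) * Complex.I))
      (Complex.I * r * Complex.exp ((s * r : ℝ) * Complex.I)) s := by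
  have h : HasDerivAt (fun s : ℝ => ((s * r : ℝ) : ℂ) * Complex.I) ((1 * r : ℝ) * Complex.I) s :=
    (((hasDerivAt_id s).mul_const r).ofReal_comp).mul_const _
  convert h.cexp using 1
  push_cast
  ring

/-- If the coefficients `e^{i s r} τ(y)` come from a smooth function with values in a normed space,
then differentiation in `s` shows that the `τ` and their derivatives decrease rapidly with respect
to `r`. -/
theorem exists_rapid_decay {𝓛 : Type*} [NormedAddCommGroup 𝓛] [NormedSpace ℝ 𝓛]
    {ev : I → 𝓛 →L[ℝ] ℂ} (hev : ∀ i, ‖ev i‖ ≤ 1) (r : I → ℝ) (hΩ : IsOpen Ω) {K : Set E}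
    (hK : IsCompact K) (hKΩ : K ⊆ Ω) (k N : ℕ) {F : ℝ × E → 𝓛} {τ : I → E → ℂ}
    (hF : ContDiffOn ℝ ∞ F (Set.univ ×ˢ Ω))
    (h : ∀ i s, ∀ y ∈ Ω, ev i (F (s, y)) = Complex.exp ((s * r i : ℝ) * Complex.I) * τ i y) :
    ∃ C : ℝ, ∀ i, ∀ y ∈ K, |r i| ^ N * ‖iteratedFDeriv ℝ k (τ i) y‖ ≤ C := by
  have hG : ∀ {F : ℝ × E → 𝓛}, ContDiffOn ℝ ∞ F (Set.univ ×ˢ Ω) →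
      ContDiffOn ℝ ∞ (fun y => F (0, y)) Ω := fun {F} hF =>
    hF.comp (contDiff_prodMk_right (0 : ℝ)).contDiffOn fun y hy => ⟨trivial, hy⟩
  have hτ : ∀ {F : ℝ × E → 𝓛} {τ : I → E → ℂ}, (∀ i s, ∀ y ∈ Ω, ev i (F (s, y)) =
      Complex.exp ((s * r i : ℝ) * Complex.I) * τ i y) → ∀ i, ∀ y ∈ Ω,
      τ i y = ev i (F (0, y)) := fun {F τ} h i y hy => by simp [h i 0 y hy]
  induction N generalizing F τ with
  | zero =>
    obtain ⟨C, hC⟩ := (hG hF).exists_norm_iteratedFDerivWithin_le hΩ hK hKΩ k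
    refine ⟨C, fun i y hy => ?_⟩
    have heq : τ i =ᶠ[nhds y] ev i ∘ fun y => F (0, y) := by
      filter_upwards [hΩ.mem_nhds (hKΩ hy)] with z hz using hτ h i z hz
    rw [pow_zero, one_mul, (heq.iteratedFDeriv ℝ k).eq_of_nhds]
    refine ((ev i).norm_iteratedFDeriv_comp_left (N := ∞)
      ((hG hF).contDiffAt (hΩ.mem_nhds (hKΩ hy))) (by exact_mod_cast le_top)).trans ?_
    refine (mul_le_of_le_one_left (norm_nonneg _) (hev i)).trans ?_
    rw [← iteratedFDerivWithin_of_isOpen k hΩ (hKΩ hy)]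
    exact hC k le_rfl y hy
  | succ N ih =>
    have hU : IsOpen ((Set.univ : Set ℝ) ×ˢ Ω) := isOpen_univ.prod hΩ
    obtain ⟨C, hC⟩ := ih (F := fun p => fderiv ℝ F p (1, 0))
      (τ := fun i y => (Complex.I * r i) • τ i y)
      ((hF.fderiv_of_isOpen hU (by simp)).clm_apply contDiffOn_const) (fun i s y hy => by
        have h1 : HasFDerivAt F (fderiv ℝ F (s, y)) (s, y) :=
          ((hF.contDiffAt (hU.mem_nhds ⟨trivial, hy⟩)).differentiableAt (by simp)).hasFDerivAt
        have h2 : HasDerivAt (fun s' : ℝ => (s', y)) ((1 : ℝ), (0 : E)) s :=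
          (hasDerivAt_id s).prodMk (hasDerivAt_const s y)
        have h3 := (ev i).hasFDerivAt.comp_hasDerivAt s (h1.comp_hasDerivAt s h2)
        have h4 := (hasDerivAt_phase (r i) s).mul_const (τ i y)
        have h5 : (ev i ∘ F ∘ fun s' => (s', y)) =
            fun s' => Complex.exp ((s' * r i : ℝ) * Complex.I) * τ i y :=
          funext fun s' => h i s' y hy
        rw [h5] at h3
        rw [h3.unique h4, smul_eq_mul]
        ring)
    refine ⟨C, fun i y hy => le_trans (le_of_eq ?_) (hC i y hy)⟩
    have hτs : ContDiffAt ℝ k (τ i) y :=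
      (((ev i).contDiff.comp_contDiffOn (hG hF)).congr
        (hτ h i)).contDiffAt (hΩ.mem_nhds (hKΩ hy)) |>.of_le (by exact_mod_cast le_top)
    rw [iteratedFDeriv_const_smul_apply' hτs, norm_smul, norm_mul, Complex.norm_I, one_mul,
      Complex.norm_real, Real.norm_eq_abs, pow_succ, mul_assoc]

theorem norm_iteratedFDeriv_phase (r s : ℝ) (j : ℕ) :
    ‖iteratedFDeriv ℝ j (fun s : ℝ => Complex.exp ((s * r : ℝ) * Complex.I)) s‖ = |r| ^ j := by
  have h : iteratedDeriv j (fun s : ℝ => Complex.exp ((s * r : ℝ) * Complex.I)) =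
      fun s => (Complex.I * r) ^ j * Complex.exp ((s * r : ℝ) * Complex.I) := by
    induction j with
    | zero => simp
    | succ j ih =>
      rw [iteratedDeriv_succ, ih]
      ext s
      rw [((hasDerivAt_phase r s).const_mul _).deriv]
      ring
  rw [norm_iteratedFDeriv_eq_norm_iteratedDeriv, h, norm_mul, Complex.norm_exp_ofReal_mul_I,
    mul_one, norm_pow, norm_mul, Complex.norm_I, one_mul, Complex.norm_real, Real.norm_eq_abs]

theorem contDiff_phase (r : ℝ) :
    ContDiff ℝ ∞ (fun s : ℝ => Complex.exp ((s * r : ℝ) * Complex.I)) :=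
  Complex.contDiff_exp.comp ((Complex.ofRealCLM.contDiff.comp
    (contDiff_id.mul contDiff_const)).mul contDiff_const)

theorem norm_iteratedFDeriv_comp_linear_le {V W F : Type*} [NormedAddCommGroup V] [NormedSpace ℝ V]
    [NormedAddCommGroup W] [NormedSpace ℝ W] [NormedAddCommGroup F] [NormedSpace ℝ F]
    (L : V →L[ℝ] W) (hL : ‖L‖ ≤ 1) {f : W → F} {U : Set W} (hf : ContDiffOn ℝ ∞ f U)
    (hU : IsOpen U) {p : V} (hp : L p ∈ U) (j : ℕ) :
    ‖iteratedFDeriv ℝ j (f ∘ L) p‖ ≤ ‖iteratedFDeriv ℝ j f (L p)‖ := by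
  have hU' : IsOpen (L ⁻¹' U) := hU.preimage L.continuous
  rw [← iteratedFDerivWithin_of_isOpen j hU' hp, ← iteratedFDerivWithin_of_isOpen j hU hp,
    L.iteratedFDerivWithin_comp_right hf hU.uniqueDiffOn hU'.uniqueDiffOn hp
      (by exact_mod_cast le_top)]
  refine (ContinuousMultilinearMap.norm_compContinuousLinearMap_le _ _).trans ?_
  exact mul_le_of_le_one_right (norm_nonneg _)
    (Finset.prod_le_one (fun _ _ => norm_nonneg _) fun _ _ => hL)

/-- Conversely to `exists_rapid_decay`, a family `v` which decreases rapidly, together with its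
derivatives, remains uniformly smooth after multiplication with phases and powers of the weight. -/
theorem isUniformlySmooth_phase_mul {r R : I → ℝ} (hR : ∀ i, |r i| ≤ R i) (hR1 : ∀ i, 1 ≤ R i)
    (hΩ : IsOpen Ω) {v : I → E → ℂ} (hv : ∀ i, ContDiffOn ℝ ∞ (v i) Ω)
    (hb : ∀ K ⊆ Ω, IsCompact K → ∀ k N : ℕ, ∃ C : ℝ, ∀ i, ∀ y ∈ K,
      R i ^ N * ‖iteratedFDeriv ℝ k (v i) y‖ ≤ C) (d : ℕ) :
    IsUniformlySmooth (fun i (p : ℝ × E) => Complex.exp ((p.1 * r i : ℝ) * Complex.I) *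
      (((R i ^ d : ℝ) : ℂ) • v i p.2)) (Set.univ ×ˢ Ω) where
  contDiffOn i := ((contDiff_phase (r i)).comp contDiff_fst).contDiffOn.mul
    (((hv i).comp contDiff_snd.contDiffOn fun p hp => hp.2).const_smul _)
  bound K hKU hK k := by
    have hKΩ : Prod.snd '' K ⊆ Ω := by
      rintro _ ⟨p, hp, rfl⟩
      exact (hKU hp).2
    have hK' : IsCompact (Prod.snd '' K) := hK.image continuous_snd
    choose C hC using fun j => hb _ hKΩ hK' j (k + d)
    refine ⟨∑ j ∈ Finset.range (k + 1), (k.choose j : ℝ) * C (k - j), fun i p hp => ?_⟩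
    have hU : IsOpen ((Set.univ : Set ℝ) ×ˢ Ω) := isOpen_univ.prod hΩ
    have hR0 : 0 ≤ R i := zero_le_one.trans (hR1 i)
    rw [← iteratedFDerivWithin_of_isOpen k hU (hKU hp)]
    refine (norm_iteratedFDerivWithin_mul_le (N := ∞)
      ((contDiff_phase (r i)).comp contDiff_fst).contDiffOn
      (((hv i).comp contDiff_snd.contDiffOn fun p hp => hp.2).const_smul _)
      hU.uniqueDiffOn (hKU hp) (by exact_mod_cast le_top)).trans ?_
    refine Finset.sum_le_sum fun j hj => ?_
    have hjk : j ≤ k := Nat.lt_succ_iff.1 (Finset.mem_range.1 hj)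
    rw [iteratedFDerivWithin_of_isOpen j hU (hKU hp),
      iteratedFDerivWithin_of_isOpen (k - j) hU (hKU hp), mul_assoc]
    gcongr
    have h1 : ‖iteratedFDeriv ℝ j (fun p : ℝ × E => Complex.exp ((p.1 * r i : ℝ) * Complex.I)) p‖ ≤
        R i ^ j := by
      refine (norm_iteratedFDeriv_comp_linear_le (ContinuousLinearMap.fst ℝ ℝ E)
        (ContinuousLinearMap.norm_fst_le ..) (contDiff_phase (r i)).contDiffOn isOpen_univ
        (Set.mem_univ _) j).trans ?_
      rw [norm_iteratedFDeriv_phase]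
      exact pow_le_pow_left₀ (abs_nonneg _) (hR i) j
    have hvi : ContDiffOn ℝ ∞ (fun y => ((R i ^ d : ℝ) : ℂ) • v i y) Ω := (hv i).const_smul _
    have h2 : ‖iteratedFDeriv ℝ (k - j) (fun p : ℝ × E => ((R i ^ d : ℝ) : ℂ) • v i p.2) p‖ ≤
        R i ^ d * ‖iteratedFDeriv ℝ (k - j) (v i) p.2‖ := by
      refine (norm_iteratedFDeriv_comp_linear_le (ContinuousLinearMap.snd ℝ ℝ E)
        (ContinuousLinearMap.norm_snd_le ..) hvi hΩ (hKU hp).2 (k - j)).trans ?_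
      rw [ContinuousLinearMap.coe_snd']
      have hvp : ContDiffAt ℝ (k - j : ℕ) (v i) p.2 :=
        contDiffAt_infty.1 ((hv i).contDiffAt (hΩ.mem_nhds (hKU hp).2)) _
      rw [iteratedFDeriv_const_smul_apply' hvp, norm_smul, Complex.norm_real, Real.norm_eq_abs,
        abs_of_nonneg (by positivity)]
    refine (mul_le_mul h1 h2 (norm_nonneg _) (by positivity)).trans
      (le_trans ?_ (hC (k - j) i p.2 ⟨p, hp, rfl⟩))
    rw [← mul_assoc, ← pow_add]
    gcongr
    exact hR1 i

end Phase

/-! ### Rapidly decreasing families -/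

/-- A sum `∑ wᵢ Lᵢ(f p)` with summable weights is the image of `f p` under the single continuous
linear map `∑ wᵢ Lᵢ`, so no term-by-term differentiation is needed. -/
theorem contDiffOn_of_hasSum_clm {I V X Y : Type*} [NormedAddCommGroup V] [NormedSpace ℝ V]
    [NormedAddCommGroup X] [NormedSpace ℝ X] [NormedAddCommGroup Y] [NormedSpace ℝ Y]
    [CompleteSpace Y] {w : I → ℝ} (hw : Summable w) (hw0 : ∀ i, 0 ≤ w i) {L : I → X →L[ℝ] Y}
    (hL : ∀ i, ‖L i‖ ≤ 1) {f : V → X} {U : Set V} (hf : ContDiffOn ℝ ∞ f U) {φ : V → Y}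
    (hφ : ∀ p ∈ U, HasSum (fun i => w i • L i (f p)) (φ p)) : ContDiffOn ℝ ∞ φ U := by
  have hsum : Summable fun i => w i • L i := by
    refine Summable.of_norm_bounded hw fun i => ?_
    rw [norm_smul (w i) (L i), Real.norm_of_nonneg (hw0 i)]
    exact mul_le_of_le_one_right (hw0 i) (hL i)
  obtain ⟨Λ, hΛ⟩ := hsum
  have happ : ∀ x, HasSum (fun i => w i • L i x) (Λ x) := fun x =>
    hΛ.map (ContinuousLinearMap.apply ℝ Y x) (ContinuousLinearMap.continuous _)
  exact (Λ.contDiff.comp_contDiffOn hf).congr fun p hp => (hφ p hp).unique (happ (f p))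

section RapidlyDecreasing

variable {Γ E T : Type*} [Group Γ] [NormedAddCommGroup E] [NormedSpace ℝ E]
  [TopologicalSpace T] [ChartedSpace E T] {S : Set Γ}
  {t : Γ → C^∞⟮𝓘(ℝ, E), T; 𝓘(ℝ, ℂ), ℂ⟯}

theorem IsRapidlyDecreasing.exists_bound (ht : IsRapidlyDecreasing S t) (J : Finset T)
    {L : T → Set E} (hL : ∀ θ, IsCompact (L θ) ∧ L θ ⊆ (extChartAt 𝓘(ℝ, E) θ).target)
    (k N : ℕ) : ∃ C : ℝ, ∀ θ ∈ J, ∀ i ≤ k, ∀ γ, ∀ y ∈ L θ, (1 + (wordLength S γ : ℝ)) ^ N *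
      ‖iteratedFDeriv ℝ i (fun z => t γ ((extChartAt 𝓘(ℝ, E) θ).symm z)) y‖ ≤ C := by
  choose C hC using fun θ i => ht θ (L θ) (hL θ).1 (hL θ).2 i N
  refine ⟨∑ θ ∈ J, ∑ i ∈ Finset.range (k + 1), |C θ i|, fun θ hθ i hi γ y hy => ?_⟩
  calc _ ≤ C θ i := hC θ i γ y hy
    _ ≤ |C θ i| := le_abs_self _
    _ ≤ ∑ i ∈ Finset.range (k + 1), |C θ i| :=
      Finset.single_le_sum (f := fun i => |C θ i|) (fun _ _ => abs_nonneg _)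
        (Finset.mem_range.2 (Nat.lt_succ_of_le hi))
    _ ≤ _ := Finset.single_le_sum (f := fun θ => ∑ i ∈ Finset.range (k + 1), |C θ i|)
        (fun _ _ => Finset.sum_nonneg fun _ _ => abs_nonneg _) hθ

theorem IsRapidlyDecreasing.exists_bound_zero [FiniteDimensional ℝ E] [CompactSpace T]
    (ht : IsRapidlyDecreasing S t) (N : ℕ) :
    ∃ C : ℝ, ∀ γ θ, (1 + (wordLength S γ : ℝ)) ^ N * ‖t γ θ‖ ≤ C := by
  obtain ⟨J, L, hL, hJ⟩ := exists_compact_chart_cover (E := E) (T := T)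
  obtain ⟨C, hC⟩ := ht.exists_bound J hL 0 N
  refine ⟨C, fun γ x => ?_⟩
  obtain ⟨θ, hθ, hx, hxL⟩ := hJ x
  have h := hC θ hθ 0 le_rfl γ _ hxL
  rwa [norm_iteratedFDeriv_zero, (extChartAt 𝓘(ℝ, E) θ).left_inv hx] at h

theorem contDiffOn_comp_extChartAt_symm [IsManifold 𝓘(ℝ, E) ∞ T] {f : T → ℂ}
    (hf : ContMDiff 𝓘(ℝ, E) 𝓘(ℝ, ℂ) ∞ f) (θ : T) :
    ContDiffOn ℝ ∞ (fun z => f ((extChartAt 𝓘(ℝ, E) θ).symm z)) (extChartAt 𝓘(ℝ, E) θ).target :=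
  contMDiffOn_iff_contDiffOn.1 (hf.comp_contMDiffOn (contMDiffOn_extChartAt_symm θ))

theorem contMDiff_of_contDiffOn_extChartAt_symm [IsManifold 𝓘(ℝ, E) ∞ T] {f : T → ℂ}
    (hf : ∀ θ, ContDiffOn ℝ ∞ (fun z => f ((extChartAt 𝓘(ℝ, E) θ).symm z))
      (extChartAt 𝓘(ℝ, E) θ).target) : ContMDiff 𝓘(ℝ, E) 𝓘(ℝ, ℂ) ∞ f := by
  intro θ
  have h1 : ContMDiffOn 𝓘(ℝ, E) 𝓘(ℝ, ℂ) ∞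
      ((fun z => f ((extChartAt 𝓘(ℝ, E) θ).symm z)) ∘ extChartAt 𝓘(ℝ, E) θ)
      (chartAt E θ).source :=
    (contMDiffOn_iff_contDiffOn.2 (hf θ)).comp contMDiffOn_extChartAt fun x hx =>
      (extChartAt 𝓘(ℝ, E) θ).map_source (by rwa [extChartAt_source])
  refine (h1.congr fun x hx => ?_).contMDiffAt
    ((chartAt E θ).open_source.mem_nhds (mem_chart_source E θ))
  exact congrArg f ((extChartAt 𝓘(ℝ, E) θ).left_inv (by rwa [extChartAt_source])).symm

open Classical in
theorem isRapidlyDecreasing_single [IsManifold 𝓘(ℝ, E) ∞ T] (f : C^∞⟮𝓘(ℝ, E), T; 𝓘(ℝ, ℂ), ℂ⟯)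
    (g : Γ) : IsRapidlyDecreasing S (Pi.single g f) := by
  intro θ K hK hKt k N
  have hopen : IsOpen (extChartAt 𝓘(ℝ, E) θ).target := isOpen_extChartAt_target θ
  obtain ⟨C, hC⟩ := (contDiffOn_comp_extChartAt_symm f.contMDiff
    θ).exists_norm_iteratedFDerivWithin_le hopen hK hKt k
  refine ⟨(1 + (wordLength S g : ℝ)) ^ N * |C|, fun γ y hy => ?_⟩
  by_cases hγ : γ = g
  · subst hγ
    rw [Pi.single_eq_same]
    gcongr
    refine le_trans ?_ ((hC k le_rfl y hy).trans (le_abs_self _))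
    rw [iteratedFDerivWithin_of_isOpen k hopen (hKt hy)]
  · rw [Pi.single_eq_of_ne hγ]
    have h0 : (fun z => (0 : C^∞⟮𝓘(ℝ, E), T; 𝓘(ℝ, ℂ), ℂ⟯) ((extChartAt 𝓘(ℝ, E) θ).symm z)) =
        fun _ => (0 : ℂ) := rfl
    rw [h0, iteratedFDeriv_fun_zero]
    simp only [Pi.zero_apply, norm_zero, mul_zero]
    positivity

variable [CompactSpace T] [MulAction Γᵐᵒᵖ T]

theorem norm_monomial_le (f : C(T, ℂ)) (g : Γ) : ‖monomial f g‖ ≤ ‖f‖ := norm_regularOp_le f g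

theorem IsRapidlyDecreasing.summable_smoothMonomial [FiniteDimensional ℝ E]
    (hΓ : Group.IsVirtuallyNilpotent Γ) (hSfin : S.Finite) (hS : Subgroup.closure S = ⊤)
    (ht : IsRapidlyDecreasing S t) : Summable fun γ => smoothMonomial (t γ) γ := by
  obtain ⟨d, hd⟩ := exists_summable_wordLength hΓ hSfin hS
  obtain ⟨C, hC⟩ := ht.exists_bound_zero d
  refine Summable.of_norm_bounded (hd.mul_left |C|) fun γ => (norm_monomial_le _ _).trans ?_
  rw [ContinuousMap.norm_le _ (by positivity)]
  intro θ
  rw [← div_eq_mul_inv, le_div_iff₀ (by positivity), mul_comm]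
  exact (hC γ θ).trans (le_abs_self C)

theorem coefficient_of_hasSum {a : ReducedCrossedProduct Γ T}
    (h : HasSum (fun γ => smoothMonomial (t γ) γ) a) (γ : Γ) (θ : T) :
    coefficient γ θ a = t γ θ := by
  classical
  have h1 := (coefficient γ θ).hasSum h
  refine h1.unique ?_
  convert hasSum_ite_eq γ (t γ θ) using 2 with g
  rw [smoothMonomial, coefficient_monomial]
  by_cases hg : γ = g
  · subst hg
    simp
  · rw [if_neg hg, if_neg (Ne.symm hg)]

/-- The summand `∑_h c(γ, h) δ_h λ_γ` of the operator on `ℓ²(Γ)` with coefficients `c`. -/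
noncomputable def coefficientShift (γ : Γ) : lp (fun _ : Γ × Γ => ℂ) ∞ →L[ℝ]
    (lp (fun _ : Γ => ℂ) 2 →L[ℂ] lp (fun _ : Γ => ℂ) 2) :=
  LinearMap.mkContinuous
    { toFun := fun c => shiftOp (fun h => c (γ, h)) ‖c‖ (norm_nonneg c)
        (fun h => lp.norm_apply_le_norm ENNReal.top_ne_zero c (γ, h)) γ
      map_add' := fun c c' => by
        ext ξ h
        exact add_mul (c (γ, h)) (c' (γ, h)) (ξ (γ⁻¹ * h))
      map_smul' := fun r c => by
        ext ξ h
        exact smul_mul_assoc r (c (γ, h)) (ξ (γ⁻¹ * h)) }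
    1 fun c => by
      rw [one_mul]
      exact norm_weightedComp_le_const (hC := norm_nonneg c)
        (hc := fun h => lp.norm_apply_le_norm ENNReal.top_ne_zero c (γ, h))

theorem norm_coefficientShift_le (γ : Γ) : ‖coefficientShift γ‖ ≤ 1 :=
  LinearMap.mkContinuous_norm_le _ zero_le_one _

end RapidlyDecreasing

/-! ### The algebra of smooth elements -/

section IsometricAction

variable {Γ E T : Type*} [Group Γ] [NormedAddCommGroup E] [NormedSpace ℝ E]
  [TopologicalSpace T] [ChartedSpace E T] [IsManifold 𝓘(ℝ, E) ∞ T] [MulAction Γᵐᵒᵖ T]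

/-- A right action of `Γ` by smooth isometries of the Riemannian metric `g`. -/
structure IsIsometricAction (Γ : Type*) {E T : Type*} [Group Γ] [NormedAddCommGroup E]
    [NormedSpace ℝ E] [TopologicalSpace T] [ChartedSpace E T] [IsManifold 𝓘(ℝ, E) ∞ T]
    [MulAction Γᵐᵒᵖ T] (g : Bundle.ContMDiffRiemannianMetric 𝓘(ℝ, E) ∞ E
      (fun θ : T => TangentSpace 𝓘(ℝ, E) θ)) : Prop where
  contMDiff : ∀ γ : Γ, ContMDiff 𝓘(ℝ, E) 𝓘(ℝ, E) ∞ (fun θ : T => MulOpposite.op γ • θ)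
  isometry : ∀ (γ : Γ) (θ : T) (v w : E), metricAt g (MulOpposite.op γ • θ)
    (mfderiv 𝓘(ℝ, E) 𝓘(ℝ, E) (fun x : T => MulOpposite.op γ • x) θ v)
    (mfderiv 𝓘(ℝ, E) 𝓘(ℝ, E) (fun x : T => MulOpposite.op γ • x) θ w) = metricAt g θ v w

/-- The translates of a rapidly decreasing family decrease rapidly, uniformly over the group. -/
theorem IsRapidlyDecreasing.exists_bound_translate [FiniteDimensional ℝ E] [CompactSpace T]
    {S : Set Γ} {g : Bundle.ContMDiffRiemannianMetric 𝓘(ℝ, E) ∞ E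
      (fun θ : T => TangentSpace 𝓘(ℝ, E) θ)} (hg : IsIsometricAction Γ g)
    {t : Γ → C^∞⟮𝓘(ℝ, E), T; 𝓘(ℝ, ℂ), ℂ⟯}
    (ht : IsRapidlyDecreasing S t) {θ₀ : T} {K : Set E}
    (hKt : K ⊆ (extChartAt 𝓘(ℝ, E) θ₀).target) (hK : IsCompact K) (k N : ℕ) :
    ∃ C : ℝ, ∀ i : Γ × Γ, ∀ y ∈ K, (1 + (wordLength S i.1 : ℝ)) ^ N *
      ‖iteratedFDeriv ℝ k (fun z => t i.1 (MulOpposite.op i.2⁻¹ •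
        (extChartAt 𝓘(ℝ, E) θ₀).symm z)) y‖ ≤ C := by
  obtain ⟨J, L, hL, hJ⟩ := exists_compact_chart_cover (E := E) (T := T)
  obtain ⟨M, hM0, hM⟩ := exists_norm_iteratedFDeriv_comp_chart_le g hL hJ hK hKt k
  obtain ⟨C, hC⟩ := ht.exists_bound J hL k N
  refine ⟨M * C, fun i y hy => ?_⟩
  have hpos : (0 : ℝ) < (1 + (wordLength S i.1 : ℝ)) ^ N := by positivity
  rw [mul_comm, ← le_div_iff₀ hpos, mul_div_assoc]
  refine hM _ (hg.contMDiff i.2⁻¹) (hg.isometry i.2⁻¹) _ (t i.1).contMDiff _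
    (fun θ hθ j hj w hw => ?_) y hy
  rw [le_div_iff₀ hpos, mul_comm]
  exact hC θ hθ j hj i.1 w hw

end IsometricAction

section SmoothElements

variable {Γ E T : Type*} [Group Γ] [NormedAddCommGroup E] [NormedSpace ℝ E]
  [TopologicalSpace T] [ChartedSpace E T] [CompactSpace T] [MulAction Γᵐᵒᵖ T]
  [ContinuousConstSMul Γᵐᵒᵖ T]

/-- The representations of the crossed product on the orbits, with phase given by the word length,
in the coordinates of the chart at `θ₀`. -/
noncomputable def chartRep (S : Set Γ) (θ₀ : T) (p : ℝ × E) :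
    ReducedCrossedProduct Γ T →ₐ[ℂ] (lp (fun _ : Γ => ℂ) 2 →L[ℂ] lp (fun _ : Γ => ℂ) 2) :=
  orbitRep (fun h => (wordLength S h : ℝ)) p.1 ((extChartAt 𝓘(ℝ, E) θ₀).symm p.2)

/-- The elements `a` of the crossed product for which the operators by which `a` acts on the orbits,
conjugated by the phases `exp(i s ‖·‖)`, depend smoothly on the point and on `s`. -/
noncomputable def smoothElements (E : Type*) {T : Type*} [NormedAddCommGroup E] [NormedSpace ℝ E]
    [TopologicalSpace T] [ChartedSpace E T] [CompactSpace T] [MulAction Γᵐᵒᵖ T]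
    [ContinuousConstSMul Γᵐᵒᵖ T] (S : Set Γ) : Subalgebra ℂ (ReducedCrossedProduct Γ T) :=
  smoothSubalgebra (chartRep (E := E) (T := T) S)
    fun θ₀ => Set.univ ×ˢ (extChartAt 𝓘(ℝ, E) θ₀).target

theorem norm_chartRep_le (S : Set Γ) (θ₀ : T) (p : ℝ × E) (a : ReducedCrossedProduct Γ T) :
    ‖chartRep S θ₀ p a‖ ≤ ‖a‖ := norm_orbitRep_le _ _ _ a

/-- The coefficients of a smooth element are matrix entries of its images under the
representations; the dependence on the phase of the entry at `(1, γ⁻¹)` is `e^{-i s ‖γ‖}`. -/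
theorem coefficient_eq_matrixEntry_chartRep {S : Set Γ} (hS : Subgroup.closure S = ⊤)
    (a : ReducedCrossedProduct Γ T) (θ₀ : T) (γ : Γ) (p : ℝ × E) :
    matrixEntry 1 γ⁻¹ (chartRep S θ₀ p a) =
      Complex.exp ((p.1 * (-(wordLength S γ : ℝ)) : ℝ) * Complex.I) *
        coefficient γ ((extChartAt 𝓘(ℝ, E) θ₀).symm p.2) a := by
  rw [chartRep, matrixEntry_orbitRep, wordLength_one, wordLength_inv hS]
  simp

variable {S : Set Γ} [FiniteDimensional ℝ E] [IsManifold 𝓘(ℝ, E) ∞ T]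

/-- Rapidly decreasing sums are smooth elements. The phase and the translates of the coefficients
are bounded uniformly with all their derivatives, since `|‖h‖ - ‖γ⁻¹ h‖| ≤ ‖γ‖` and `Γ` acts by
isometries; the powers of `1 + ‖γ‖` that occur are absorbed by the rapid decrease. -/
theorem mem_smoothElements_of_hasSum {g : Bundle.ContMDiffRiemannianMetric 𝓘(ℝ, E) ∞ E
      (fun θ : T => TangentSpace 𝓘(ℝ, E) θ)}
    (hg : IsIsometricAction Γ g) (hΓ : Group.IsVirtuallyNilpotent Γ) (hSfin : S.Finite)
    (hS : Subgroup.closure S = ⊤) {t : Γ → C^∞⟮𝓘(ℝ, E), T; 𝓘(ℝ, ℂ), ℂ⟯}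
    (ht : IsRapidlyDecreasing S t) {a : ReducedCrossedProduct Γ T}
    (ha : HasSum (fun γ => smoothMonomial (t γ) γ) a) : a ∈ smoothElements E S := by
  intro θ₀
  obtain ⟨d, hd⟩ := exists_summable_wordLength hΓ hSfin hS
  have hΩ : IsOpen (extChartAt 𝓘(ℝ, E) θ₀).target := isOpen_extChartAt_target θ₀
  have hu := isUniformlySmooth_phase_mul
    (r := fun i : Γ × Γ => (wordLength S i.2 : ℝ) - wordLength S (i.1⁻¹ * i.2))
    (R := fun i : Γ × Γ => 1 + (wordLength S i.1 : ℝ))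
    (v := fun i y => t i.1 (MulOpposite.op i.2⁻¹ • (extChartAt 𝓘(ℝ, E) θ₀).symm y))
    (fun i => (abs_wordLength_sub_le hS i.1 i.2).trans (by simp))
    (fun i => by simp) hΩ
    (fun i => contDiffOn_comp_extChartAt_symm ((t i.1).contMDiff.comp (hg.contMDiff i.2⁻¹)) θ₀)
    (fun K hKt hK k N => ht.exists_bound_translate hg hKt hK k N) d
  set u := fun (i : Γ × Γ) (p : ℝ × E) =>
    Complex.exp ((p.1 * ((wordLength S i.2 : ℝ) - wordLength S (i.1⁻¹ * i.2)) : ℝ) * Complex.I) *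
      ((((1 + (wordLength S i.1 : ℝ)) ^ d : ℝ) : ℂ) •
        t i.1 (MulOpposite.op i.2⁻¹ • (extChartAt 𝓘(ℝ, E) θ₀).symm p.2)) with hu_def
  refine contDiffOn_of_hasSum_clm hd (fun γ => by positivity) norm_coefficientShift_le
    (hu.contDiffOn_toLinfty (isOpen_univ.prod hΩ)) fun p hp => ?_
  have h1 : HasSum (fun γ => chartRep S θ₀ p (smoothMonomial (t γ) γ)) (chartRep S θ₀ p a) :=
    (orbitCompress (fun h => (wordLength S h : ℝ)) p.1
      ((extChartAt 𝓘(ℝ, E) θ₀).symm p.2)).hasSum ha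
  suffices key : ∀ γ,
      ((((1 + (wordLength S γ : ℝ)) ^ d)⁻¹ : ℝ) • coefficientShift γ (toLinfty u p)) =
      chartRep S θ₀ p (smoothMonomial (t γ) γ) from
    (congrArg (fun s => HasSum s (chartRep S θ₀ p a)) (funext key)).mpr h1
  intro γ
  ext ξ h
  have h3 : chartRep S θ₀ p (smoothMonomial (t γ) γ) ξ h =
      orbitWeight (fun h => (wordLength S h : ℝ)) p.1 ((extChartAt 𝓘(ℝ, E) θ₀).symm p.2)
        (t γ) γ h * ξ (γ⁻¹ * h) :=
    congrArg (fun A : lp (fun _ : Γ => ℂ) 2 →L[ℂ] lp (fun _ : Γ => ℂ) 2 => A ξ h)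
      (orbitCompress_monomial _ _ _ _ γ)
  have h4 : ((((1 + (wordLength S γ : ℝ)) ^ d)⁻¹ : ℝ) • coefficientShift γ (toLinfty u p)) ξ h =
      (((1 + (wordLength S γ : ℝ)) ^ d)⁻¹ : ℝ) • (toLinfty u p (γ, h) * ξ (γ⁻¹ * h)) := rfl
  refine Eq.trans h4 (Eq.trans ?_ h3.symm)
  rw [hu.toLinfty_apply hp, orbitWeight, Complex.real_smul, hu_def]
  simp only [smul_eq_mul]
  have hne : ((((1 + (wordLength S γ : ℝ)) ^ d : ℝ) : ℂ)) ≠ 0 :=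
    Complex.ofReal_ne_zero.2 (by positivity)
  rw [Complex.ofReal_inv]
  field_simp

/-- The coefficients of a smooth element decrease rapidly: each derivative in the phase variable
`s` multiplies the coefficient at `γ` by `-i ‖γ‖`, and stays bounded on compact sets. -/
theorem exists_hasSum_of_mem_smoothElements (hΓ : Group.IsVirtuallyNilpotent Γ) (hSfin : S.Finite)
    (hS : Subgroup.closure S = ⊤) {a : ReducedCrossedProduct Γ T} (ha : a ∈ smoothElements E S) :
    a ∈ rapidlyDecreasingSet E T S := by
  have hτ : ∀ γ θ₀, ContDiffOn ℝ ∞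
      (fun z => coefficient γ ((extChartAt 𝓘(ℝ, E) θ₀).symm z) a)
        (extChartAt 𝓘(ℝ, E) θ₀).target := by
    intro γ θ₀
    have h1 : ContDiffOn ℝ ∞ (fun z => chartRep S θ₀ ((0 : ℝ), z) a)
        (extChartAt 𝓘(ℝ, E) θ₀).target :=
      (ha θ₀).comp (contDiff_prodMk_right (0 : ℝ)).contDiffOn fun y hy => ⟨trivial, hy⟩
    refine (((matrixEntry 1 γ⁻¹).restrictScalars ℝ).contDiff.comp_contDiffOn h1).congr
      fun z _ => ?_
    refine Eq.trans ?_ (coefficient_eq_matrixEntry_chartRep hS a θ₀ γ (0, z)).symm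
    simp
  let t : Γ → C^∞⟮𝓘(ℝ, E), T; 𝓘(ℝ, ℂ), ℂ⟯ := fun γ =>
    ⟨fun θ => coefficient γ θ a, contMDiff_of_contDiffOn_extChartAt_symm (hτ γ)⟩
  have ht : IsRapidlyDecreasing S t := by
    intro θ₀ K hK hKt k N
    have hdecay : ∀ N, ∃ C : ℝ, ∀ γ, ∀ y ∈ K, |(-(wordLength S γ : ℝ))| ^ N *
        ‖iteratedFDeriv ℝ k (fun z => t γ ((extChartAt 𝓘(ℝ, E) θ₀).symm z)) y‖ ≤ C := fun N =>
      exists_rapid_decay (ev := fun γ : Γ => (matrixEntry 1 γ⁻¹).restrictScalars ℝ)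
        (fun γ => (ContinuousLinearMap.norm_restrictScalars _).trans_le (norm_matrixEntry_le _ _))
        (fun γ => -(wordLength S γ : ℝ)) (isOpen_extChartAt_target θ₀) hK hKt k N (ha θ₀)
        fun γ s y _ => coefficient_eq_matrixEntry_chartRep hS a θ₀ γ (s, y)
    obtain ⟨C₀, hC₀⟩ := hdecay 0
    obtain ⟨C, hC⟩ := hdecay N
    refine ⟨2 ^ (N - 1) * (C₀ + C), fun γ y hy => ?_⟩
    have h0 := hC₀ γ y hy
    have h1 := hC γ y hy
    rw [abs_neg, abs_of_nonneg (Nat.cast_nonneg _)] at h0 h1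
    rw [pow_zero] at h0
    calc _ ≤ (2 ^ (N - 1) * (1 ^ N + (wordLength S γ : ℝ) ^ N)) * _ := by
          gcongr
          exact add_pow_le zero_le_one (Nat.cast_nonneg _) N
      _ = 2 ^ (N - 1) * (1 * ‖iteratedFDeriv ℝ k
            (fun z => t γ ((extChartAt 𝓘(ℝ, E) θ₀).symm z)) y‖ + (wordLength S γ : ℝ) ^ N *
          ‖iteratedFDeriv ℝ k (fun z => t γ ((extChartAt 𝓘(ℝ, E) θ₀).symm z)) y‖) := by ring
      _ ≤ _ := by gcongr
  obtain ⟨b, hb⟩ := ht.summable_smoothMonomial hΓ hSfin hS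
  refine ⟨t, ht, ?_⟩
  rwa [show a = b from eq_of_coefficient_eq fun γ θ => (coefficient_of_hasSum hb γ θ).symm]

/-- Smooth functions are dense in the continuous ones, so that the smooth elements are dense as soon
as they contain the monomials with smooth coefficients. -/
theorem dense_of_smoothMonomial_mem [T2Space T] {A : Subalgebra ℂ (ReducedCrossedProduct Γ T)}
    (hA : ∀ (f : C^∞⟮𝓘(ℝ, E), T; 𝓘(ℝ, ℂ), ℂ⟯) (γ : Γ), smoothMonomial f γ ∈ A) :
    Dense (A : Set (ReducedCrossedProduct Γ T)) := by
  have hmon : ∀ (f : C(T, ℂ)) (γ : Γ), monomial f γ ∈ A.topologicalClosure := by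
    intro f γ
    refine Metric.mem_closure_iff.2 fun ε hε => ?_
    obtain ⟨f', hf', -⟩ := f.continuous.exists_contMDiff_approx 𝓘(ℝ, E) ⊤
      (continuous_const (y := ε / 2)) fun _ => half_pos hε
    refine ⟨smoothMonomial f' γ, hA f' γ, ?_⟩
    have h1 : monomial f γ - smoothMonomial f' γ =
        monomial (f - ⟨f', f'.contMDiff.continuous⟩) γ := Subtype.ext (regularOp_sub f _ γ)
    rw [dist_eq_norm, h1]
    refine (norm_monomial_le _ _).trans_lt (lt_of_le_of_lt ?_ (half_lt_self hε))
    rw [ContinuousMap.norm_le _ (half_pos hε).le]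
    intro θ
    have h2 := (hf' θ).le
    rwa [dist_comm, dist_eq_norm] at h2
  have hspan : (Submodule.span ℂ (Set.range fun p : C(T, ℂ) × Γ => monomial p.1 p.2)) ≤
      A.topologicalClosure.toSubmodule :=
    Submodule.span_le.2 (by rintro _ ⟨⟨f, γ⟩, rfl⟩; exact hmon f γ)
  have hd := dense_span_monomial.mono hspan
  exact dense_closure.1 hd

end SmoothElements

theorem mainTheorem10 {Γ E T : Type*} [Group Γ] (hΓ : Group.IsVirtuallyNilpotent Γ)
    (S : Set Γ) (hSfin : S.Finite) (hS : Subgroup.closure S = ⊤)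
    [NormedAddCommGroup E] [NormedSpace ℝ E] [FiniteDimensional ℝ E]
    [TopologicalSpace T] [ChartedSpace E T] [IsManifold 𝓘(ℝ, E) ∞ T]
    [T2Space T] [CompactSpace T] [ConnectedSpace T] [MulAction Γᵐᵒᵖ T]
    (hsmooth : ∀ γ : Γ,
      ContMDiff 𝓘(ℝ, E) 𝓘(ℝ, E) ∞ (fun θ : T => MulOpposite.op γ • θ))
    (g : Bundle.ContMDiffRiemannianMetric 𝓘(ℝ, E) ∞ E
      (fun θ : T => TangentSpace 𝓘(ℝ, E) θ))
    (hg : ∀ (γ : Γ) (θ : T) (v w : TangentSpace 𝓘(ℝ, E) θ),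
      g.inner (MulOpposite.op γ • θ)
        (mfderiv 𝓘(ℝ, E) 𝓘(ℝ, E) (fun x : T => MulOpposite.op γ • x) θ v)
        (mfderiv 𝓘(ℝ, E) 𝓘(ℝ, E) (fun x : T => MulOpposite.op γ • x) θ w) =
      g.inner θ v w) :
    (∀ t : Γ → C^∞⟮𝓘(ℝ, E), T; 𝓘(ℝ, ℂ), ℂ⟯, IsRapidlyDecreasing S t →
      Summable fun γ => smoothMonomial (t γ) γ) ∧
    Set.InjOn (fun t : Γ → C^∞⟮𝓘(ℝ, E), T; 𝓘(ℝ, ℂ), ℂ⟯ => ∑' γ, smoothMonomial (t γ) γ)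
      {t | IsRapidlyDecreasing S t} ∧
    ∃ A : Subalgebra ℂ (ReducedCrossedProduct Γ T),
      (A : Set (ReducedCrossedProduct Γ T)) = rapidlyDecreasingSet E T S ∧
      IsClosedUnderHolomorphicCalculus A ∧
      Function.Bijective (KZero.map (A.val : A →+* ReducedCrossedProduct Γ T)) := by
  have : ContinuousConstSMul Γᵐᵒᵖ T := ⟨fun γ => (hsmooth γ.unop).continuous⟩
  have hact : IsIsometricAction Γ g := ⟨hsmooth, hg⟩
  have hmem : ∀ {t : Γ → C^∞⟮𝓘(ℝ, E), T; 𝓘(ℝ, ℂ), ℂ⟯} {a : ReducedCrossedProduct Γ T},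
      IsRapidlyDecreasing S t → HasSum (fun γ => smoothMonomial (t γ) γ) a →
        a ∈ smoothElements E S := fun ht ha =>
    mem_smoothElements_of_hasSum hact hΓ hSfin hS ht ha
  have hdense : Dense ((smoothElements E S : Subalgebra ℂ (ReducedCrossedProduct Γ T)) :
      Set (ReducedCrossedProduct Γ T)) := by
    classical
    refine dense_of_smoothMonomial_mem (E := E) fun f γ =>
      hmem (isRapidlyDecreasing_single f γ) ?_
    convert hasSum_single (f := fun γ' => smoothMonomial
      ((Pi.single γ f : Γ → C^∞⟮𝓘(ℝ, E), T; 𝓘(ℝ, ℂ), ℂ⟯) γ') γ') γ fun γ' hγ' => ?_ using 1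
    · rw [Pi.single_eq_same]
    · rw [Pi.single_eq_of_ne hγ']
      refine norm_le_zero_iff.1 ((norm_monomial_le _ γ').trans (le_of_eq ?_))
      exact norm_eq_zero.2 rfl
  refine ⟨fun t ht => ht.summable_smoothMonomial hΓ hSfin hS, fun t ht t' ht' h => ?_,
    smoothElements E S, ?_, isClosedUnderHolomorphicCalculus_smoothSubalgebra (norm_chartRep_le S),
    bijective_kZeroMap (bijective_vMonoidMap hdense
      (isStableOnMatrices_smoothSubalgebra (norm_chartRep_le S)))⟩
  · have h1 := (ht.summable_smoothMonomial hΓ hSfin hS).hasSum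
    have h2 := (ht'.summable_smoothMonomial hΓ hSfin hS).hasSum
    beta_reduce at h
    rw [← h] at h2
    funext γ
    ext θ
    rw [← coefficient_of_hasSum h1, ← coefficient_of_hasSum h2]
  · ext a
    exact ⟨exists_hasSum_of_mem_smoothElements hΓ hSfin hS, fun ⟨t, ht, ha⟩ => hmem ht ha⟩
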